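/- **Conventions.** Let $\mathbb X$ be a virtual equipment, i.e. a virtual double category (with strictly associative tight-cells $f$, loose-cells $p$, and 2-cells from chains $p_1,\dots,p_n$, $n\ge 0$, of loose-cells to a single loose-cell) with loose-identities and all restrictions $q(f,g)$ of loose-cells along tight-cells; a choice of these is fixed. $E(f,g)$ denotes the restriction of the loose-identity of $E$; a 2-cell $f\Rightarrow g$ of parallel tight-cells is a nullary 2-cell into the loose-identity of the codomain (equivalently a 2-cell $E(1,f)\Rightarrow E(1,g)$). Composition $f\mathbin{;}g$ of tight-cells is diagrammatic. Fix a tight-cell $j\colon A\to E$. * A *$j$-monad* $T$ is a tight-cell $t\colon A\to E$ with 2-cells $\eta\colon j\Rightarrow t$ and $\dag\colon E(j,t)\Rightarrow E(t,t)$ satisfying two unit laws and an associativity law. A morphism $T\to T'$ is a 2-cell $\tau\colon t\Rightarrow t'$ compatible with the units and extension operators. This gives a category $\mathbf{RMnd}(j)$. * A *$j$-adjunction* $\ell\dashv_j r$ consists of tight-cells $\ell\colon A\to C$, $r\colon C\to E$ and an invertible 2-cell $\sharp\colon C(\ell,1)\cong E(j,r)$ with inverse $\flat$. A *right-morphism*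 from $\ell\dashv_j r$ to $\ell'\dashv_j r'$ is a tight-cell $c\colon C\to C'$ with $\ell\mathbin{;}c=\ell'$ and a 2-cell $\rho\colon r\Rightarrow c\mathbin{;}r'$ such that $C(\ell,1)\xrightarrow{\sharp}E(j,r)\xrightarrow{E(j,\rho)}E(j,c\mathbin{;}r')$ equals $C(\ell,1)\xrightarrow{c}C'(\ell',c)\xrightarrow{\sharp'}E(j,c\mathbin{;}r')$; it is *strict* if $r=c\mathbin{;}r'$ and $\rho$ is the identity. This gives a category $\mathbf{RAdj}_R(j)$, and a functor $\oslash_j\colon\mathbf{RAdj}_R(j)\to\mathbf{RMnd}(j)$ sending $\ell\dashv_j r$ to the $j$-monad it induces on $\ell\mathbin{;}r$ (unit: the image of $1_\ell$ under $\sharp$; extension operator $E(j,\ell\mathbin{;}r)\xrightarrow{\flat}C(\ell,\ell)\xrightarrow{r}E(\ell\mathbin{;}r,\ell\mathbin{;}r)$) and $(c,\rho)$ to its whiskering $\ell\mathbin{;}\rho$. * $\mathbf{Res}(T)$ is the category of *resolutions* of $T$, i.e. $j$-adjunctions $\ell\dashv_j r$ with $\oslash_j(\ell\dashv_j r)=T$,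 with morphisms the tight-cells $c$ such that $\ell\mathbin{;}c=\ell'$ and $c\mathbin{;}r'=r$. * A *$T$-opalgebra* is a tight-cell $a\colon A\to B$ with a 2-cell $\ltimes\colon E(j,t)\Rightarrow B(a,a)$ compatible with $\eta$ and $\dag$; in particular $(t,\dag)$ is one. It has an associated action $E(j,t),B(1,a)\Rightarrow B(1,a)$. For a chain $P$ of loose-cells from $B$ to $B'$, a *$P$-graded morphism* $(a,\ltimes)\to(a',\ltimes')$ is a 2-cell $B(1,a),P\Rightarrow B'(1,a')$ commuting with the actions (chains are written from left to right). An *opalgebra object* for $T$ is a $T$-opalgebra $(k_T\colon A\to\mathbf{Opalg}(T),\ltimes_T)$ such that (i) for every $T$-opalgebra $(a,\ltimes)$ there is a unique tight-cell $[]_{\ltimes}$ with $k_T\mathbin{;}[]_\ltimes=a$ and $\ltimes_T\mathbin{;}[]_\ltimes=\ltimes$; and (ii) every graded morphism $\alpha\colon B(1,a),P\Rightarrow B'(1,a')$ is the restriction along $k_T$ of a unique 2-cell $B(1,[]_{\ltimes}),P\Rightarrow B'(1,[]_{\ltimes'})$. Write $v_T=[]_\dag\colon\mathbf{Opalg}(T)\to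 E$. * $j$ is *dense* if the identity $1_j\colon j\Rightarrow j$ exhibits $1_E$ as the pointwise left extension of $j$ along $j$, i.e. the canonical 2-cell $E(1,1),E(j,1)\Rightarrow E(j,1)$ exhibits $E(1,1)$ as the right lift of $E(j,1)$ through $E(j,1)$. $A/\mathbb X$ is the category of strict coslices: tight-cells out of $A$ and strictly commuting triangles. **Theorem.** Let $\mathbb X$ be a virtual equipment and $j\colon A\to E$ a tight-cell, and let $\mathcal D\subseteq\mathbf{RMnd}(j)$ be the full subcategory of $j$-monads admitting an opalgebra object. For any choice of an opalgebra object $(k_T,\ltimes_T)$ for each $T\in\mathcal D$, there is a functor $S\colon\mathcal D\to\mathbf{RAdj}_R(j)$ such that: 1. For every $T\in\mathcal D$, $S(T)$ is a $j$-adjunction $k_T\dashv_j v_T$ with apex $\mathbf{Opalg}(T)$, and $\oslash_j\circ S$ is equal to the inclusion $\mathcal D\hookrightarrow\mathbf{RMnd}(j)$. 2. $S$ is a partial left adjoint section of $\oslash_j$: for every $T\in\mathcal D$ and every $j$-adjunction $\ell'\dashv_j r'$, transposition $$\mathbf{RAdj}_R(j)\bigl(k_T\dashv_j v_T,\ \ell'\dashv_j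 r'\bigr)\longrightarrow\mathbf{RMnd}(j)\bigl(T,\ \oslash_j(\ell'\dashv_j r')\bigr),\qquad f\mapsto\oslash_j(f),$$ is a bijection. 3. For $T\in\mathcal D$, a right-morphism $f$ from $k_T\dashv_j v_T$ to $\ell'\dashv_j r'$ is strict if and only if $T=\oslash_j(\ell'\dashv_j r')$ and the transpose $\oslash_j(f)$ is the identity. 4. For every $T\in\mathcal D$, the resolution $k_T\dashv_j v_T$ is an initial object of $\mathbf{Res}(T)$. 5. If $j$ is dense, then the functor $k_{(-)}\colon\mathcal D\to A/\mathbb X$, obtained by composing $S$ with the functor sending a $j$-adjunction to its left adjoint and a right-morphism $(c,\rho)$ to $c$, is fully faithful. -/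

import Mathlib

open CategoryTheory

universe w z v u

namespace FormalCat

/-- Finite chains of composable loose-cells, listed from left to right (as they appear at the top
of a pasting diagram). Tight-cells compose diagrammatically, `f ≫ g`. -/
inductive LoosePath {X : Type u} (L : X → X → Type w) : X → X → Type (max u w)
  | nil (a : X) : LoosePath L a a
  | cons {a b c : X} (p : L a b) (P : LoosePath L b c) : LoosePath L a c

namespace LoosePath

variable {X : Type u} {L : X → X → Type w}

/-- Concatenation of chains. -/
def append {a b c : X} : LoosePath L a b → LoosePath L b c → LoosePath L a c
  | nil _, Q => Q
  | cons p P, Q => cons p (append P Q)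

/-- The chain consisting of one loose-cell. -/
abbrev single {a b : X} (p : L a b) : LoosePath L a b := cons p (nil b)

/-- The chain consisting of two loose-cells. -/
abbrev pair {a b c : X} (p : L a b) (q : L b c) : LoosePath L a c := cons p (single q)

theorem nil_append {a b : X} (P : LoosePath L a b) : (nil a).append P = P :=
  rfl

theorem single_append {a b c : X} (p : L a b) (P : LoosePath L b c) :
    (single p).append P = cons p P :=
  rfl

theorem append_nil {a b : X} (P : LoosePath L a b) : P.append (nil b) = P := by
  induction P with
  | nil => rfl
  | cons p P ih => exact congrArg (cons p) ih

theorem append_assoc {a b c d : X} (P : LoosePath L a b) (Q : LoosePath L b c)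
    (R : LoosePath L c d) : (P.append Q).append R = P.append (Q.append R) := by
  induction P with
  | nil => rfl
  | cons p P ih => exact congrArg (cons p) (ih Q)

end LoosePath

/-- The underlying data of a virtual double category whose category of objects and tight-cells
is `X`: loose-cells, and 2-cells `Cell f P g q` with left tight-cell `f`, right tight-cell `g`,
a chain `P` of loose-cells on top and a single loose-cell `q` on the bottom. -/
class VDCData (X : Type u) [Category.{v} X] where
  Loose : X → X → Type w
  Cell : ∀ {a b a' b' : X}, (a ⟶ a') → LoosePath Loose a b → (b ⟶ b') → Loose a' b' → Type z
  /-- The identity 2-cell of a loose-cell. -/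
  cellId : ∀ {a b : X} (q : Loose a b), Cell (𝟙 a) (.single q) (𝟙 b) q

open VDCData

section Rows

variable {X : Type u} [Category.{v} X] [VDCData.{w, z} X]

/-- Horizontally adjacent sequences of 2-cells. -/
inductive Row : ∀ {a b a' b' : X}, (a ⟶ a') → LoosePath (Loose (X := X)) a b → (b ⟶ b') →
    LoosePath (Loose (X := X)) a' b' → Type (max u v w z)
  | nil {a a' : X} (f : a ⟶ a') : Row f (.nil a) f (.nil a')
  | cons {a b c a' b' c' : X} {f : a ⟶ a'} {g : b ⟶ b'} {h : c ⟶ c'}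
      {P : LoosePath Loose a b} {P' : LoosePath Loose b c} {P'' : LoosePath Loose a c}
      {q : Loose a' b'} {Q : LoosePath Loose b' c'}
      (φ : Cell f P g q) (Φ : Row g P' h Q) (hP : P.append P' = P'') : Row f P'' h (.cons q Q)

namespace Row

/-- The row consisting of one 2-cell. -/
def single {a b a' b' : X} {f : a ⟶ a'} {g : b ⟶ b'} {P : LoosePath Loose a b}
    {q : Loose a' b'} (φ : Cell f P g q) : Row f P g (.single q) :=
  .cons φ (.nil g) P.append_nil

/-- The row consisting of two 2-cells. -/
def pair {a b c a' b' c' : X} {f : a ⟶ a'} {g : b ⟶ b'} {h : c ⟶ c'}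
    {P : LoosePath Loose a b} {Q : LoosePath Loose b c} {R : LoosePath Loose a c}
    {p : Loose a' b'} {q : Loose b' c'} (φ : Cell f P g p) (ψ : Cell g Q h q)
    (hR : P.append Q = R) : Row f R h (.pair p q) :=
  .cons φ (.single ψ) hR

/-- The row consisting of two unary 2-cells. -/
abbrev pair₁ {a b c a' b' c' : X} {f : a ⟶ a'} {g : b ⟶ b'} {h : c ⟶ c'}
    {P : Loose a b} {Q : Loose b c} {p : Loose a' b'} {q : Loose b' c'}
    (φ : Cell f (.single P) g p) (ψ : Cell g (.single Q) h q) :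
    Row f (.pair P Q) h (.pair p q) :=
  .pair φ ψ (LoosePath.single_append P (.single Q))

/-- The row of identity 2-cells on a chain. -/
def ids {a b : X} : (P : LoosePath (Loose (X := X)) a b) → Row (𝟙 a) P (𝟙 b) P
  | .nil a => .nil (𝟙 a)
  | .cons p P => .cons (cellId p) (ids P) rfl

/-- Horizontal juxtaposition of rows. -/
def append {a b c a' b' c' : X} {f : a ⟶ a'} {g : b ⟶ b'} {h : c ⟶ c'}
    {P : LoosePath Loose a b} {P' : LoosePath Loose b c} {P'' : LoosePath Loose a c}
    {Q : LoosePath Loose a' b'} {Q' : LoosePath Loose b' c'} :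
    Row f P g Q → Row g P' h Q' → P.append P' = P'' → Row f P'' h (Q.append Q')
  | .nil _, Ψ, hP => hP ▸ Ψ
  | .cons φ Φ hΦ, Ψ, hP =>
      .cons φ (append Φ Ψ rfl) (by rw [← hP, ← hΦ, LoosePath.append_assoc])

end Row

/-- Two vertically composable rows of 2-cells, the upper one being subdivided into blocks, one
block above each 2-cell of the lower row. -/
inductive BlockRow : ∀ {a b a' b' a'' b'' : X}, (a ⟶ a') → (a' ⟶ a'') →
    LoosePath (Loose (X := X)) a b → LoosePath (Loose (X := X)) a' b' →
    LoosePath (Loose (X := X)) a'' b'' → (b ⟶ b') → (b' ⟶ b'') → Type (max u v w z)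
  | nil {a a' a'' : X} (f : a ⟶ a') (f' : a' ⟶ a'') :
      BlockRow f f' (.nil a) (.nil a') (.nil a'') f f'
  | cons {a b c a' b' c' a'' b'' c'' : X} {f : a ⟶ a'} {f' : a' ⟶ a''} {g : b ⟶ b'}
      {g' : b' ⟶ b''} {h : c ⟶ c'} {h' : c' ⟶ c''}
      {P : LoosePath Loose a b} {P' : LoosePath Loose b c} {P'' : LoosePath Loose a c}
      {Q : LoosePath Loose a' b'} {Q' : LoosePath Loose b' c'}
      {r : Loose a'' b''} {R : LoosePath Loose b'' c''}
      (Φ : Row f P g Q) (ψ : Cell f' Q g' r) (B : BlockRow g g' P' Q' R h h')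
      (hP : P.append P' = P'') :
      BlockRow f f' P'' (Q.append Q') (.cons r R) h h'

namespace BlockRow

/-- The upper row. -/
def upper {a b a' b' a'' b'' : X} {f : a ⟶ a'} {f' : a' ⟶ a''} {P : LoosePath Loose a b}
    {Q : LoosePath Loose a' b'} {R : LoosePath Loose a'' b''} {g : b ⟶ b'} {g' : b' ⟶ b''} :
    BlockRow f f' P Q R g g' → Row f P g Q
  | .nil f _ => .nil f
  | .cons Φ _ B hP => Φ.append B.upper hP

/-- The lower row. -/
def lower {a b a' b' a'' b'' : X} {f : a ⟶ a'} {f' : a' ⟶ a''} {P : LoosePath Loose a b}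
    {Q : LoosePath Loose a' b'} {R : LoosePath Loose a'' b''} {g : b ⟶ b'} {g' : b' ⟶ b''} :
    BlockRow f f' P Q R g g' → Row f' Q g' R
  | .nil _ f' => .nil f'
  | .cons _ ψ B _ => .cons ψ B.lower rfl

/-- The row obtained by composing each 2-cell of the lower row with the block above it, for a
given composition operation. -/
def composite
    (comp : ∀ {a b a' b' a'' b'' : X} {f : a ⟶ a'} {P : LoosePath Loose a b} {g : b ⟶ b'}
      {Q : LoosePath Loose a' b'} {f' : a' ⟶ a''} {g' : b' ⟶ b''} {r : Loose a'' b''}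
      {f'' : a ⟶ a''} {g'' : b ⟶ b''}, Row f P g Q → Cell f' Q g' r →
      f ≫ f' = f'' → g ≫ g' = g'' → Cell f'' P g'' r)
    {a b a' b' a'' b'' : X} {f : a ⟶ a'} {f' : a' ⟶ a''} {P : LoosePath Loose a b}
    {Q : LoosePath Loose a' b'} {R : LoosePath Loose a'' b''} {g : b ⟶ b'} {g' : b' ⟶ b''} :
    BlockRow f f' P Q R g g' → Row (f ≫ f') P (g ≫ g') R
  | .nil f f' => .nil (f ≫ f')
  | .cons Φ ψ B hP => .cons (comp Φ ψ rfl rfl) (B.composite comp) hP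

end BlockRow

end Rows

/-- A virtual double category with category of objects and tight-cells `X`.  Since composition of
tight-cells is associative and unital, the frame of a composite 2-cell may be presented in several
equal ways; `comp` takes equations identifying the left and right boundaries of the composite. -/
class VirtualDoubleCategory (X : Type u) [Category.{v} X] extends VDCData.{w, z} X where
  /-- The composite of a row of 2-cells with a 2-cell below it. -/
  comp : ∀ {a b a' b' a'' b'' : X} {f : a ⟶ a'} {P : LoosePath Loose a b} {g : b ⟶ b'}
    {Q : LoosePath Loose a' b'} {f' : a' ⟶ a''} {g' : b' ⟶ b''} {r : Loose a'' b''}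
    {f'' : a ⟶ a''} {g'' : b ⟶ b''}, Row f P g Q → Cell f' Q g' r →
    f ≫ f' = f'' → g ≫ g' = g'' → Cell f'' P g'' r
  comp_cellId : ∀ {a b a' b' : X} {f : a ⟶ a'} {P : LoosePath Loose a b} {g : b ⟶ b'}
    {q : Loose a' b'} (φ : Cell f P g q),
    comp (.single φ) (cellId q) (Category.comp_id f) (Category.comp_id g) = φ
  ids_comp : ∀ {a b a' b' : X} {f : a ⟶ a'} {P : LoosePath Loose a b} {g : b ⟶ b'}
    {q : Loose a' b'} (φ : Cell f P g q),
    comp (Row.ids P) φ (Category.id_comp f) (Category.id_comp g) = φ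
  comp_assoc : ∀ {a b a' b' a'' b'' a₃ b₃ : X} {f : a ⟶ a'} {f' : a' ⟶ a''}
    {P : LoosePath Loose a b} {Q : LoosePath Loose a' b'} {R : LoosePath Loose a'' b''}
    {g : b ⟶ b'} {g' : b' ⟶ b''} (B : BlockRow f f' P Q R g g')
    {f'' : a'' ⟶ a₃} {g'' : b'' ⟶ b₃} {s : Loose a₃ b₃} (χ : Cell f'' R g'' s),
    comp B.upper (comp B.lower χ rfl rfl) rfl rfl =
      comp (B.composite comp) χ (Category.assoc f f' f'') (Category.assoc g g' g'')

open VirtualDoubleCategory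

section VDC

variable {X : Type u} [Category.{v} X] [VirtualDoubleCategory.{w, z} X]

/-- Vertical composition of two 2-cells. -/
def vcomp {a b a' b' a'' b'' : X} {f : a ⟶ a'} {P : LoosePath Loose a b} {g : b ⟶ b'}
    {q : Loose a' b'} {f' : a' ⟶ a''} {g' : b' ⟶ b''} {r : Loose a'' b''}
    {f'' : a ⟶ a''} {g'' : b ⟶ b''} (φ : Cell f P g q) (ψ : Cell f' (.single q) g' r)
    (hf : f ≫ f' = f'') (hg : g ≫ g' = g'') : Cell f'' P g'' r :=
  comp (.single φ) ψ hf hg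

/-- The row with `χ` in the middle and identities on the left and on the right. -/
def Row.context {a b c d : X} (L : LoosePath Loose a b) {Q : LoosePath Loose b c}
    {q : Loose b c} (χ : Cell (𝟙 b) Q (𝟙 c) q) (R : LoosePath Loose c d) :
    Row (𝟙 a) (L.append (Q.append R)) (𝟙 d) (L.append (.cons q R)) :=
  (Row.ids L).append (.cons χ (Row.ids R) rfl) rfl

/-- Opcartesian 2-cells: every 2-cell having `Q` as a segment of its domain factors uniquely. -/
def IsOpcartesian {b c : X} {Q : LoosePath Loose b c} {q : Loose b c}
    (χ : Cell (𝟙 b) Q (𝟙 c) q) : Prop :=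
  ∀ {a d a' d' : X} (L : LoosePath Loose a b) (R : LoosePath Loose c d) (f : a ⟶ a')
    (g : d ⟶ d') (s : Loose a' d') (φ : Cell f (L.append (Q.append R)) g s),
    ∃! φ' : Cell f (L.append (.cons q R)) g s,
      comp (Row.context L χ R) φ' (Category.id_comp f) (Category.id_comp g) = φ

/-- Cartesian 2-cells. -/
def IsCartesian {a b a' b' : X} {g : a ⟶ a'} {p : Loose a b} {f : b ⟶ b'} {q : Loose a' b'}
    (χ : Cell g (.single p) f q) : Prop :=
  ∀ {x y : X} (g' : x ⟶ a) (f' : y ⟶ b) (R : LoosePath Loose x y)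
    (φ : Cell (g' ≫ g) R (f' ≫ f) q), ∃! φ' : Cell g' R f' p, vcomp φ' χ rfl rfl = φ

end VDC

/-- A virtual equipment: a virtual double category with (chosen) loose-identities and
restrictions. -/
class VirtualEquipment (X : Type u) [Category.{v} X] extends VirtualDoubleCategory.{w, z} X where
  /-- The loose-identity `A(1, 1)`. -/
  looseId : ∀ a : X, Loose a a
  /-- The nullary 2-cell exhibiting the loose-identity. -/
  looseUnit : ∀ a : X, Cell (𝟙 a) (.nil a) (𝟙 a) (looseId a)
  looseUnit_opcartesian : ∀ a : X, IsOpcartesian (X := X) (looseUnit a)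
  /-- The restriction `q(f, g)`. -/
  restrict : ∀ {a b a' b' : X} (_ : Loose a' b') (_ : b ⟶ b') (_ : a ⟶ a'), Loose a b
  /-- The 2-cell exhibiting the restriction. -/
  restrictCell : ∀ {a b a' b' : X} (q : Loose a' b') (f : b ⟶ b') (g : a ⟶ a'),
    Cell g (.single (restrict q f g)) f q
  restrictCell_cartesian : ∀ {a b a' b' : X} (q : Loose a' b') (f : b ⟶ b') (g : a ⟶ a'),
    IsCartesian (X := X) (restrictCell q f g)

open VirtualEquipment

section Equipment

variable {X : Type u} [Category.{v} X] [VirtualEquipment.{w, z} X]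

theorem comp_assoc' {a b a' b' a'' b'' a₃ b₃ : X} {f : a ⟶ a'} {f' : a' ⟶ a''}
    {P : LoosePath Loose a b} {Q : LoosePath Loose a' b'} {R : LoosePath Loose a'' b''}
    {g : b ⟶ b'} {g' : b' ⟶ b''} (B : BlockRow (X := X) f f' P Q R g g')
    {f'' : a'' ⟶ a₃} {g'' : b'' ⟶ b₃} {s : Loose a₃ b₃} (χ : Cell f'' R g'' s)
    {k k' l l'} (hk : f' ≫ f'' = k) (hl : g' ≫ g'' = l) (hk' : f ≫ k = k') (hl' : g ≫ l = l') :
    comp B.upper (comp B.lower χ hk hl) hk' hl' =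
      comp (B.composite comp) χ (by rw [Category.assoc, hk, hk'])
        (by rw [Category.assoc, hl, hl']) := by
  subst hk hl hk' hl'
  exact comp_assoc B χ

theorem vcomp_assoc {a b a' b' a'' b'' a₃ b₃ : X} {f : a ⟶ a'} {P : LoosePath Loose a b}
    {g : b ⟶ b'} {q : Loose a' b'} {f' : a' ⟶ a''} {g' : b' ⟶ b''} {r : Loose a'' b''}
    {f'' : a'' ⟶ a₃} {g'' : b'' ⟶ b₃} {s : Loose a₃ b₃}
    (φ : Cell f P g q) (ψ : Cell f' (.single q) g' r) (χ : Cell f'' (.single r) g'' s)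
    {k k' l l' m n} (hk : f ≫ f' = k) (hl : g ≫ g' = l) (hk' : k ≫ f'' = k')
    (hl' : l ≫ g'' = l') (hm : f' ≫ f'' = m) (hn : g' ≫ g'' = n)
    (hm' : f ≫ m = k') (hn' : g ≫ n = l') :
    vcomp (vcomp φ ψ hk hl) χ hk' hl' = vcomp φ (vcomp ψ χ hm hn) hm' hn' := by
  subst hk hl
  exact (comp_assoc' (.cons (.single φ) ψ (.nil g g') P.append_nil) χ hm hn hm' hn').symm

/-- Equal cells from equal composites with the opcartesian unit. -/
theorem looseId_ext {a b c a' c' : X} (L : LoosePath Loose a b) (R : LoosePath Loose b c)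
    {f : a ⟶ a'} {g : c ⟶ c'} {s : Loose a' c'}
    {φ ψ : Cell f (L.append (.cons (looseId b) R)) g s}
    (h : comp (Row.context L (looseUnit b) R) φ (Category.id_comp f) (Category.id_comp g) =
      comp (Row.context L (looseUnit b) R) ψ (Category.id_comp f) (Category.id_comp g)) :
    φ = ψ :=
  (looseUnit_opcartesian b L R f g s _).unique h rfl

/-- The identity 2-cell of a tight-cell. -/
def tightId {a b : X} (f : a ⟶ b) {f' f'' : a ⟶ b} (h : f = f') (h' : f = f'') :
    Cell f' (.nil a) f'' (looseId b) :=
  comp (.nil f) (looseUnit b) ((Category.comp_id f).trans h) ((Category.comp_id f).trans h')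

/-- The canonical 2-cell `B(1, 1), B(1, 1) ⇒ B(1, 1)`. -/
noncomputable def looseMul (b : X) :
    Cell (𝟙 b) (.pair (looseId b) (looseId b)) (𝟙 b) (looseId b) :=
  (looseUnit_opcartesian b (.nil b) (.single (looseId b)) (𝟙 b) (𝟙 b) _
    (cellId (looseId b))).choose

theorem unit_looseMul (b : X) :
    comp (.pair (looseUnit b) (cellId (looseId b)) rfl) (looseMul b) (Category.id_comp _)
      (Category.id_comp _) = cellId (looseId b) :=
  (looseUnit_opcartesian b (.nil b) (.single (looseId b)) (𝟙 b) (𝟙 b) _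
    (cellId (looseId b))).choose_spec.1

/-- Horizontal composition of 2-cells whose codomains are loose-identities. -/
noncomputable def hcomp {a b c e : X} {f : a ⟶ e} {g : b ⟶ e} {h : c ⟶ e}
    {P : LoosePath Loose a b} {Q : LoosePath Loose b c} {R : LoosePath Loose a c}
    (α : Cell f P g (looseId e)) (β : Cell g Q h (looseId e)) (hR : P.append Q = R) :
    Cell f R h (looseId e) :=
  comp (.pair α β hR) (looseMul e) (Category.comp_id f) (Category.comp_id h)

/-- Horizontal composition with a nullary 2-cell on the left. -/
noncomputable abbrev hcompL {a b e : X} {f g : a ⟶ e} {h : b ⟶ e} {P : LoosePath Loose a b}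
    (τ : Cell f (.nil a) g (looseId e)) (β : Cell g P h (looseId e)) : Cell f P h (looseId e) :=
  hcomp τ β P.nil_append

/-- Horizontal composition with a nullary 2-cell on the right. -/
noncomputable abbrev hcompR {a b e : X} {f : a ⟶ e} {g h : b ⟶ e} {P : LoosePath Loose a b}
    (α : Cell f P g (looseId e)) (τ : Cell g (.nil b) h (looseId e)) : Cell f P h (looseId e) :=
  hcomp α τ P.append_nil

/-- Horizontal composition of two unary 2-cells. -/
noncomputable abbrev hcomp₂ {a b c e : X} {f : a ⟶ e} {g : b ⟶ e} {h : c ⟶ e} {p : Loose a b}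
    {q : Loose b c} (α : Cell f (.single p) g (looseId e)) (β : Cell g (.single q) h (looseId e)) :
    Cell f (.pair p q) h (looseId e) :=
  hcomp α β (LoosePath.single_append p (.single q))

theorem comp_pair {a b c a' b' c' a'' b'' c'' a₃ c₃ : X} {f : a ⟶ a'} {g : b ⟶ b'} {h : c ⟶ c'}
    {P : LoosePath Loose a b} {P' : LoosePath Loose b c} {P'' : LoosePath Loose a c}
    {Q : LoosePath Loose a' b'} {Q' : LoosePath Loose b' c'}
    (Φ : Row (X := X) f P g Q) (Ψ : Row g P' h Q') (hP : P.append P' = P'')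
    {f' : a' ⟶ a''} {g' : b' ⟶ b''} {h' : c' ⟶ c''} {r : Loose a'' b''} {r' : Loose b'' c''}
    (φ : Cell f' Q g' r) (ψ : Cell g' Q' h' r')
    {f'' : a'' ⟶ a₃} {h'' : c'' ⟶ c₃} {s : Loose a₃ c₃} (χ : Cell f'' (.pair r r') h'' s)
    {k l m x y x' y'} (hk : f ≫ f' = k) (hl : g ≫ g' = l) (hm : h ≫ h' = m)
    (hx : f' ≫ f'' = x) (hy : h' ≫ h'' = y) (hx' : f ≫ x = x') (hy' : h ≫ y = y') :
    comp (Φ.append (Ψ.append (.nil h) P'.append_nil) hP)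
      (comp (Row.cons φ (Row.cons ψ (.nil h') rfl) rfl) χ hx hy) hx' hy' =
    comp (Row.pair (comp Φ φ hk hl) (comp Ψ ψ hl hm) hP) χ
      (by rw [← hk, Category.assoc, hx, hx']) (by rw [← hm, Category.assoc, hy, hy']) := by
  subst hk hl hm
  exact comp_assoc' (.cons Φ φ (.cons Ψ ψ (.nil _ _) P'.append_nil) hP) χ hx hy hx' hy'

theorem looseMul_unit (b : X) :
    comp (.pair (cellId (looseId b)) (looseUnit b) rfl) (looseMul b) (Category.id_comp _)
      (Category.id_comp _) = cellId (looseId b) := by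
  refine looseId_ext (.nil b) (.nil b) ?_
  have e0 : comp (.nil (𝟙 b)) (looseUnit b) (Category.id_comp _) (Category.id_comp _) =
    looseUnit b := ids_comp _
  have e1 : comp (.single (looseUnit b)) (comp (.pair (cellId (looseId b)) (looseUnit b) rfl)
      (looseMul b) (Category.id_comp _) (Category.id_comp _)) (Category.id_comp _)
      (Category.id_comp _) = comp (.pair (looseUnit b) (looseUnit b) rfl) (looseMul b)
      (Category.id_comp _) (Category.id_comp _) := by
    refine (comp_pair (.single (looseUnit b)) (.nil (𝟙 b)) rfl (cellId (looseId b)) (looseUnit b)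
      (looseMul b) (Category.id_comp _) (Category.id_comp _) (Category.id_comp _)
      (Category.id_comp _) (Category.id_comp _) (Category.id_comp _) (Category.id_comp _)).trans ?_
    rw [e0, comp_cellId]
  have e2 : comp (.single (looseUnit b)) (comp (.pair (looseUnit b) (cellId (looseId b)) rfl)
      (looseMul b) (Category.id_comp _) (Category.id_comp _)) (Category.id_comp _)
      (Category.id_comp _) = comp (.pair (looseUnit b) (looseUnit b) rfl) (looseMul b)
      (Category.id_comp _) (Category.id_comp _) := by
    refine (comp_pair (.nil (𝟙 b)) (.single (looseUnit b)) rfl (looseUnit b) (cellId (looseId b))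
      (looseMul b) (Category.id_comp _) (Category.id_comp _) (Category.id_comp _)
      (Category.id_comp _) (Category.id_comp _) (Category.id_comp _) (Category.id_comp _)).trans ?_
    rw [e0, comp_cellId]
  exact e1.trans (e2.symm.trans (congrArg (fun φ => comp (.single (looseUnit b)) φ
    (Category.id_comp _) (Category.id_comp _)) (unit_looseMul b)))

/-- Precomposition of a 2-cell between tight-cells by a tight-cell. -/
def precomp {a b d d' : X} (x : a ⟶ b) {f : b ⟶ d} {g : b ⟶ d'} {q : Loose d d'}
    (τ : Cell f (.nil b) g q) {f' : a ⟶ d} {g' : a ⟶ d'} (hf : x ≫ f = f') (hg : x ≫ g = g') :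
    Cell f' (.nil a) g' q :=
  comp (.nil x) τ hf hg

section hcomp

variable {a b c e : X}

theorem tightId_hcomp {g : b ⟶ e} {h : c ⟶ e} {Q : LoosePath Loose b c}
    (β : Cell (X := X) g Q h (looseId e)) : hcompL (tightId g rfl rfl) β = β := by
  have e := comp_pair (.nil g) (.single β) rfl (looseUnit e) (cellId (looseId e))
      (looseMul e) (Category.comp_id _) (Category.comp_id _) (Category.comp_id _)
      (Category.id_comp _) (Category.id_comp _) (Category.comp_id _) (Category.comp_id _)
  rw [comp_cellId] at e
  refine e.symm.trans ?_
  exact (congrArg (fun φ => comp (.single β) φ (Category.comp_id _) (Category.comp_id _))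
    (unit_looseMul _)).trans (comp_cellId β)

theorem hcomp_tightId {g : b ⟶ e} {h : c ⟶ e} {Q : LoosePath Loose b c}
    (β : Cell (X := X) g Q h (looseId e)) : hcompR β (tightId h rfl rfl) = β := by
  have e := comp_pair (.single β) (.nil h) Q.append_nil (cellId (looseId e)) (looseUnit e)
      (looseMul e) (Category.comp_id _) (Category.comp_id _) (Category.comp_id _)
      (Category.id_comp _) (Category.id_comp _) (Category.comp_id _) (Category.comp_id _)
  rw [comp_cellId] at e
  refine e.symm.trans ?_
  exact (congrArg (fun φ => comp (.single β) φ (Category.comp_id _) (Category.comp_id _))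
    (looseMul_unit _)).trans (comp_cellId β)

theorem looseMul_assoc (e : X) :
    comp (.pair (looseMul e) (cellId (looseId e)) rfl) (looseMul e) (Category.id_comp _)
      (Category.id_comp _) =
    comp (.pair (cellId (looseId e)) (looseMul e) rfl) (looseMul e) (Category.id_comp _)
      (Category.id_comp _) := by
  refine looseId_ext (.nil e) (.pair (looseId e) (looseId e)) ?_
  have e0 : comp (.nil (𝟙 e)) (looseUnit e) (Category.id_comp _) (Category.id_comp _) =
    looseUnit e := ids_comp _
  have e1 := comp_pair (.pair (looseUnit e) (cellId (looseId e)) rfl)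
    (.single (cellId (looseId e))) rfl (looseMul e) (cellId (looseId e)) (looseMul e)
    (Category.id_comp _) (Category.id_comp _) (Category.id_comp _)
    (Category.id_comp _) (Category.id_comp _) (Category.id_comp _) (Category.id_comp _)
  have e2 := comp_pair (.single (looseUnit e))
    (.pair (cellId (looseId e)) (cellId (looseId e)) rfl) rfl (cellId (looseId e)) (looseMul e)
    (looseMul e) (Category.id_comp _) (Category.id_comp _) (Category.id_comp _)
    (Category.id_comp _) (Category.id_comp _) (Category.id_comp _) (Category.id_comp _)
  have e3 := comp_pair (.nil (𝟙 e)) (.single (looseMul e)) rfl (looseUnit e)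
    (cellId (looseId e)) (looseMul e) (Category.id_comp _) (Category.id_comp _)
    (Category.id_comp _) (Category.id_comp _) (Category.id_comp _) (Category.id_comp _)
    (Category.id_comp _)
  have e4 : comp (.pair (cellId (looseId e)) (cellId (looseId e)) rfl) (looseMul e)
    (Category.id_comp _) (Category.id_comp _) = looseMul e := ids_comp _
  rw [unit_looseMul, comp_cellId] at e1
  rw [comp_cellId, e4] at e2
  rw [e0, comp_cellId] at e3
  have e5 : comp (.single (looseMul e)) (cellId (looseId e))
    (Category.id_comp _) (Category.id_comp _) = looseMul e := comp_cellId _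
  exact (e1.trans e4).trans (e2.trans (e3.symm.trans ((congrArg (fun φ =>
    comp (.single (looseMul e)) φ (Category.id_comp _) (Category.id_comp _))
    (unit_looseMul e)).trans e5))).symm

theorem hcomp_assoc {d : X} {f : a ⟶ e} {g : b ⟶ e} {h : c ⟶ e} {k : d ⟶ e}
    {P : LoosePath Loose a b} {Q : LoosePath Loose b c} {R : LoosePath Loose c d}
    {PQ : LoosePath Loose a c} {QR : LoosePath Loose b d} {PQR : LoosePath Loose a d}
    (α : Cell (X := X) f P g (looseId e)) (β : Cell g Q h (looseId e))
    (γ : Cell h R k (looseId e)) (h₁ : P.append Q = PQ) (h₂ : PQ.append R = PQR)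
    (h₃ : Q.append R = QR) (h₄ : P.append QR = PQR) :
    hcomp (hcomp α β h₁) γ h₂ = hcomp α (hcomp β γ h₃) h₄ := by
  subst h₁ h₃
  have e1 := comp_pair (.pair α β rfl) (.single γ) h₂ (looseMul e) (cellId (looseId e))
    (looseMul e) (Category.comp_id _) (Category.comp_id _) (Category.comp_id _)
    (Category.id_comp _) (Category.id_comp _) (Category.comp_id _) (Category.comp_id _)
  have e2 := comp_pair (.single α) (.pair β γ rfl) h₄ (cellId (looseId e)) (looseMul e)
    (looseMul e) (Category.comp_id _) (Category.comp_id _) (Category.comp_id _)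
    (Category.id_comp _) (Category.id_comp _) (Category.comp_id _) (Category.comp_id _)
  rw [comp_cellId] at e1 e2
  refine e1.symm.trans (Eq.trans ?_ e2)
  have r1 : (Row.pair α β rfl).append ((Row.single γ).append (Row.nil k) R.append_nil) h₂ =
    .cons α (.cons β (.single γ) rfl) h₄ := rfl
  have r2 : (Row.single α).append ((Row.pair β γ rfl).append (Row.nil k)
    (Q.append R).append_nil) h₄ = .cons α (.cons β (.single γ) rfl) h₄ := by
    have r3 : ∀ S (hS : R.append (.nil _) = S) (h : Q.append S = Q.append R),
        Row.cons α (.cons β (.cons γ (.nil k) hS) h) h₄ =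
          .cons α (.cons β (.single γ) rfl) h₄ := by
      intro S hS h
      obtain rfl : R = S := R.append_nil.symm.trans hS
      rfl
    exact r3 _ rfl (by rw [LoosePath.append_nil])
  rw [r2]
  exact congrArg (fun φ => comp (.cons α (.cons β (.single γ) rfl) h₄) φ (Category.comp_id _)
    (Category.comp_id _)) (looseMul_assoc e)

theorem precomp_hcomp_vcomp {a' c' : X} {x : a ⟶ a'} {y : c ⟶ c'} {P : LoosePath Loose a c}
    {p : Loose a' c'} {f g : a' ⟶ e} {h : c' ⟶ e} {f₁ g₁ h₁}
    (τ : Cell (X := X) f (.nil a') g (looseId e)) (φ : Cell x P y p)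
    (β : Cell g (.single p) h (looseId e)) (hf : x ≫ f = f₁) (hg : x ≫ g = g₁)
    (hh : y ≫ h = h₁) :
    hcompL (precomp x τ hf hg) (vcomp φ β hg hh) = vcomp φ (hcompL τ β) hf hh :=
  (comp_pair (.nil x) (.single φ) rfl τ β (looseMul e) hf hg hh (Category.comp_id _)
    (Category.comp_id _) hf hh).symm

theorem vcomp_hcomp_precomp {a' c' : X} {x : a ⟶ a'} {y : c ⟶ c'} {P : LoosePath Loose a c}
    {p : Loose a' c'} {f : a' ⟶ e} {g h : c' ⟶ e} {f₁ g₁ h₁}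
    (τ : Cell (X := X) g (.nil c') h (looseId e)) (φ : Cell x P y p)
    (α : Cell f (.single p) g (looseId e)) (hf : x ≫ f = f₁) (hg : y ≫ g = g₁)
    (hh : y ≫ h = h₁) :
    hcompR (vcomp φ α hf hg) (precomp y τ hg hh) =
      vcomp φ (hcompR α τ) hf hh :=
  (comp_pair (.single φ) (.nil y) P.append_nil α τ (looseMul e) hf hg hh (Category.comp_id _)
    (Category.comp_id _) hf hh).symm

theorem precomp_id {d d' : X} {f : b ⟶ d} {g : b ⟶ d'} {q : Loose d d'}
    (τ : Cell (X := X) f (.nil b) g q) :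
    precomp (𝟙 b) τ (Category.id_comp _) (Category.id_comp _) = τ :=
  ids_comp τ

theorem hcomp_vcomp {c' : X} {y : c ⟶ c'} {P : LoosePath Loose a c}
    {p : Loose a c'} {f g : a ⟶ e} {h : c' ⟶ e} {h₁}
    (τ : Cell (X := X) f (.nil a) g (looseId e)) (φ : Cell (𝟙 a) P y p)
    (β : Cell g (.single p) h (looseId e)) (hg : 𝟙 a ≫ g = g) (hf : 𝟙 a ≫ f = f)
    (hh : y ≫ h = h₁) :
    hcompL τ (vcomp φ β hg hh) = vcomp φ (hcompL τ β) hf hh := by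
  rw [← precomp_hcomp_vcomp τ φ β hf hg hh, precomp_id]

theorem vcomp_hcomp {a' : X} {x : a ⟶ a'} {P : LoosePath Loose a c}
    {p : Loose a' c} {f : a' ⟶ e} {g h : c ⟶ e} {f₁}
    (τ : Cell (X := X) g (.nil c) h (looseId e)) (φ : Cell x P (𝟙 c) p)
    (α : Cell f (.single p) g (looseId e)) (hf : x ≫ f = f₁) (hg : 𝟙 c ≫ g = g)
    (hh : 𝟙 c ≫ h = h) :
    hcompR (vcomp φ α hf hg) τ = vcomp φ (hcompR α τ) hf hh := by
  rw [← vcomp_hcomp_precomp τ φ α hf hg hh, precomp_id]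

theorem comp_pair_hcomp {a' b' c' : X} {x : a ⟶ a'} {y : b ⟶ b'} {z : c ⟶ c'}
    {P : LoosePath Loose a b} {Q : LoosePath Loose b c} {R : LoosePath Loose a c}
    {p : Loose a' b'} {q : Loose b' c'}
    {f : a' ⟶ e} {g : b' ⟶ e} {h : c' ⟶ e} {f₁ g₁ h₁} (φ : Cell (X := X) x P y p)
    (ψ : Cell y Q z q) (α : Cell f (.single p) g (looseId e)) (β : Cell g (.single q) h (looseId e))
    (hR : P.append Q = R) (hf : x ≫ f = f₁) (hg : y ≫ g = g₁) (hh : z ≫ h = h₁) :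
    comp (.pair φ ψ hR) (hcomp₂ α β) hf hh =
      hcomp (vcomp φ α hf hg) (vcomp ψ β hg hh) hR :=
  comp_pair (.single φ) (.single ψ) hR α β (looseMul e) hf hg hh (Category.comp_id _)
    (Category.comp_id _) hf hh

end hcomp

theorem comp_single {a b a' b' a'' b'' a₃ b₃ : X} {f : a ⟶ a'} {P : LoosePath Loose a b}
    {g : b ⟶ b'} {Q : LoosePath Loose a' b'} {f' : a' ⟶ a''} {g' : b' ⟶ b''} {r : Loose a'' b''}
    {f'' : a'' ⟶ a₃} {g'' : b'' ⟶ b₃} {s : Loose a₃ b₃}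
    (Φ : Row (X := X) f P g Q) (ψ : Cell f' Q g' r) (χ : Cell f'' (.single r) g'' s)
    {k k' l l' m n} (hk : f ≫ f' = k) (hl : g ≫ g' = l) (hk' : k ≫ f'' = k')
    (hl' : l ≫ g'' = l') (hm : f' ≫ f'' = m) (hn : g' ≫ g'' = n)
    (hm' : f ≫ m = k') (hn' : g ≫ n = l') :
    comp (Φ.append (.nil g) P.append_nil) (comp (.cons ψ (.nil g') rfl) χ hm hn) hm' hn' =
      vcomp (comp Φ ψ hk hl) χ hk' hl' := by
  subst hk hl
  exact comp_assoc' (.cons Φ ψ (.nil g g') P.append_nil) χ hm hn hm' hn'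

/-- The 2-cell `B(1, 1) ⇒ C(1, 1)` given by the action of a tight-cell `k : B ⟶ C`. -/
noncomputable def looseMap {b c : X} (k : b ⟶ c) : Cell k (.single (looseId b)) k (looseId c) :=
  (looseUnit_opcartesian b (.nil b) (.nil b) k k (looseId c) (tightId k rfl rfl)).choose

theorem unit_looseMap {b c : X} (k : b ⟶ c) :
    vcomp (looseUnit b) (looseMap k) (Category.id_comp _) (Category.id_comp _) =
      tightId k rfl rfl :=
  (looseUnit_opcartesian b (.nil b) (.nil b) k k (looseId c) (tightId k rfl rfl)).choose_spec.1

theorem looseMul_looseMap {b c : X} (k : b ⟶ c) :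
    vcomp (looseMul b) (looseMap k) (Category.id_comp _) (Category.id_comp _) =
      hcomp₂ (looseMap k) (looseMap k) := by
  refine looseId_ext (.nil b) (.single (looseId b)) ?_
  have e1 := comp_single (.pair (looseUnit b) (cellId (looseId b)) rfl) (looseMul b) (looseMap k)
    (Category.id_comp _) (Category.id_comp _) (Category.id_comp _) (Category.id_comp _)
    (Category.id_comp _) (Category.id_comp _) (Category.id_comp _) (Category.id_comp _)
  have e2 := comp_pair_hcomp (looseUnit b) (cellId (looseId b)) (looseMap k) (looseMap k) rfl
    (Category.id_comp _) (Category.id_comp _) (Category.id_comp _)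
  have e3 : vcomp (cellId (looseId b)) (looseMap k) (Category.id_comp _) (Category.id_comp _) =
    looseMap k := ids_comp _
  rw [unit_looseMul] at e1
  rw [unit_looseMap] at e2
  exact e1.trans (e2.trans (tightId_hcomp _)).symm

theorem comp_pair_vcomp {a b c a' b' c' a'' c'' a₃ c₃ : X} {f : a ⟶ a'} {g : b ⟶ b'} {h : c ⟶ c'}
    {P : LoosePath Loose a b} {Q : LoosePath Loose b c} {R : LoosePath Loose a c}
    {p : Loose a' b'} {q : Loose b' c'}
    (α : Cell (X := X) f P g p) (β : Cell g Q h q) (hR : P.append Q = R)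
    {f' : a' ⟶ a''} {h' : c' ⟶ c''} {r : Loose a'' c''} {f'' : a'' ⟶ a₃} {h'' : c'' ⟶ c₃}
    {s : Loose a₃ c₃} (ψ : Cell f' (.pair p q) h' r) (χ : Cell f'' (.single r) h'' s)
    {k k' l l' m n} (hk : f ≫ f' = k) (hl : h ≫ h' = l) (hk' : k ≫ f'' = k')
    (hl' : l ≫ h'' = l') (hm : f' ≫ f'' = m) (hn : h' ≫ h'' = n)
    (hm' : f ≫ m = k') (hn' : h ≫ n = l') :
    comp (.pair α β hR) (vcomp ψ χ hm hn) hm' hn' =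
      vcomp (comp (.pair α β hR) ψ hk hl) χ hk' hl' := by
  have e2 := comp_single (.pair α β hR) ψ χ hk hl hk' hl' hm hn hm' hn'
  have e3 : (Row.pair α β hR).append (Row.nil h) R.append_nil = Row.pair α β hR := by
    have r3 : ∀ S (hS : Q.append (.nil _) = S) (h' : P.append S = R),
        Row.cons α (.cons β (.nil h) hS) h' = .pair α β hR := by
      intro S hS h'
      obtain rfl : Q = S := Q.append_nil.symm.trans hS
      rfl
    exact r3 _ rfl _
  rw [e3] at e2
  exact e2

theorem hcomp_looseMap {a b c e d : X} {f : a ⟶ e} {g : b ⟶ e} {h : c ⟶ e}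
    {P : LoosePath Loose a b} {Q : LoosePath Loose b c} {R : LoosePath Loose a c}
    (α : Cell (X := X) f P g (looseId e)) (β : Cell g Q h (looseId e)) (hR : P.append Q = R)
    (k : e ⟶ d) {f' g' h'} (hf : f ≫ k = f') (hg : g ≫ k = g') (hh : h ≫ k = h') :
    vcomp (hcomp α β hR) (looseMap k) hf hh =
      hcomp (vcomp α (looseMap k) hf hg) (vcomp β (looseMap k) hg hh) hR := by
  have e1 := congrArg (fun φ => comp (.pair α β hR) φ hf hh) (looseMul_looseMap k)
  exact (comp_pair_vcomp α β hR (looseMul e) (looseMap k) _ _ _ _ _ _ _ _).symm.trans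
    (e1.trans (comp_pair_hcomp α β (looseMap k) (looseMap k) hR hf hg hh))

theorem tightId_looseMap {a b c : X} (f : a ⟶ b) (k : b ⟶ c) {f' f'' : a ⟶ b} {g' g'' : a ⟶ c}
    (h : f = f') (h' : f = f'') (hg : f' ≫ k = g') (hg' : f'' ≫ k = g'') :
    vcomp (tightId f h h') (looseMap k) hg hg' =
      tightId (f ≫ k) (by rw [h, hg]) (by rw [h', hg']) := by
  subst h h' hg hg'
  have e1 := comp_single (.nil f) (looseUnit b) (looseMap k) (Category.comp_id f)
    (Category.comp_id f) rfl rfl (Category.id_comp k) (Category.id_comp k) rfl rfl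
  have e2 := congrArg (fun φ => comp (.nil f) φ rfl rfl) (unit_looseMap k)
  exact e1.symm.trans (e2.trans (comp_assoc' (.nil f k) (looseUnit c) (Category.comp_id k)
    (Category.comp_id k) rfl rfl))

theorem precomp_tightId {a b c : X} (x : a ⟶ b) (k : b ⟶ c) {k' k'' : b ⟶ c} {g' g'' : a ⟶ c}
    (h : k = k') (h' : k = k'') (hg : x ≫ k' = g') (hg' : x ≫ k'' = g'') :
    precomp x (tightId k h h') hg hg' =
      tightId (x ≫ k) (by rw [h, hg]) (by rw [h', hg']) := by
  subst h h' hg hg'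
  exact comp_assoc' (.nil x k) (looseUnit c) _ _ _ _

theorem looseMap_comp {a b c : X} (f : a ⟶ b) (k : b ⟶ c) :
    vcomp (looseMap f) (looseMap k) rfl rfl = looseMap (f ≫ k) := by
  refine looseId_ext (.nil a) (.nil a) ?_
  refine ((vcomp_assoc (looseUnit a) (looseMap f) (looseMap k) (Category.id_comp _)
    (Category.id_comp _) rfl rfl rfl rfl _ _).symm.trans ?_).trans (unit_looseMap _).symm
  rw [unit_looseMap, tightId_looseMap]

theorem vcomp_cellId {a b a' b' : X} {f : a ⟶ a'} {P : LoosePath Loose a b} {g : b ⟶ b'}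
    {q : Loose a' b'} (φ : Cell (X := X) f P g q) :
    vcomp φ (cellId q) (Category.comp_id f) (Category.comp_id g) = φ :=
  comp_cellId φ

theorem cellId_vcomp {a b a' b' : X} {f : a ⟶ a'} {p : Loose a b} {g : b ⟶ b'}
    {q : Loose a' b'} (φ : Cell (X := X) f (.single p) g q) :
    vcomp (cellId p) φ (Category.id_comp f) (Category.id_comp g) = φ :=
  ids_comp φ

theorem precomp_looseMap {a b c e : X} (x : a ⟶ b) {f g : b ⟶ c}
    (τ : Cell (X := X) f (.nil b) g (looseId c)) (k : c ⟶ e) {f₁ g₁ : a ⟶ c} {f₂ g₂ : b ⟶ e}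
    {f₃ g₃ : a ⟶ e} (hf₁ : x ≫ f = f₁) (hg₁ : x ≫ g = g₁) (hf₂ : f ≫ k = f₂) (hg₂ : g ≫ k = g₂)
    (hf₃ : f₁ ≫ k = f₃) (hg₃ : g₁ ≫ k = g₃) (hf₄ : x ≫ f₂ = f₃) (hg₄ : x ≫ g₂ = g₃) :
    vcomp (precomp x τ hf₁ hg₁) (looseMap k) hf₃ hg₃ =
      precomp x (vcomp τ (looseMap k) hf₂ hg₂) hf₄ hg₄ :=
  (comp_single (.nil x) τ (looseMap k) hf₁ hg₁ hf₃ hg₃ hf₂ hg₂ hf₄ hg₄).symm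

theorem precomp_precomp {a b c e e' : X} (x : a ⟶ b) (y : b ⟶ c) {f : c ⟶ e} {g : c ⟶ e'}
    {q : Loose e e'} (τ : Cell (X := X) f (.nil c) g q) {f₁ g₁ f₂ g₂ xy} (hf₁ : y ≫ f = f₁)
    (hg₁ : y ≫ g = g₁) (hf₂ : x ≫ f₁ = f₂) (hg₂ : x ≫ g₁ = g₂) (hxy : x ≫ y = xy)
    (hf₃ : xy ≫ f = f₂) (hg₃ : xy ≫ g = g₂) :
    precomp x (precomp y τ hf₁ hg₁) hf₂ hg₂ = precomp xy τ hf₃ hg₃ := by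
  subst hxy
  exact comp_assoc' (.nil x y) τ hf₁ hg₁ hf₂ hg₂

theorem precomp_hcomp {a b e : X} (x : a ⟶ b) {f g h : b ⟶ e}
    (α : Cell (X := X) f (.nil b) g (looseId e)) (β : Cell g (.nil b) h (looseId e))
    {f₁ g₁ h₁} (hf : x ≫ f = f₁) (hg : x ≫ g = g₁) (hh : x ≫ h = h₁) :
    precomp x (hcompL α β) hf hh = hcompL (precomp x α hf hg) (precomp x β hg hh) :=
  comp_pair (.nil x) (.nil x) rfl α β (looseMul e) hf hg hh (Category.comp_id _)
    (Category.comp_id _) hf hh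

/-- Naturality of a 2-cell between tight-cells. -/
theorem precomp_hcomp_looseMap {a b d e : X} {r s : d ⟶ e}
    (ρ : Cell (X := X) s (.nil d) r (looseId e)) {g : a ⟶ d} {h : b ⟶ d}
    {P : LoosePath Loose a b} (α : Cell g P h (looseId d)) {gr gs : a ⟶ e} {hr hs : b ⟶ e}
    (h₁ : g ≫ r = gr) (h₂ : g ≫ s = gs) (h₃ : h ≫ r = hr) (h₄ : h ≫ s = hs) :
    hcompL (precomp g ρ h₂ h₁) (vcomp α (looseMap r) h₁ h₃) =
      hcompR (vcomp α (looseMap s) h₂ h₄) (precomp h ρ h₄ h₃) := by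
  subst h₁ h₂ h₃ h₄
  rw [precomp_hcomp_vcomp ρ α (looseMap r) rfl rfl rfl,
    vcomp_hcomp_precomp ρ α (looseMap s) rfl rfl rfl]
  congr 1
  refine looseId_ext (.nil d) (.nil d) ?_
  have e1 := hcomp_vcomp ρ (looseUnit d) (looseMap r) (Category.id_comp _) (Category.id_comp _)
    (Category.id_comp _)
  have e2 := vcomp_hcomp ρ (looseUnit d) (looseMap s) (Category.id_comp _) (Category.id_comp _)
    (Category.id_comp _)
  rw [unit_looseMap] at e1 e2
  refine e1.symm.trans (Eq.trans ?_ e2)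
  exact (hcomp_tightId ρ).trans (tightId_hcomp ρ).symm

end Equipment
section Hom

variable {X : Type u} [Category.{v} X] [VirtualEquipment.{w, z} X]

/-- The restriction `E(f, g)` of the loose-identity of `E`. -/
abbrev ehom {x y e : X} (f : y ⟶ e) (g : x ⟶ e) : Loose x y :=
  restrict (looseId e) f g

/-- The cartesian 2-cell out of `E(f, g)`. -/
abbrev cart {x y e : X} (f : y ⟶ e) (g : x ⟶ e) :
    Cell g (.single (ehom f g)) f (looseId e) :=
  restrictCell (looseId e) f g

theorem existsUnique_lift {x y a b e : X} (f : y ⟶ e) (g : x ⟶ e) {g' : a ⟶ x} {f' : b ⟶ y}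
    {P : LoosePath Loose a b} {k : a ⟶ e} {l : b ⟶ e} (φ : Cell (X := X) k P l (looseId e))
    (hg : g' ≫ g = k) (hf : f' ≫ f = l) :
    ∃! φ' : Cell g' P f' (ehom f g), vcomp φ' (cart f g) hg hf = φ := by
  subst hg hf
  exact restrictCell_cartesian (looseId e) f g g' f' P φ

/-- The factorisation of a 2-cell through the cartesian 2-cell out of `E(f, g)`. -/
noncomputable def lift {x y a b e : X} (f : y ⟶ e) (g : x ⟶ e) {g' : a ⟶ x} {f' : b ⟶ y}
    {P : LoosePath Loose a b} {k : a ⟶ e} {l : b ⟶ e} (φ : Cell (X := X) k P l (looseId e))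
    (hg : g' ≫ g = k) (hf : f' ≫ f = l) : Cell g' P f' (ehom f g) :=
  (existsUnique_lift f g φ hg hf).choose

theorem lift_cart {x y a b e : X} (f : y ⟶ e) (g : x ⟶ e) {g' : a ⟶ x} {f' : b ⟶ y}
    {P : LoosePath Loose a b} {k : a ⟶ e} {l : b ⟶ e} (φ : Cell (X := X) k P l (looseId e))
    (hg : g' ≫ g = k) (hf : f' ≫ f = l) : vcomp (lift f g φ hg hf) (cart f g) hg hf = φ :=
  (existsUnique_lift f g φ hg hf).choose_spec.1

theorem cart_ext {x y a b e : X} {f : y ⟶ e} {g : x ⟶ e} {g' : a ⟶ x} {f' : b ⟶ y}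
    {P : LoosePath Loose a b} {k : a ⟶ e} {l : b ⟶ e} {φ ψ : Cell (X := X) g' P f' (ehom f g)}
    (hg : g' ≫ g = k) (hf : f' ≫ f = l)
    (h : vcomp φ (cart f g) hg hf = vcomp ψ (cart f g) hg hf) : φ = ψ :=
  (existsUnique_lift f g _ hg hf).unique h rfl

/-- A 2-cell `f ⇒ g` between parallel tight-cells. -/
abbrev TightCell {x e : X} (f g : x ⟶ e) := Cell g (.nil x) f (looseId e)

/-- Vertical composite of a globular 2-cell with another 2-cell. -/
abbrev gcomp {a b x y : X} {P : LoosePath Loose a b} {p : Loose a b} {f : a ⟶ x} {g : b ⟶ y}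
    {q : Loose x y} (φ : Cell (X := X) (𝟙 a) P (𝟙 b) p) (ψ : Cell f (.single p) g q) :
    Cell f P g q :=
  vcomp φ ψ (Category.id_comp f) (Category.id_comp g)

infixl:80 " ⨾ " => gcomp

/-- `E(η, g) : E(f', g) ⇒ E(f, g)` for `η : f ⇒ f'`. -/
noncomputable def resMapL {x y e : X} {f f' : y ⟶ e} (η : TightCell f f') (g : x ⟶ e) :
    Cell (𝟙 x) (.single (ehom f' g)) (𝟙 y) (ehom f g) :=
  lift f g (hcompR (cart f' g) η) (Category.id_comp g) (Category.id_comp f)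

/-- `E(f, η) : E(f, g) ⇒ E(f, g')` for `η : g ⇒ g'`. -/
noncomputable def resMapR {x y e : X} (f : y ⟶ e) {g g' : x ⟶ e} (η : TightCell g g') :
    Cell (𝟙 x) (.single (ehom f g)) (𝟙 y) (ehom f g') :=
  lift f g' (hcompL η (cart f g)) (Category.id_comp g') (Category.id_comp f)

/-- The composition 2-cell `E(g, h), E(f, g) ⇒ E(f, h)`. -/
noncomputable def resComp {x y z e : X} (f : z ⟶ e) (g : y ⟶ e) (h : x ⟶ e) :
    Cell (𝟙 x) (.pair (ehom g h) (ehom f g)) (𝟙 z) (ehom f h) :=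
  lift f h (hcomp₂ (cart g h) (cart f g)) (Category.id_comp h) (Category.id_comp f)

/-- The nullary 2-cell `⇒ E(f, f)`. -/
noncomputable def resUnit {y e : X} (f : y ⟶ e) : Cell (𝟙 y) (.nil y) (𝟙 y) (ehom f f) :=
  lift f f (tightId f rfl rfl) (Category.id_comp f) (Category.id_comp f)

/-- The 2-cell `E(f, g) ⇒ D(f', g')` given by the action of a tight-cell `k : E ⟶ D`, where `f'`
and `g'` are the composites of `f` and `g` with `k`. -/
noncomputable def postMap {x y e d : X} (f : y ⟶ e) (g : x ⟶ e) (k : e ⟶ d) {f' : y ⟶ d}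
    {g' : x ⟶ d} (hf : f ≫ k = f') (hg : g ≫ k = g') :
    Cell (𝟙 x) (.single (ehom f g)) (𝟙 y) (ehom f' g') :=
  lift f' g' (vcomp (cart f g) (looseMap k) hg hf) (Category.id_comp g') (Category.id_comp f')

/-- The canonical 2-cell `E(f, h) ⇒ E(f, k)`, for `h` the composite `c ≫ k`, having left frame
`c`. -/
noncomputable def resFactor {x y d e : X} (f : y ⟶ e) (k : d ⟶ e) (c : x ⟶ d) {h : x ⟶ e}
    (hc : c ≫ k = h) : Cell c (.single (ehom f h)) (𝟙 y) (ehom f k) :=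
  lift f k (cart f h) hc (Category.id_comp f)

/-- Restriction along a tight-cell `c` of a 2-cell `E(f, k) ⇒ E'(f', k')`: the 2-cell
`E(f, c ≫ k) ⇒ E'(f', c ≫ k')`. -/
noncomputable def resAlong {x y d e e' : X} {f : y ⟶ e} {k : d ⟶ e} {f' : y ⟶ e'} {k' : d ⟶ e'}
    (φ : Cell (𝟙 d) (.single (ehom f k)) (𝟙 y) (ehom f' k')) (c : x ⟶ d) {h : x ⟶ e} {h' : x ⟶ e'}
    (hh : c ≫ k = h) (hh' : c ≫ k' = h') :
    Cell (𝟙 x) (.single (ehom f h)) (𝟙 y) (ehom f' h') :=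
  lift f' h' (vcomp (resFactor f k c hh) (φ ⨾ cart f' k') hh' (Category.id_comp f'))
    (Category.id_comp h') (Category.id_comp f')

theorem resMapL_cart {x y e : X} {f f' : y ⟶ e} (η : TightCell f f') (g : x ⟶ e) :
    resMapL η g ⨾ cart f g = hcompR (cart f' g) η :=
  lift_cart ..

theorem resMapR_cart {x y e : X} (f : y ⟶ e) {g g' : x ⟶ e} (η : TightCell g g') :
    resMapR f η ⨾ cart f g' = hcompL η (cart f g) :=
  lift_cart ..

theorem resComp_cart {x y z e : X} (f : z ⟶ e) (g : y ⟶ e) (h : x ⟶ e) :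
    resComp f g h ⨾ cart f h = hcomp₂ (cart g h) (cart f g) :=
  lift_cart ..

theorem resUnit_cart {y e : X} (f : y ⟶ e) : resUnit f ⨾ cart f f = tightId f rfl rfl :=
  lift_cart ..

theorem postMap_cart {x y e d : X} (f : y ⟶ e) (g : x ⟶ e) (k : e ⟶ d) {f' : y ⟶ d}
    {g' : x ⟶ d} (hf : f ≫ k = f') (hg : g ≫ k = g') :
    postMap f g k hf hg ⨾ cart f' g' = vcomp (cart f g) (looseMap k) hg hf :=
  lift_cart ..

theorem resAlong_cart {x y d e e' : X} {f : y ⟶ e} {k : d ⟶ e} {f' : y ⟶ e'} {k' : d ⟶ e'}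
    (φ : Cell (𝟙 d) (.single (ehom f k)) (𝟙 y) (ehom f' k')) (c : x ⟶ d) {h : x ⟶ e} {h' : x ⟶ e'}
    (hh : c ≫ k = h) (hh' : c ≫ k' = h') : resAlong φ c hh hh' ⨾ cart f' h' =
      vcomp (resFactor f k c hh) (φ ⨾ cart f' k') hh' (Category.id_comp f') :=
  lift_cart ..

theorem gcomp_assoc {a b x y : X} {P : LoosePath Loose a b} {p p' : Loose a b} {f : a ⟶ x}
    {g : b ⟶ y} {q : Loose x y} (φ : Cell (X := X) (𝟙 a) P (𝟙 b) p)
    (ψ : Cell (𝟙 a) (.single p) (𝟙 b) p') (χ : Cell f (.single p') g q) :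
    φ ⨾ ψ ⨾ χ = φ ⨾ (ψ ⨾ χ) :=
  vcomp_assoc φ ψ χ _ _ _ _ _ _ _ _

theorem gcomp_vcomp {a b x y x' y' : X} {P : LoosePath Loose a b} {p : Loose a b} {f : a ⟶ x}
    {g : b ⟶ y} {q : Loose x y} (φ : Cell (X := X) (𝟙 a) P (𝟙 b) p)
    (ψ : Cell f (.single p) g q) {f' : x ⟶ x'} {g' : y ⟶ y'} {q' : Loose x' y'}
    (χ : Cell f' (.single q) g' q') {k l} (hk : f ≫ f' = k) (hl : g ≫ g' = l) :
    φ ⨾ vcomp ψ χ hk hl = vcomp (φ ⨾ ψ) χ hk hl :=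
  (vcomp_assoc φ ψ χ _ _ _ _ _ _ _ _).symm

theorem hcomp_gcomp {a c e : X} {f g : a ⟶ e} {h : c ⟶ e} {P : LoosePath Loose a c}
    {p : Loose a c} (τ : Cell (X := X) f (.nil a) g (looseId e)) (φ : Cell (𝟙 a) P (𝟙 c) p)
    (β : Cell g (.single p) h (looseId e)) : φ ⨾ hcompL τ β = hcompL τ (φ ⨾ β) :=
  (hcomp_vcomp τ φ β _ _ _).symm

theorem gcomp_hcomp {a c e : X} {f : a ⟶ e} {g h : c ⟶ e} {P : LoosePath Loose a c}
    {p : Loose a c} (φ : Cell (X := X) (𝟙 a) P (𝟙 c) p) (α : Cell f (.single p) g (looseId e))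
    (τ : Cell g (.nil c) h (looseId e)) :
    φ ⨾ hcompR α τ = hcompR (φ ⨾ α) τ :=
  (vcomp_hcomp τ φ α _ _ _).symm

theorem comp_pair_gcomp {a b c : X} {P : LoosePath Loose a b} {Q : LoosePath Loose b c}
    {R : LoosePath Loose a c} {p : Loose a b} {q : Loose b c} {p' : Loose a c}
    (α : Cell (X := X) (𝟙 a) P (𝟙 b) p) (β : Cell (𝟙 b) Q (𝟙 c) q) (hR : P.append Q = R)
    (ψ : Cell (𝟙 a) (.pair p q) (𝟙 c) p') {a' c' : X} {f : a ⟶ a'} {h : c ⟶ c'}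
    {s : Loose a' c'} (χ : Cell f (.single p') h s) :
    comp (.pair α β hR) (ψ ⨾ χ) (Category.id_comp f) (Category.id_comp h) =
      comp (.pair α β hR) ψ (Category.id_comp _) (Category.id_comp _) ⨾ χ :=
  comp_pair_vcomp α β hR ψ χ _ _ _ _ _ _ _ _

end Hom

section RelativeMonad

variable {X : Type u} [Category.{v} X] [VirtualEquipment.{w, z} X]

/-- A `j`-relative monad. -/
structure RelMonad {A E : X} (j : A ⟶ E) where
  t : A ⟶ E
  ext : Cell (𝟙 A) (.single (ehom j t)) (𝟙 A) (ehom t t)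
  unit : TightCell j t
  ext_unit : ext ⨾ resMapL unit t = cellId (ehom j t)
  unit_ext : resUnit j ⨾ resMapR j unit ⨾ ext = resUnit t
  ext_ext :
    comp (.pair₁ ext ext) (resComp t t t) (Category.id_comp _) (Category.id_comp _) =
      comp (.pair₁ ext (cellId (ehom j t))) (resComp j t t) (Category.id_comp _)
        (Category.id_comp _) ⨾ ext

/-- A morphism of `j`-relative monads. -/
@[ext]
structure RelMonadHom {A E : X} {j : A ⟶ E} (S T : RelMonad j) where
  τ : TightCell S.t T.t
  unit_comp : hcompL τ S.unit = T.unit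
  ext_comp : S.ext ⨾ resMapR S.t τ = resMapR j τ ⨾ T.ext ⨾ resMapL τ T.t

theorem resMapR_tightId {x y e : X} (f : y ⟶ e) (g : x ⟶ e) :
    resMapR f (tightId g rfl rfl) = cellId (ehom f g) := by
  refine cart_ext (Category.id_comp _) (Category.id_comp _) ?_
  rw [cellId_vcomp]
  exact (resMapR_cart f _).trans (tightId_hcomp _)

theorem resMapL_tightId {x y e : X} (f : y ⟶ e) (g : x ⟶ e) :
    resMapL (tightId f rfl rfl) g = cellId (ehom f g) := by
  refine cart_ext (Category.id_comp _) (Category.id_comp _) ?_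
  rw [cellId_vcomp]
  exact (resMapL_cart _ _).trans (hcomp_tightId _)

theorem resMapR_hcomp {x y e : X} (f : y ⟶ e) {g g' g'' : x ⟶ e} (σ : TightCell g' g'')
    (τ : TightCell g g') : resMapR f (hcompL σ τ) = resMapR f τ ⨾ resMapR f σ := by
  refine cart_ext (Category.id_comp _) (Category.id_comp _) ?_
  refine (resMapR_cart _ _).trans ?_
  refine Eq.trans ?_ (gcomp_assoc _ _ _).symm
  rw [resMapR_cart, hcomp_gcomp, resMapR_cart]
  exact hcomp_assoc _ _ _ _ _ _ _

theorem resMapL_hcomp {x y e : X} {f f' f'' : y ⟶ e} (g : x ⟶ e) (σ : TightCell f' f'')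
    (τ : TightCell f f') : resMapL (hcompL σ τ) g = resMapL σ g ⨾ resMapL τ g := by
  refine cart_ext (Category.id_comp _) (Category.id_comp _) ?_
  refine (resMapL_cart _ _).trans ?_
  refine Eq.trans ?_ (gcomp_assoc _ _ _).symm
  rw [resMapL_cart, gcomp_hcomp, resMapL_cart]
  exact (hcomp_assoc _ _ _ _ _ _ _).symm

theorem resMapR_resMapL {x y e : X} {f f' : y ⟶ e} {g g' : x ⟶ e} (σ : TightCell f f')
    (τ : TightCell g g') : resMapR f' τ ⨾ resMapL σ g' = resMapL σ g ⨾ resMapR f τ := by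
  refine cart_ext (Category.id_comp _) (Category.id_comp _) ?_
  refine (gcomp_assoc _ _ _).trans (Eq.trans ?_ (gcomp_assoc _ _ _).symm)
  rw [resMapR_cart, resMapL_cart, gcomp_hcomp, hcomp_gcomp, resMapR_cart, resMapL_cart]
  exact hcomp_assoc _ _ _ _ _ _ _

/-- The category `RMnd(j)`. -/
noncomputable instance RelMonad.category {A E : X} (j : A ⟶ E) : Category (RelMonad j) where
  Hom S T := RelMonadHom S T
  id T :=
    { τ := tightId T.t rfl rfl
      unit_comp := tightId_hcomp _
      ext_comp := by
        rw [resMapR_tightId, resMapR_tightId, resMapL_tightId]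
        exact (vcomp_cellId _).trans ((vcomp_cellId _).trans (cellId_vcomp _)).symm }
  comp {R S T} σ τ :=
    { τ := hcompL τ.τ σ.τ
      unit_comp :=
        (hcomp_assoc _ _ _ _ _ _ _).trans
          ((congrArg (hcompL τ.τ) σ.unit_comp).trans τ.unit_comp)
      ext_comp := by
        rw [resMapR_hcomp, resMapR_hcomp, resMapL_hcomp, ← gcomp_assoc, σ.ext_comp,
          gcomp_assoc, ← resMapR_resMapL, gcomp_assoc, gcomp_assoc, ← gcomp_assoc S.ext,
          τ.ext_comp]
        simp only [gcomp_assoc] }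
  id_comp τ := RelMonadHom.ext (hcomp_tightId _)
  comp_id τ := RelMonadHom.ext (tightId_hcomp _)
  assoc ρ σ τ := RelMonadHom.ext (hcomp_assoc _ _ _ _ _ _ _).symm

end RelativeMonad

section RelativeAdjunction

variable {X : Type u} [Category.{v} X] [VirtualEquipment.{w, z} X]

/-- A `j`-relative adjunction `ℓ ⊣ r`: an isomorphism `♯ : C(ℓ, 1) ≅ E(j, r) : ♭`. -/
structure RelAdj {A E : X} (j : A ⟶ E) where
  apex : X
  ℓ : A ⟶ apex
  r : apex ⟶ E
  sharp : Cell (𝟙 apex) (.single (ehom ℓ (𝟙 apex))) (𝟙 A) (ehom j r)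
  flat : Cell (𝟙 apex) (.single (ehom j r)) (𝟙 A) (ehom ℓ (𝟙 apex))
  sharp_flat : sharp ⨾ flat = cellId (ehom ℓ (𝟙 apex))
  flat_sharp : flat ⨾ sharp = cellId (ehom j r)

/-- A right-morphism of `j`-relative adjunctions. -/
structure RightMor {A E : X} {j : A ⟶ E} (L R : RelAdj j) where
  c : L.apex ⟶ R.apex
  ℓ_comp : L.ℓ ≫ c = R.ℓ
  ρ : TightCell L.r (c ≫ R.r)
  compat : L.sharp ⨾ resMapR j ρ =
    postMap L.ℓ (𝟙 L.apex) c ℓ_comp (Category.id_comp c) ⨾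
      resAlong R.sharp c (Category.comp_id c) rfl

/-- A right-morphism is strict when its 2-cell is the identity. -/
def RightMor.IsStrict {A E : X} {j : A ⟶ E} {L R : RelAdj j} (f : RightMor L R) : Prop :=
  ∃ h : L.r = f.c ≫ R.r, f.ρ = tightId L.r h rfl

namespace RelAdj

variable {A E : X} {j : A ⟶ E} (L : RelAdj j)

/-- The 2-cell `C(ℓ, 1) ⇒ E(1, 1)` corresponding to `♯`. -/
noncomputable def s : Cell L.r (.single (ehom L.ℓ (𝟙 L.apex))) j (looseId E) :=
  L.sharp ⨾ cart j L.r

/-- The 2-cell `⇒ C(ℓ, 1)` corresponding to the identity on `ℓ`. -/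
noncomputable def ι : Cell L.ℓ (.nil A) (𝟙 A) (ehom L.ℓ (𝟙 L.apex)) :=
  lift L.ℓ (𝟙 L.apex) (tightId L.ℓ rfl rfl) (Category.comp_id _) (Category.id_comp _)

theorem ι_cart : vcomp L.ι (cart L.ℓ (𝟙 L.apex)) (Category.comp_id _) (Category.id_comp _) =
    tightId L.ℓ rfl rfl :=
  lift_cart ..

/-- The unit `j ⇒ ℓ ≫ r`: the image under `♯` of the identity on `ℓ`. -/
noncomputable def unit : TightCell j (L.ℓ ≫ L.r) :=
  vcomp L.ι (L.sharp ⨾ cart j L.r) rfl (Category.id_comp j)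

theorem s_cancel {x y : X} {f : x ⟶ L.apex} {g : y ⟶ A} {P : LoosePath Loose x y}
    {φ ψ : Cell f P g (ehom L.ℓ (𝟙 L.apex))} {k l} (hk : f ≫ L.r = k) (hl : g ≫ j = l)
    (h : vcomp φ L.s hk hl = vcomp ψ L.s hk hl) : φ = ψ := by
  have key : ∀ φ : Cell f P g (ehom L.ℓ (𝟙 L.apex)), vcomp φ L.s hk hl =
      vcomp (vcomp φ L.sharp (Category.comp_id f) (Category.comp_id g)) (cart j L.r) hk hl :=
    fun φ => (vcomp_assoc φ L.sharp (cart j L.r) _ _ _ _ _ _ _ _).symm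
  rw [key, key] at h
  have h' := congrArg (fun χ => vcomp χ L.flat (Category.comp_id f) (Category.comp_id g))
    (cart_ext hk hl h)
  have key' : ∀ φ : Cell f P g (ehom L.ℓ (𝟙 L.apex)),
      vcomp (vcomp φ L.sharp (Category.comp_id f) (Category.comp_id g)) L.flat
        (Category.comp_id f) (Category.comp_id g) = φ := by
    intro φ
    refine (vcomp_assoc φ L.sharp L.flat _ _ _ _ (Category.comp_id _) (Category.comp_id _)
      (Category.comp_id _) (Category.comp_id _)).trans ?_
    exact (congrArg (fun χ => vcomp φ χ (Category.comp_id f) (Category.comp_id g))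
      L.sharp_flat).trans (vcomp_cellId φ)
  simpa only [key'] using h'

/-- The action of `C(1, 1)` on `C(ℓ, 1)`. -/
noncomputable def act : Cell (𝟙 L.apex) (.pair (looseId L.apex) (ehom L.ℓ (𝟙 L.apex))) (𝟙 A)
    (ehom L.ℓ (𝟙 L.apex)) :=
  lift L.ℓ (𝟙 L.apex) (hcomp₂ (cellId (looseId L.apex)) (cart L.ℓ (𝟙 L.apex)))
    (Category.id_comp _) (Category.id_comp _)

theorem comp_pair_act {x y z : X} {f : x ⟶ L.apex} {g : y ⟶ L.apex} {h : z ⟶ A} {h₁}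
    {P : LoosePath Loose x y} {Q : LoosePath Loose y z} {R : LoosePath Loose x z}
    (α : Cell f P g (looseId L.apex)) (β : Cell g Q h (ehom L.ℓ (𝟙 L.apex)))
    (hR : P.append Q = R) (hh : h ≫ L.ℓ = h₁) :
    comp (.pair α β hR) L.act (Category.comp_id _) (Category.comp_id _) =
      lift L.ℓ (𝟙 L.apex) (hcomp α (vcomp β (cart L.ℓ (𝟙 L.apex)) (Category.comp_id g) hh) hR)
        (Category.comp_id f) hh := by
  refine cart_ext (Category.comp_id f) hh ?_
  rw [lift_cart]
  refine (comp_pair_vcomp α β hR L.act (cart L.ℓ (𝟙 L.apex)) (Category.comp_id _)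
    (Category.comp_id _) (Category.comp_id f) hh (Category.id_comp _) (Category.id_comp _)
    (Category.comp_id _) hh).symm.trans ?_
  rw [act, lift_cart]
  refine (comp_pair_hcomp α β (cellId (looseId L.apex)) (cart L.ℓ (𝟙 L.apex)) hR
    (Category.comp_id f) (Category.comp_id g) hh).trans ?_
  rw [vcomp_cellId]

theorem act_s : L.act ⨾ L.s = hcomp₂ (looseMap L.r) L.s := by
  refine looseId_ext (.nil L.apex) (.single (ehom L.ℓ (𝟙 L.apex))) ?_
  have e1 := comp_pair_gcomp (looseUnit L.apex) (cellId (ehom L.ℓ (𝟙 L.apex))) rfl L.act L.s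
  have e2 := L.comp_pair_act (looseUnit L.apex) (cellId (ehom L.ℓ (𝟙 L.apex))) rfl
    (Category.id_comp _)
  have e0 : tightId (X := X) (𝟙 L.apex) rfl rfl = looseUnit L.apex := ids_comp _
  have e3 : comp (.pair (looseUnit L.apex) (cellId (ehom L.ℓ (𝟙 L.apex))) rfl) L.act
      (Category.comp_id _) (Category.comp_id _) = cellId (ehom L.ℓ (𝟙 L.apex)) := by
    refine e2.trans ?_
    refine cart_ext (Category.id_comp _) (Category.id_comp _) ?_
    rw [lift_cart, cellId_vcomp, ← e0]
    exact (tightId_hcomp (cart L.ℓ (𝟙 L.apex))).trans (cellId_vcomp _).symm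
  have e4 := comp_pair_hcomp (looseUnit L.apex) (cellId (ehom L.ℓ (𝟙 L.apex))) (looseMap L.r)
    L.s rfl (Category.id_comp _) (Category.id_comp _) (Category.id_comp _)
  rw [unit_looseMap, cellId_vcomp] at e4
  refine (e1.trans ((congrArg (· ⨾ L.s) e3).trans (cellId_vcomp _))).trans ?_
  exact (e4.trans (tightId_hcomp _)).symm

theorem lift_s {x y z : X} {f : x ⟶ L.apex} {g : y ⟶ L.apex} {h : z ⟶ A} {h₁ f₁ g₁ h₂}
    {P : LoosePath Loose x y} {Q : LoosePath Loose y z} {R : LoosePath Loose x z}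
    (α : Cell f P g (looseId L.apex)) (β : Cell g Q h (ehom L.ℓ (𝟙 L.apex)))
    (hR : P.append Q = R) (hh : h ≫ L.ℓ = h₁) (hf : f ≫ L.r = f₁) (hg : g ≫ L.r = g₁)
    (hh' : h ≫ j = h₂) :
    vcomp (lift L.ℓ (𝟙 L.apex)
      (hcomp α (vcomp β (cart L.ℓ (𝟙 L.apex)) (Category.comp_id g) hh) hR)
        (Category.comp_id f) hh) L.s hf hh' =
      hcomp (vcomp α (looseMap L.r) hf hg) (vcomp β L.s hg hh') hR := by
  rw [← L.comp_pair_act, ← comp_pair_hcomp α β (looseMap L.r) L.s hR hf hg hh', ← act_s]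
  exact (comp_pair_vcomp α β hR L.act L.s _ _ _ _ _ _ _ _).symm

theorem lift_s_unit {x : X} {f : x ⟶ L.apex} {P : LoosePath Loose x A}
    (α : Cell f P L.ℓ (looseId L.apex)) {f₁} (hf : f ≫ L.r = f₁) :
    vcomp (lift L.ℓ (𝟙 L.apex) α (Category.comp_id f) (Category.id_comp _)) L.s hf
        (Category.id_comp j) = hcompR (vcomp α (looseMap L.r) hf rfl) L.unit := by
  have e := L.lift_s α L.ι P.append_nil (Category.id_comp _) hf rfl (Category.id_comp j)
  rw [ι_cart] at e
  have e' := hcomp_tightId α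
  rw [hcompR] at e'
  rw [e'] at e
  exact e

/-- The canonical 2-cell `E(j, ℓ ≫ r) ⇒ E(j, r)`. -/
noncomputable def lam : Cell L.ℓ (.single (ehom j (L.ℓ ≫ L.r))) (𝟙 A) (ehom j L.r) :=
  resFactor j L.r L.ℓ rfl

theorem lam_cart : vcomp L.lam (cart j L.r) rfl (Category.id_comp _) = cart j (L.ℓ ≫ L.r) :=
  lift_cart ..

/-- The 2-cell `E(j, ℓ ≫ r) ⇒ C(ℓ, 1)` induced by `♭`. -/
noncomputable def lamFlat : Cell L.ℓ (.single (ehom j (L.ℓ ≫ L.r))) (𝟙 A)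
    (ehom L.ℓ (𝟙 L.apex)) :=
  vcomp L.lam L.flat (Category.comp_id _) (Category.comp_id _)

theorem lamFlat_s : vcomp L.lamFlat L.s rfl (Category.id_comp j) = cart j (L.ℓ ≫ L.r) := by
  refine Eq.trans ?_ L.lam_cart
  refine (vcomp_assoc L.lam L.flat L.s _ _ _ _ (Category.id_comp _) (Category.id_comp _) rfl
    (Category.id_comp j)).trans ?_
  congr 1
  refine (gcomp_assoc _ _ _).symm.trans ?_
  rw [flat_sharp]
  exact cellId_vcomp _

/-- The 2-cell `E(j, ℓ ≫ r) ⇒ C(ℓ, ℓ)` induced by `♭`, followed by the cartesian 2-cell. -/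
noncomputable def e : Cell L.ℓ (.single (ehom j (L.ℓ ≫ L.r))) L.ℓ (looseId L.apex) :=
  vcomp L.lamFlat (cart L.ℓ (𝟙 L.apex)) (Category.comp_id _) (Category.id_comp _)

theorem lift_e : lift L.ℓ (𝟙 L.apex) L.e (Category.comp_id _) (Category.id_comp _) = L.lamFlat :=
  cart_ext (Category.comp_id _) (Category.id_comp _) (lift_cart ..)

/-- The extension operator `E(j, ℓ ≫ r) ⇒ C(ℓ, ℓ) ⇒ E(ℓ ≫ r, ℓ ≫ r)`. -/
noncomputable def ext : Cell (𝟙 A) (.single (ehom j (L.ℓ ≫ L.r))) (𝟙 A)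
    (ehom (L.ℓ ≫ L.r) (L.ℓ ≫ L.r)) :=
  lift (L.ℓ ≫ L.r) (L.ℓ ≫ L.r) (vcomp L.e (looseMap L.r) rfl rfl) (Category.id_comp _)
    (Category.id_comp _)

theorem ext_cart : L.ext ⨾ cart (L.ℓ ≫ L.r) (L.ℓ ≫ L.r) = vcomp L.e (looseMap L.r) rfl rfl :=
  lift_cart ..

theorem e_unit : hcompR (vcomp L.e (looseMap L.r) rfl rfl) L.unit = cart j (L.ℓ ≫ L.r) := by
  rw [← L.lamFlat_s, ← L.lift_e, ← lift_s_unit]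

/-- The `j`-relative monad induced by a `j`-relative adjunction. -/
noncomputable def monad : RelMonad j where
  t := L.ℓ ≫ L.r
  ext := L.ext
  unit := L.unit
  ext_unit := by
    refine cart_ext (Category.id_comp _) (Category.id_comp _) ?_
    refine (gcomp_assoc _ _ _).trans ?_
    rw [resMapL_cart, gcomp_hcomp, ext_cart, e_unit]
    exact (cellId_vcomp _).symm
  unit_ext := by
    have h : vcomp (resUnit j ⨾ resMapR j L.unit) L.lamFlat (Category.id_comp _)
        (Category.id_comp _) = L.ι := by
      refine L.s_cancel rfl (Category.id_comp _) ?_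
      refine (vcomp_assoc _ L.lamFlat L.s (Category.id_comp _) (Category.id_comp _) rfl
        (Category.id_comp _) rfl (Category.id_comp _) (Category.id_comp _)
        (Category.id_comp _)).trans ?_
      rw [lamFlat_s]
      refine (gcomp_assoc _ _ _).trans ?_
      rw [resMapR_cart, hcomp_gcomp, resUnit_cart]
      exact hcomp_tightId _
    refine cart_ext (Category.id_comp _) (Category.id_comp _) ?_
    refine (gcomp_assoc _ _ _).trans ?_
    rw [ext_cart, gcomp_vcomp, e, gcomp_vcomp]
    refine Eq.trans ?_ (resUnit_cart _).symm
    refine Eq.trans ?_ (tightId_looseMap L.ℓ L.r rfl rfl rfl rfl)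
    rw [← L.ι_cart]
    congr 2
  ext_ext := by
    set m : Cell (𝟙 A) (.pair (ehom j (L.ℓ ≫ L.r)) (ehom j (L.ℓ ≫ L.r))) (𝟙 A)
      (ehom j (L.ℓ ≫ L.r)) :=
      comp (.pair₁ L.ext (cellId (ehom j (L.ℓ ≫ L.r))))
        (resComp j (L.ℓ ≫ L.r) (L.ℓ ≫ L.r)) (Category.id_comp _) (Category.id_comp _) with hm
    have m_cart : m ⨾ cart j (L.ℓ ≫ L.r) =
        hcomp₂ (vcomp L.e (looseMap L.r) rfl rfl) (cart j (L.ℓ ≫ L.r)) := by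
      rw [hm, ← comp_pair_gcomp, resComp_cart,
        comp_pair_hcomp _ _ _ _ _ (Category.id_comp _) (Category.id_comp _) (Category.id_comp _)]
      rw [cellId_vcomp]
      congr 1
      exact L.ext_cart
    have m_lamFlat : vcomp m L.lamFlat (Category.id_comp _) (Category.id_comp _) =
        lift L.ℓ (𝟙 L.apex) (hcomp₂ L.e L.e) (Category.comp_id _) (Category.id_comp _) := by
      refine L.s_cancel rfl (Category.id_comp _) ?_
      refine Eq.trans ?_ (L.lift_s L.e L.lamFlat _ (Category.id_comp _) rfl rfl
        (Category.id_comp _)).symm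
      refine (vcomp_assoc _ L.lamFlat L.s (Category.id_comp _) (Category.id_comp _) rfl
        (Category.id_comp _) rfl (Category.id_comp _) (Category.id_comp _)
        (Category.id_comp _)).trans ?_
      rw [lamFlat_s]
      exact m_cart
    have m_e : m ⨾ L.e = hcomp₂ L.e L.e := by
      rw [e, gcomp_vcomp]
      refine (congrArg (fun φ => vcomp φ (cart L.ℓ (𝟙 L.apex)) (Category.comp_id _)
        (Category.id_comp _)) m_lamFlat).trans ?_
      rw [lift_cart]
      rfl
    refine cart_ext (Category.id_comp _) (Category.id_comp _) ?_
    refine Eq.trans ?_ (gcomp_assoc _ _ _).symm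
    rw [ext_cart, gcomp_vcomp, m_e, hcomp_looseMap L.e L.e _ L.r rfl rfl rfl]
    refine (comp_pair_gcomp _ _ _ _ _).symm.trans ?_
    rw [resComp_cart,
        comp_pair_hcomp _ _ _ _ _ (Category.id_comp _) (Category.id_comp _) (Category.id_comp _)]
    congr 1
    · exact L.ext_cart
    · exact L.ext_cart

end RelAdj

end RelativeAdjunction

section RightMorphisms

variable {X : Type u} [Category.{v} X] [VirtualEquipment.{w, z} X]

/-- The 2-cell `C(ℓ, 1) ⇒ C'(ℓ', 1)` induced by a tight-cell `c : C ⟶ C'` with `ℓ ≫ c = ℓ'`. -/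
noncomputable def pushMap {A C C' : X} (ℓ : A ⟶ C) (c : C ⟶ C') {ℓ' : A ⟶ C'} (h : ℓ ≫ c = ℓ') :
    Cell c (.single (ehom ℓ (𝟙 C))) (𝟙 A) (ehom ℓ' (𝟙 C')) :=
  lift ℓ' (𝟙 C') (vcomp (cart ℓ (𝟙 C)) (looseMap c) (Category.id_comp c) h) (Category.comp_id c)
    (Category.id_comp ℓ')

theorem pushMap_cart {A C C' : X} (ℓ : A ⟶ C) (c : C ⟶ C') {ℓ' : A ⟶ C'} (h : ℓ ≫ c = ℓ') :
    vcomp (pushMap ℓ c h) (cart ℓ' (𝟙 C')) (Category.comp_id c) (Category.id_comp ℓ') =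
      vcomp (cart ℓ (𝟙 C)) (looseMap c) (Category.id_comp c) h :=
  lift_cart ..

theorem vcomp_pushMap_cart {A C C' x y : X} (ℓ : A ⟶ C) (c : C ⟶ C') {ℓ' : A ⟶ C'}
    (h : ℓ ≫ c = ℓ') {P : LoosePath Loose x y} {f : x ⟶ C} {g : y ⟶ A}
    (φ : Cell f P g (ehom ℓ (𝟙 C))) {f₁ g₁ g₂} (hf : f ≫ c = f₁) (hg : g ≫ ℓ = g₁)
    (hg' : g ≫ ℓ' = g₂) (hg₂ : g₁ ≫ c = g₂) :
    vcomp (vcomp φ (pushMap ℓ c h) hf (Category.comp_id g)) (cart ℓ' (𝟙 C'))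
      (Category.comp_id f₁) hg' =
      vcomp (vcomp φ (cart ℓ (𝟙 C)) (Category.comp_id f) hg) (looseMap c) hf hg₂ := by
  refine (vcomp_assoc φ (pushMap ℓ c h) (cart ℓ' (𝟙 C')) _ _ _ _ (Category.comp_id c)
    (Category.id_comp ℓ') hf hg').trans ?_
  rw [pushMap_cart]
  exact (vcomp_assoc φ (cart ℓ (𝟙 C)) (looseMap c) _ _ _ _ _ _ _ _).symm

theorem pushMap_pushMap {A C C' C'' : X} (ℓ : A ⟶ C) (c : C ⟶ C') (c' : C' ⟶ C'') {ℓ' : A ⟶ C'}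
    {ℓ'' : A ⟶ C''} (h : ℓ ≫ c = ℓ') (h' : ℓ' ≫ c' = ℓ'') (h'' : ℓ ≫ c ≫ c' = ℓ'') :
    vcomp (pushMap ℓ c h) (pushMap ℓ' c' h') rfl (Category.comp_id _) =
      pushMap ℓ (c ≫ c') h'' := by
  refine cart_ext (Category.comp_id _) (Category.id_comp _) ?_
  rw [pushMap_cart]
  refine (vcomp_pushMap_cart ℓ' c' h' (pushMap ℓ c h) rfl (Category.id_comp ℓ')
    (Category.id_comp _) h').trans ?_
  rw [pushMap_cart, ← looseMap_comp]
  exact vcomp_assoc _ _ _ _ _ _ _ _ _ _ _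

theorem pushMap_id {A C : X} (ℓ : A ⟶ C) :
    pushMap ℓ (𝟙 C) (Category.comp_id ℓ) = cellId (ehom ℓ (𝟙 C)) := by
  refine cart_ext (Category.comp_id _) (Category.id_comp _) ?_
  rw [pushMap_cart]
  have e : looseMap (𝟙 C) = cellId (looseId C) := by
    refine looseId_ext (.nil C) (.nil C) ?_
    refine (unit_looseMap (𝟙 C)).trans ?_
    exact (ids_comp (looseUnit C)).trans (vcomp_cellId (looseUnit C)).symm
  rw [e]
  exact (vcomp_cellId _).trans (cellId_vcomp _).symm

variable {A E : X} {j : A ⟶ E}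

/-- The compatibility condition of a right-morphism in terms of 2-cells into `E(1, 1)`. -/
theorem compat_iff {L R : RelAdj j} (c : L.apex ⟶ R.apex) (h : L.ℓ ≫ c = R.ℓ)
    (ρ : TightCell L.r (c ≫ R.r)) :
    (L.sharp ⨾ resMapR j ρ = postMap L.ℓ (𝟙 L.apex) c h (Category.id_comp c) ⨾
      resAlong R.sharp c (Category.comp_id c) rfl) ↔
    hcompL ρ L.s = vcomp (pushMap L.ℓ c h) R.s rfl (Category.id_comp j) := by
  have e1 : L.sharp ⨾ resMapR j ρ ⨾ cart j (c ≫ R.r) = hcompL ρ L.s := by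
    rw [gcomp_assoc, resMapR_cart, hcomp_gcomp]
    rfl
  have e2 : postMap L.ℓ (𝟙 L.apex) c h (Category.id_comp c) ⨾
      resAlong R.sharp c (Category.comp_id c) rfl ⨾ cart j (c ≫ R.r) =
        vcomp (pushMap L.ℓ c h) R.s rfl (Category.id_comp j) := by
    rw [gcomp_assoc, resAlong_cart, gcomp_vcomp]
    have e3 : postMap L.ℓ (𝟙 L.apex) c h (Category.id_comp c) ⨾
        resFactor R.ℓ (𝟙 R.apex) c (Category.comp_id c) = pushMap L.ℓ c h := by
      refine cart_ext (Category.comp_id _) (Category.id_comp _) ?_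
      rw [pushMap_cart, ← gcomp_vcomp, resFactor, lift_cart, postMap_cart]
    rw [e3]
    rfl
  constructor
  · intro h
    rw [← e1, ← e2, h]
  · intro h
    exact cart_ext (Category.id_comp _) (Category.id_comp _) (e1.trans (h.trans e2.symm))

theorem RightMor.ext_heq {L R : RelAdj j} {f g : RightMor L R} (hc : f.c = g.c)
    (hρ : HEq f.ρ g.ρ) : f = g := by
  cases f
  cases g
  cases hc
  cases hρ
  rfl

/-- The identity right-morphism. -/
noncomputable def RightMor.id (L : RelAdj j) : RightMor L L where
  c := 𝟙 L.apex
  ℓ_comp := Category.comp_id L.ℓ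
  ρ := tightId L.r (Category.id_comp L.r).symm rfl
  compat := by
    rw [compat_iff, pushMap_id]
    have key : ∀ k (h : L.r = k), HEq (hcompL (tightId L.r h rfl) L.s) L.s := by
      intro k h
      subst h
      exact heq_of_eq (tightId_hcomp _)
    have key' : ∀ k (h : 𝟙 L.apex ≫ L.r = k),
        HEq (vcomp (cellId (ehom L.ℓ (𝟙 L.apex))) L.s h (Category.id_comp j)) L.s := by
      intro k h
      obtain rfl : L.r = k := (Category.id_comp _).symm.trans h
      exact heq_of_eq (cellId_vcomp _)
    exact eq_of_heq ((key _ _).trans (key' _ _).symm)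

/-- Composition of right-morphisms. -/
noncomputable def RightMor.comp {L M N : RelAdj j} (f : RightMor L M) (g : RightMor M N) :
    RightMor L N where
  c := f.c ≫ g.c
  ℓ_comp := by rw [← Category.assoc, f.ℓ_comp, g.ℓ_comp]
  ρ := hcompL (precomp f.c g.ρ (Category.assoc f.c g.c N.r).symm rfl) f.ρ
  compat := by
    rw [compat_iff]
    refine (hcomp_assoc _ _ _ _ _ (LoosePath.nil_append _) (LoosePath.nil_append _)).trans ?_
    refine (congrArg (hcompL _) ((compat_iff f.c f.ℓ_comp f.ρ).1 f.compat)).trans ?_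
    refine (precomp_hcomp_vcomp g.ρ (pushMap L.ℓ f.c f.ℓ_comp) M.s
      (Category.assoc f.c g.c N.r).symm rfl (Category.id_comp j)).trans ?_
    rw [(compat_iff g.c g.ℓ_comp g.ρ).1 g.compat, ← pushMap_pushMap L.ℓ f.c g.c f.ℓ_comp g.ℓ_comp]
    exact (vcomp_assoc _ _ _ _ _ _ _ _ _ _ _).symm

/-- The category `RAdj_R(j)` of `j`-relative adjunctions and right-morphisms. -/
noncomputable instance RelAdj.category : Category (RelAdj j) where
  Hom := RightMor
  id := RightMor.id
  comp := RightMor.comp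
  id_comp {L R} f := by
    refine RightMor.ext_heq (Category.id_comp f.c) ?_
    have key : ∀ k l (hk : 𝟙 L.apex ≫ f.c ≫ R.r = k) (hl : 𝟙 L.apex ≫ L.r = l) (hl' : L.r = l),
        HEq (hcompL (precomp (𝟙 L.apex) f.ρ hk hl) (tightId L.r hl' rfl)) f.ρ := by
      intro k l hk hl hl'
      subst hl'
      obtain rfl := (Category.id_comp _).symm.trans hk
      refine heq_of_eq ((hcomp_tightId _).trans (precomp_id _))
    exact key _ _ _ _ (Category.id_comp _).symm
  comp_id {L R} f := by
    refine RightMor.ext_heq (Category.comp_id f.c) ?_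
    have key : ∀ k (hk : f.c ≫ 𝟙 R.apex ≫ R.r = k),
        HEq (hcompL (precomp f.c (tightId R.r (Category.id_comp R.r).symm rfl) hk rfl) f.ρ)
          f.ρ := by
      intro k hk
      rw [precomp_tightId]
      obtain rfl : f.c ≫ R.r = k := by rw [← hk, Category.id_comp]
      exact heq_of_eq (tightId_hcomp _)
    exact key _ _
  assoc {K L M N} f g h := by
    refine RightMor.ext_heq (Category.assoc _ _ _) ?_
    have key : ∀ k k' (hk : (f.c ≫ g.c) ≫ h.c ≫ N.r = k) (hk₁ : f.c ≫ g.c ≫ h.c ≫ N.r = k')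
        (hk₂ : g.c ≫ h.c ≫ N.r = (g.c ≫ h.c) ≫ N.r) (hk₃ : f.c ≫ (g.c ≫ h.c) ≫ N.r = k'),
        HEq (hcompL (precomp (f.c ≫ g.c) h.ρ hk rfl)
          (hcompL (precomp f.c g.ρ (Category.assoc f.c g.c M.r).symm rfl) f.ρ))
        (hcompL (precomp f.c (hcompL (precomp g.c h.ρ hk₂ rfl) g.ρ) hk₃ rfl) f.ρ) := by
      intro k k' hk hk₁ hk₂ hk₃
      obtain rfl : k = k' := by rw [← hk, ← hk₁, Category.assoc]
      rw [precomp_hcomp f.c (precomp g.c h.ρ hk₂ rfl) g.ρ hk₃ (Category.assoc f.c g.c M.r).symm rfl,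
        precomp_precomp f.c g.c h.ρ hk₂ rfl hk₃ (Category.assoc f.c g.c M.r).symm rfl hk rfl]
      exact heq_of_eq (hcomp_assoc _ _ _ _ _ _ _).symm
    exact key _ _ _ (show f.c ≫ g.c ≫ h.c ≫ N.r = (f.c ≫ g.c ≫ h.c) ≫ N.r by
      simp only [Category.assoc]) _ _

end RightMorphisms

section Oslash

variable {X : Type u} [Category.{v} X] [VirtualEquipment.{w, z} X] {A E : X} {j : A ⟶ E}

theorem ι_pushMap {L R : RelAdj j} (c : L.apex ⟶ R.apex) (h : L.ℓ ≫ c = R.ℓ) :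
    vcomp L.ι (pushMap L.ℓ c h) h (Category.comp_id _) = R.ι := by
  refine cart_ext (Category.comp_id _) (Category.id_comp _) ?_
  refine (vcomp_pushMap_cart L.ℓ c h L.ι h (Category.id_comp _) (Category.id_comp _) h).trans ?_
  rw [L.ι_cart, R.ι_cart, tightId_looseMap]
  have : ∀ k (h : L.ℓ ≫ c = k), tightId (L.ℓ ≫ c) h h = tightId k rfl rfl := by
    intro k h
    subst h
    rfl
  exact this _ _

/-- The transpose of a right-morphism. -/
noncomputable def RightMor.transposeCell {L R : RelAdj j} (f : RightMor L R) :
    TightCell (L.ℓ ≫ L.r) (R.ℓ ≫ R.r) :=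
  precomp L.ℓ f.ρ (by rw [← Category.assoc, f.ℓ_comp]) rfl

theorem e_pushMap {L R : RelAdj j} (f : RightMor L R) :
    vcomp L.e (looseMap f.c) f.ℓ_comp f.ℓ_comp = resMapR j f.transposeCell ⨾ R.e := by
  have h1 : vcomp L.lamFlat (pushMap L.ℓ f.c f.ℓ_comp) f.ℓ_comp (Category.comp_id _) =
      resMapR j f.transposeCell ⨾ R.lamFlat := by
    refine R.s_cancel rfl (Category.id_comp j) ?_
    have hh : L.ℓ ≫ f.c ≫ R.r = R.ℓ ≫ R.r := by rw [← Category.assoc, f.ℓ_comp]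
    refine (vcomp_assoc _ _ _ _ _ _ _ rfl (Category.id_comp j) hh (Category.id_comp _)).trans ?_
    rw [← (compat_iff f.c f.ℓ_comp f.ρ).1 f.compat]
    refine (precomp_hcomp_vcomp f.ρ L.lamFlat L.s hh rfl (Category.id_comp j)).symm.trans ?_
    rw [L.lamFlat_s, ← gcomp_vcomp, R.lamFlat_s, resMapR_cart]
    rfl
  rw [RelAdj.e, RelAdj.e, gcomp_vcomp, ← h1]
  exact (vcomp_pushMap_cart L.ℓ f.c f.ℓ_comp L.lamFlat f.ℓ_comp (Category.id_comp _)
    (Category.id_comp _) f.ℓ_comp).symm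

/-- The morphism of induced relative monads given by a right-morphism. -/
noncomputable def RightMor.transpose {L R : RelAdj j} (f : RightMor L R) :
    L.monad ⟶ R.monad where
  τ := f.transposeCell
  unit_comp := by
    have hh : L.ℓ ≫ f.c ≫ R.r = R.ℓ ≫ R.r := by rw [← Category.assoc, f.ℓ_comp]
    refine (precomp_hcomp_vcomp f.ρ L.ι L.s hh rfl (Category.id_comp j)).trans ?_
    rw [(compat_iff f.c f.ℓ_comp f.ρ).1 f.compat]
    refine (vcomp_assoc L.ι _ R.s f.ℓ_comp (Category.comp_id _) rfl (Category.id_comp j) _ _ _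
      _).symm.trans ?_
    rw [ι_pushMap]
    rfl
  ext_comp := by
    refine cart_ext (Category.id_comp _) (Category.id_comp _) ?_
    refine (gcomp_assoc _ _ _).trans (Eq.trans ?_ (gcomp_assoc _ _ _).symm)
    have e1 := resMapR_cart L.monad.t f.transposeCell
    have e2 := resMapL_cart f.transposeCell R.monad.t
    refine (congrArg (L.monad.ext ⨾ ·) e1).trans (Eq.trans ?_
      (congrArg (resMapR j f.transposeCell ⨾ R.monad.ext ⨾ ·) e2).symm)
    refine (hcomp_gcomp _ _ _).trans (Eq.trans ?_ (gcomp_hcomp _ _ _).symm)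
    have h1 : L.monad.ext ⨾ cart L.monad.t L.monad.t = vcomp L.e (looseMap L.r) rfl rfl :=
      L.ext_cart
    have h2 : resMapR j f.transposeCell ⨾ R.monad.ext ⨾ cart R.monad.t R.monad.t =
        vcomp (resMapR j f.transposeCell ⨾ R.e) (looseMap R.r) rfl rfl :=
      (gcomp_assoc _ _ _).trans
        ((congrArg (resMapR j f.transposeCell ⨾ ·) R.ext_cart).trans (gcomp_vcomp _ _ _ rfl rfl))
    refine (congrArg (hcompL f.transposeCell) h1).trans ?_
    refine Eq.trans ?_ (congrArg (hcompR · f.transposeCell) h2).symm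
    have hh : L.ℓ ≫ f.c ≫ R.r = R.ℓ ≫ R.r := by rw [← Category.assoc, f.ℓ_comp]
    refine (precomp_hcomp_looseMap f.ρ L.e rfl hh rfl hh).trans ?_
    rw [← e_pushMap, ← looseMap_comp]
    congr 1
    exact (vcomp_assoc _ _ _ _ _ _ _ _ _ _ _).symm

/-- The functor `⊘_j` sending a `j`-relative adjunction to the `j`-relative monad it induces. -/
noncomputable def oslash (j : A ⟶ E) : RelAdj j ⥤ RelMonad j where
  obj L := L.monad
  map f := RightMor.transpose f
  map_id L := RelMonadHom.ext (precomp_tightId _ _ (Category.id_comp L.r).symm rfl _ _)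
  map_comp {L M N} f g := by
    refine RelMonadHom.ext ?_
    have hh : L.ℓ ≫ f.c ≫ M.r = M.ℓ ≫ M.r := by rw [← Category.assoc, f.ℓ_comp]
    have hh' : M.ℓ ≫ g.c ≫ N.r = N.ℓ ≫ N.r := by rw [← Category.assoc, g.ℓ_comp]
    have hh'' : L.ℓ ≫ (f.c ≫ g.c) ≫ N.r = N.ℓ ≫ N.r := by
      rw [← hh', ← f.ℓ_comp]; simp only [Category.assoc]
    refine (precomp_hcomp L.ℓ _ f.ρ hh'' hh rfl).trans ?_
    refine congrArg (hcompL · (precomp L.ℓ f.ρ hh rfl)) ?_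
    exact precomp_precomp L.ℓ f.c g.ρ _ _ hh'' hh f.ℓ_comp hh' rfl

end Oslash

section Resolutions

variable {X : Type u} [Category.{v} X] [VirtualEquipment.{w, z} X] {A E : X} {j : A ⟶ E}

/-- A resolution of a `j`-relative monad `T`: a `j`-relative adjunction inducing `T`. -/
structure Resolution (T : RelMonad j) where
  adj : RelAdj j
  eq_monad : T = (oslash j).obj adj

/-- A morphism of resolutions. -/
@[ext]
structure ResolutionHom {T : RelMonad j} (L R : Resolution T) where
  c : L.adj.apex ⟶ R.adj.apex
  ℓ_comp : L.adj.ℓ ≫ c = R.adj.ℓ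
  comp_r : c ≫ R.adj.r = L.adj.r

/-- The category `Res(T)`. -/
instance Resolution.category (T : RelMonad j) : Category (Resolution T) where
  Hom := ResolutionHom
  id L := ⟨𝟙 L.adj.apex, Category.comp_id _, Category.id_comp _⟩
  comp f g := ⟨f.c ≫ g.c, by rw [← Category.assoc, f.ℓ_comp, g.ℓ_comp],
    by rw [Category.assoc, g.comp_r, f.comp_r]⟩
  id_comp f := ResolutionHom.ext (Category.id_comp f.c)
  comp_id f := ResolutionHom.ext (Category.comp_id f.c)
  assoc f g h := ResolutionHom.ext (Category.assoc f.c g.c h.c)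

/-- The functor sending a `j`-relative adjunction to its left adjoint, as an object of the
category of strict coslices under `A`. -/
def leftAdjoint (j : A ⟶ E) : RelAdj j ⥤ Under A where
  obj L := Under.mk L.ℓ
  map f := Under.homMk (RightMor.c f) (RightMor.ℓ_comp f)
  map_id _ := rfl
  map_comp _ _ := rfl

end Resolutions

section Opalgebras

variable {X : Type u} [Category.{v} X] [VirtualEquipment.{w, z} X] {A E : X} {j : A ⟶ E}

/-- An opalgebra for a relative monad. -/
structure Opalgebra (T : RelMonad j) where
  B : X
  a : A ⟶ B
  opext : Cell (𝟙 A) (.single (ehom j T.t)) (𝟙 A) (ehom a a)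
  unit_opext : resUnit j ⨾ resMapR j T.unit ⨾ opext = resUnit a
  opext_opext :
    comp (.pair₁ opext opext) (resComp a a a) (Category.id_comp _) (Category.id_comp _) =
      comp (.pair₁ T.ext (cellId (ehom j T.t))) (resComp j T.t T.t) (Category.id_comp _)
        (Category.id_comp _) ⨾ opext

/-- The opalgebra `(t, †)`. -/
def RelMonad.opalgebra (T : RelMonad j) : Opalgebra T where
  B := E
  a := T.t
  opext := T.ext
  unit_opext := T.unit_ext
  opext_opext := T.ext_ext

/-- The right action `E(j, t), B(1, a) ⇒ B(1, a)` corresponding to the opextension operator. -/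
noncomputable def Opalgebra.action {T : RelMonad j} (U : Opalgebra T) :
    Cell (𝟙 A) (.pair (ehom j T.t) (ehom (𝟙 U.B) U.a)) (𝟙 U.B) (ehom (𝟙 U.B) U.a) :=
  comp (.pair₁ U.opext (cellId (ehom (𝟙 U.B) U.a))) (resComp (𝟙 U.B) U.a U.a)
    (Category.id_comp _) (Category.id_comp _)

/-- Graded morphisms of opalgebras.  The grading is the chain `P` of loose-cells from the
codomain of `U` to the codomain of `V`. -/
def IsGradedOpalgebraMor {T : RelMonad j} (U V : Opalgebra T) (P : LoosePath Loose U.B V.B)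
    (α : Cell (𝟙 A) (.cons (ehom (𝟙 U.B) U.a) P) (𝟙 V.B) (ehom (𝟙 V.B) V.a)) : Prop :=
  comp (.cons U.action (Row.ids P) rfl) α (Category.id_comp _) (Category.id_comp _) =
    comp (.pair (cellId (ehom j T.t)) α rfl) V.action (Category.id_comp _) (Category.id_comp _)

/-- A tight-cell `c` carries the opalgebra `U` to the opalgebra `V`. -/
def IsMediating {T : RelMonad j} (U V : Opalgebra T) (c : U.B ⟶ V.B) : Prop :=
  ∃ h : U.a ≫ c = V.a, U.opext ⨾ postMap U.a U.a c h h = V.opext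

/-- An opalgebra object for a relative monad. -/
structure OpalgebraObject (T : RelMonad j) extends Opalgebra T where
  existsUnique_mediating : ∀ U : Opalgebra T, ∃! c, IsMediating toOpalgebra U c
  /-- Each graded morphism `α` between opalgebras is the restriction along `k_T` of a unique
  2-cell between the mediating tight-cells. -/
  existsUnique_cell : ∀ (U V : Opalgebra T) (c : B ⟶ U.B) (d : B ⟶ V.B) (hc : a ≫ c = U.a)
    (hd : a ≫ d = V.a), IsMediating toOpalgebra U c → IsMediating toOpalgebra V d →
    ∀ (P : LoosePath Loose U.B V.B)
      (α : Cell (𝟙 A) (.cons (ehom (𝟙 U.B) U.a) P) (𝟙 V.B) (ehom (𝟙 V.B) V.a)),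
      IsGradedOpalgebraMor U V P α →
      ∃! β : Cell (𝟙 B) (.cons (ehom (𝟙 U.B) c) P) (𝟙 V.B) (ehom (𝟙 V.B) d),
        comp (.cons (resFactor (𝟙 U.B) c a hc) (Row.ids P) rfl) β (Category.comp_id a)
            (Category.id_comp (𝟙 V.B)) =
          vcomp α (resFactor (𝟙 V.B) d a hd) (Category.id_comp a) (Category.id_comp (𝟙 V.B))

/-- The tight-cell `v_T` out of an opalgebra object, induced by the opalgebra `(t, †)`. -/
noncomputable def OpalgebraObject.v {T : RelMonad j} (O : OpalgebraObject T) : O.B ⟶ E :=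
  (O.existsUnique_mediating T.opalgebra).choose

variable (j) in
/-- The `j`-relative monads admitting opalgebra objects. -/
def AdmitsOpalgebraObject : ObjectProperty (RelMonad j) :=
  fun T => Nonempty (OpalgebraObject T)

end Opalgebras

section Density

variable {X : Type u} [Category.{v} X] [VirtualEquipment.{w, z} X]

/-- The 2-cell `ϖ` exhibits `l` as the right lift of `q` through `p`. -/
def IsRightLift {x y z : X} (p : Loose y z) (q : Loose x z) (l : Loose x y)
    (ϖ : Cell (𝟙 x) (.pair l p) (𝟙 z) q) : Prop :=
  ∀ (R : LoosePath Loose x y) (φ : Cell (𝟙 x) (R.append (.single p)) (𝟙 z) q),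
    ∃! ψ : Cell (𝟙 x) R (𝟙 y) l,
      comp (.pair ψ (cellId p) rfl) ϖ (Category.id_comp _) (Category.id_comp _) = φ

/-- The `p`-weighted cylinder `(c, γ)` for `f` is colimiting. -/
def IsColimiting {x y z : X} (p : Loose y z) (f : z ⟶ x) (c : y ⟶ x)
    (γ : Cell (𝟙 y) (.single p) (𝟙 z) (ehom f c)) : Prop :=
  IsRightLift p (ehom f (𝟙 x)) (ehom c (𝟙 x))
    (comp (.pair₁ (cellId (ehom c (𝟙 x))) γ) (resComp f c (𝟙 x)) (Category.id_comp _)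
      (Category.id_comp _))

/-- The 2-cell `π : f ⇒ j ≫ e` exhibits `e` as the (pointwise) left extension of `f` along `j`. -/
def IsLeftExtension {x y z : X} (j : z ⟶ y) (f : z ⟶ x) (e : y ⟶ x) (π : TightCell f (j ≫ e)) :
    Prop :=
  IsColimiting (ehom j (𝟙 y)) f e (postMap j (𝟙 y) e rfl (Category.id_comp e) ⨾ resMapL π e)

/-- Dense tight-cells. -/
def IsDense {A E : X} (j : A ⟶ E) : Prop :=
  IsLeftExtension j j (𝟙 E) (tightId j (Category.comp_id j).symm rfl)

end Density

end FormalCat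

open FormalCat

/-! Write `k`, `⋉`, `v` for the structure of an opalgebra object of `T`, with apex `B`; then `k ≫ v
= t`, and `v` carries `⋉` to `†`.

The adjunction. The 2-cell `♯ : B(k, 1) ⇒ E(j, v)` applies `v` and then restricts along `η`. For
`♭`, the composite `E(1, t), E(j, 1) ⇒ E(j, t) ⇒ B(k, k)` of composition with `⋉` is, by
associativity, a morphism from `(t, †)` to `(k, ⋉)` graded by `E(j, 1)`. It therefore extends along
`k` to a 2-cell out of `E(1, v), E(j, 1)`, which is `♭` up to transposition. The uniqueness of such
extensions, with the law relating `†` and `η`, makes `♭` followed by `♯` the identity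
(`flatCell_unit`). In the other order a Yoneda argument (`conjUnit_ext`) reduces the claim to the
unit law of the opalgebra. The induced relative monad is `T` because `⋉` is forced to be the 2-cell
`E(j, t) ⇒ B(k, k)` obtained from `♭` (`RelAdj.monad_eq_and_e_eq`).

Transposition. The left adjoint `ℓ'` of any relative adjunction is an opalgebra for the relative
monad it induces, and a morphism `σ` from `T` to that relative monad restricts it to a
`T`-opalgebra. Its mediating tight-cell is the only possible `c` with transpose `σ`
(`isMediating_c`). Moreover `σ` is a morphism of opalgebras from `(t, †)` to the image of this
opalgebra under `r'`, so it extends uniquely to `ρ : v ⇒ c ≫ r'` (`existsUnique_ρ`). Compatibility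
with `♯` is, again by Yoneda, nothing but the unit law of `σ` (`compat_of_precomp_eq`). Hence
transposition is bijective, and `S` is defined on morphisms as its inverse.

Consequences. A 2-cell `ρ` which is an identity transposes to an identity, and conversely by the two
uniqueness clauses (`isStrict_iff`). Strict right-morphisms with identity transpose are the
morphisms of resolutions, which gives initiality. If `j` is dense, `ρ` can be recovered from `E(j,
ρ)`, which the compatibility condition expresses in terms of `c`. Right-morphisms are then the same
as morphisms of coslices (`IsDense.existsUnique_rightMor`). -/

namespace FormalCat

open VDCData VirtualDoubleCategory VirtualEquipment

/-! ### Pasting calculus: associativity, units of `E(1, g)` and `E(f, 1)`, the Yoneda lemma -/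

section Calculus

variable {X : Type u} [Category.{v} X] [VirtualEquipment.{w, z} X]

theorem Row.pair_append_nil {a b c a' b' c' : X} {f : a ⟶ a'} {g : b ⟶ b'} {h : c ⟶ c'}
    {P : LoosePath Loose a b} {Q : LoosePath Loose b c} {R : LoosePath Loose a c}
    {p : Loose a' b'} {q : Loose b' c'} (α : Cell (X := X) f P g p) (β : Cell g Q h q)
    (hR : P.append Q = R) :
    (Row.pair α β hR).append (Row.nil h) R.append_nil = Row.pair α β hR := by
  have key : ∀ S (hS : Q.append (.nil _) = S) (h' : P.append S = R),
      Row.cons α (.cons β (.nil h) hS) h' = .pair α β hR := by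
    intro S hS h'
    obtain rfl : Q = S := Q.append_nil.symm.trans hS
    rfl
  exact key _ rfl _

/-- Appending an empty chain returns the original chain only propositionally, so the two rows have
different types and are compared heterogeneously. -/
theorem Row.append_nil_heq {a b a' b' : X} {f : a ⟶ a'} {g : b ⟶ b'} {P P₁ : LoosePath Loose a b}
    {Q : LoosePath Loose a' b'} (Φ : Row (X := X) f P g Q) (hP : P.append (.nil b) = P₁) :
    HEq (Φ.append (.nil g) hP) Φ := by
  induction Φ with
  | nil f => subst hP; rfl
  | @cons a b c a' b' c' f g h P P' P'' q Q φ Φ hΦ ih =>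
    obtain rfl : P'' = P₁ := P''.append_nil.symm.trans hP
    have key : ∀ (S : LoosePath Loose b c) (S' : LoosePath Loose b' c') (Ψ : Row g S h S')
        (_ : S = P') (_ : S' = Q) (_ : HEq Ψ Φ) (h' : P.append S = P''),
        HEq (Row.cons φ Ψ h') (Row.cons φ Φ hΦ) := by
      intro S S' Ψ h₁ h₂ h₃ h'
      subst h₁ h₂
      cases h₃
      rfl
    exact key _ _ _ P'.append_nil Q.append_nil (ih rfl) _

/-- Associativity of a single block produces a row with an empty row appended, as in `comp_single`;
this is the usable form, with the empty row removed. -/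
theorem comp_vcomp {a b a' b' a'' b'' a₃ b₃ : X} {f : a ⟶ a'} {P : LoosePath Loose a b}
    {g : b ⟶ b'} {Q : LoosePath Loose a' b'} {f' : a' ⟶ a''} {g' : b' ⟶ b''} {r : Loose a'' b''}
    {f'' : a'' ⟶ a₃} {g'' : b'' ⟶ b₃} {s : Loose a₃ b₃}
    (Φ : Row (X := X) f P g Q) (ψ : Cell f' Q g' r) (χ : Cell f'' (.single r) g'' s)
    {k k' l l' m n} (hk : f ≫ f' = k) (hl : g ≫ g' = l) (hk' : k ≫ f'' = k')
    (hl' : l ≫ g'' = l') (hm : f' ≫ f'' = m) (hn : g' ≫ g'' = n)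
    (hm' : f ≫ m = k') (hn' : g ≫ n = l') :
    comp Φ (vcomp ψ χ hm hn) hm' hn' = vcomp (comp Φ ψ hk hl) χ hk' hl' := by
  refine Eq.trans ?_ (comp_single Φ ψ χ hk hl hk' hl' hm hn hm' hn')
  have key : ∀ (Q' : LoosePath Loose a' b') (hQ : Q.append (.nil b') = Q') (Φ' : Row f P g Q')
      (_ : HEq (Φ.append (.nil g) P.append_nil) Φ'),
      comp Φ' (comp (Row.cons ψ (.nil g') hQ) χ hm hn) hm' hn' =
        comp (Φ.append (.nil g) P.append_nil) (comp (Row.cons ψ (.nil g') rfl) χ hm hn)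
          hm' hn' := by
    intro Q' hQ Φ' h
    subst hQ
    cases h
    rfl
  exact key Q Q.append_nil Φ (Row.append_nil_heq Φ _)

/-- Associativity for triples of 2-cells. -/
theorem comp_triple {a b c d a' b' c' d' a'' b'' c'' d'' a₃ d₃ : X} {f : a ⟶ a'} {g : b ⟶ b'}
    {h : c ⟶ c'} {i : d ⟶ d'}
    {P₁ : LoosePath Loose a b} {P₂ : LoosePath Loose b c} {P₃ : LoosePath Loose c d}
    {Q₁ : LoosePath Loose a' b'} {Q₂ : LoosePath Loose b' c'} {Q₃ : LoosePath Loose c' d'}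
    (Φ₁ : Row (X := X) f P₁ g Q₁) (Φ₂ : Row g P₂ h Q₂) (Φ₃ : Row h P₃ i Q₃)
    {f' : a' ⟶ a''} {g' : b' ⟶ b''} {h' : c' ⟶ c''} {i' : d' ⟶ d''}
    {r₁ : Loose a'' b''} {r₂ : Loose b'' c''} {r₃ : Loose c'' d''}
    (φ₁ : Cell f' Q₁ g' r₁) (φ₂ : Cell g' Q₂ h' r₂) (φ₃ : Cell h' Q₃ i' r₃)
    {f'' : a'' ⟶ a₃} {i'' : d'' ⟶ d₃} {s : Loose a₃ d₃}
    (χ : Cell f'' (.cons r₁ (.pair r₂ r₃)) i'' s)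
    {k l m n x y x' y'} (hk : f ≫ f' = k) (hl : g ≫ g' = l) (hm : h ≫ h' = m) (hn : i ≫ i' = n)
    (hx : f' ≫ f'' = x) (hy : i' ≫ i'' = y) (hx' : f ≫ x = x') (hy' : i ≫ y = y')
    (hk' : k ≫ f'' = x') (hn' : n ≫ i'' = y') :
    comp (Φ₁.append (Φ₂.append (Φ₃.append (.nil i) P₃.append_nil) rfl) rfl)
      (comp (Row.cons φ₁ (Row.cons φ₂ (Row.cons φ₃ (.nil i') rfl) rfl) rfl) χ hx hy) hx' hy' =
    comp (Row.cons (comp Φ₁ φ₁ hk hl) (Row.cons (comp Φ₂ φ₂ hl hm)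
      (Row.single (comp Φ₃ φ₃ hm hn)) rfl) rfl) χ hk' hn' := by
  subst hk hl hm hn
  exact comp_assoc' (.cons Φ₁ φ₁ (.cons Φ₂ φ₂ (.cons Φ₃ φ₃ (.nil _ _) P₃.append_nil) rfl) rfl) χ
    hx hy hx' hy'

/-- Composition of a pair with a horizontal composite with a nullary 2-cell. -/
theorem comp_pair_hcompR {a b c a' b' c' e : X} {f : a ⟶ a'} {g : b ⟶ b'} {h : c ⟶ c'}
    {P : LoosePath Loose a b} {Q : LoosePath Loose b c} {R : LoosePath Loose a c}
    {p : Loose a' b'} {q : Loose b' c'} (α : Cell (X := X) f P g p) (β : Cell g Q h q)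
    (hR : P.append Q = R) {x : a' ⟶ e} {y z : c' ⟶ e} (ψ : Cell x (.pair p q) y (looseId e))
    (τ : Cell y (.nil c') z (looseId e)) {x' y' z'} (hx : f ≫ x = x') (hy : h ≫ y = y')
    (hz : h ≫ z = z') :
    comp (.pair α β hR) (hcompR ψ τ) hx hz =
      hcompR (comp (.pair α β hR) ψ hx hy) (precomp h τ hy hz) := by
  have e := comp_pair (.pair α β hR) (.nil h) R.append_nil ψ τ (looseMul e) hx hy hz
    (Category.comp_id _) (Category.comp_id _) hx hz
  exact (congrArg (fun Φ => comp Φ (hcompR ψ τ) hx hz) (Row.pair_append_nil α β hR)).symm.trans e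

theorem cellId_gcomp {a b a' b' : X} {f : a ⟶ a'} {p : Loose a b} {g : b ⟶ b'}
    {q : Loose a' b'} (φ : Cell (X := X) f (.single p) g q) : cellId p ⨾ φ = φ :=
  ids_comp φ

theorem comp_pair_cellId_left {a b c e : X} {Q : LoosePath Loose b c} {R : LoosePath Loose a c}
    {p : Loose a b} {q : Loose b c} {f : a ⟶ e} {g : b ⟶ e} {h : c ⟶ e}
    (ψ : Cell (X := X) (𝟙 b) Q (𝟙 c) q) (α : Cell f (.single p) g (looseId e))
    (β : Cell g (.single q) h (looseId e)) (hR : (LoosePath.single p).append Q = R) :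
    comp (.pair (cellId p) ψ hR) (hcomp₂ α β) (Category.id_comp _) (Category.id_comp _) =
      hcomp α (ψ ⨾ β) hR := by
  rw [comp_pair_hcomp _ _ _ _ _ (Category.id_comp _) (Category.id_comp _) (Category.id_comp _),
    cellId_vcomp]

theorem comp_pair_cellId_right {a b c e : X} {P : LoosePath Loose a b} {R : LoosePath Loose a c}
    {p : Loose a b} {q : Loose b c} {f : a ⟶ e} {g : b ⟶ e} {h : c ⟶ e}
    (φ : Cell (X := X) (𝟙 a) P (𝟙 b) p) (α : Cell f (.single p) g (looseId e))
    (β : Cell g (.single q) h (looseId e)) (hR : P.append (LoosePath.single q) = R) :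
    comp (.pair φ (cellId q) hR) (hcomp₂ α β) (Category.id_comp _) (Category.id_comp _) =
      hcomp (φ ⨾ α) β hR := by
  rw [comp_pair_hcomp _ _ _ _ _ (Category.id_comp _) (Category.id_comp _) (Category.id_comp _),
    cellId_vcomp]

theorem lift_gcomp_cart {x y e : X} (f : y ⟶ e) (g : x ⟶ e) {P : LoosePath Loose x y}
    (φ : Cell (X := X) g P f (looseId e)) :
    lift f g φ (Category.id_comp g) (Category.id_comp f) ⨾ cart f g = φ :=
  lift_cart ..

theorem resFactor_cart {x y d e : X} (f : y ⟶ e) (k : d ⟶ e) (c : x ⟶ d) {h : x ⟶ e}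
    (hc : c ≫ k = h) :
    vcomp (resFactor (X := X) f k c hc) (cart f k) hc (Category.id_comp f) = cart f h :=
  lift_cart ..

/-- The canonical 2-cell `⇒ E(1, g)` with right frame `g`. -/
noncomputable def compUnit {y e : X} (g : y ⟶ e) : Cell (𝟙 y) (.nil y) g (ehom (𝟙 e) g) :=
  lift (𝟙 e) g (tightId g rfl rfl) (Category.id_comp g) (Category.comp_id g)

theorem compUnit_cart {y e : X} (g : y ⟶ e) :
    vcomp (compUnit g) (cart (𝟙 e) g) (Category.id_comp g) (Category.comp_id g) =
      tightId g rfl rfl :=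
  lift_cart ..

/-- The canonical 2-cell `⇒ E(f, 1)` with left frame `f`. -/
noncomputable def conjUnit {y e : X} (f : y ⟶ e) : Cell f (.nil y) (𝟙 y) (ehom f (𝟙 e)) :=
  lift f (𝟙 e) (tightId f rfl rfl) (Category.comp_id f) (Category.id_comp f)

/-- Through cartesian 2-cells, the composition of restrictions becomes horizontal composition into a
loose-identity. Equations between composites are checked in that form. -/
theorem comp_pair_resComp {a b c x y z e : X} {a' : a ⟶ x} {b' : b ⟶ y} {c' : c ⟶ z}
    {P : LoosePath Loose a b} {Q : LoosePath Loose b c} {R : LoosePath Loose a c}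
    {f : z ⟶ e} {g : y ⟶ e} {h : x ⟶ e} (α : Cell (X := X) a' P b' (ehom g h))
    (β : Cell b' Q c' (ehom f g)) (hR : P.append Q = R) {h₁ g₁ f₁} (hh : a' ≫ h = h₁)
    (hg : b' ≫ g = g₁) (hf : c' ≫ f = f₁) :
    vcomp (comp (.pair α β hR) (resComp f g h) (Category.comp_id _) (Category.comp_id _))
        (cart f h) hh hf =
      hcomp (vcomp α (cart g h) hh hg) (vcomp β (cart f g) hg hf) hR := by
  refine (comp_pair_vcomp α β hR (resComp f g h) (cart f h) (Category.comp_id _)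
    (Category.comp_id _) hh hf (Category.id_comp _) (Category.id_comp _) hh hf).symm.trans ?_
  refine (congrArg (fun φ => comp (.pair α β hR) φ hh hf) (resComp_cart f g h)).trans ?_
  exact comp_pair_hcomp α β (cart g h) (cart f g) hR hh hg hf

theorem conjUnit_cart {y e : X} (f : y ⟶ e) :
    vcomp (conjUnit f) (cart f (𝟙 e)) (Category.comp_id f) (Category.id_comp f) =
      tightId f rfl rfl :=
  lift_cart ..

/-- The canonical 2-cell `E(f, g) ⇒ E(1, g)` with right frame `f`. -/
noncomputable def toComp {x y e : X} (f : y ⟶ e) (g : x ⟶ e) :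
    Cell (𝟙 x) (.single (ehom f g)) f (ehom (𝟙 e) g) :=
  lift (𝟙 e) g (cart f g) (Category.id_comp g) (Category.comp_id f)

theorem toComp_cart {x y e : X} (f : y ⟶ e) (g : x ⟶ e) :
    vcomp (toComp f g) (cart (𝟙 e) g) (Category.id_comp g) (Category.comp_id f) = cart f g :=
  lift_cart ..

/-- The action of `B(1, 1)` on `B(f, 1)` -/
noncomputable def conjAct {a b : X} (f : a ⟶ b) :
    Cell (𝟙 b) (.pair (looseId b) (ehom f (𝟙 b))) (𝟙 a) (ehom f (𝟙 b)) :=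
  lift f (𝟙 b) (hcomp₂ (cellId (looseId b)) (cart f (𝟙 b))) (Category.id_comp _)
    (Category.id_comp _)

theorem comp_pair_conjAct {a b x y z : X} (f : a ⟶ b) {g : x ⟶ b} {h : y ⟶ b} {k : z ⟶ a} {k₁}
    {P : LoosePath Loose x y} {Q : LoosePath Loose y z} {R : LoosePath Loose x z}
    (α : Cell (X := X) g P h (looseId b)) (β : Cell h Q k (ehom f (𝟙 b)))
    (hR : P.append Q = R) (hk : k ≫ f = k₁) :
    vcomp (comp (.pair α β hR) (conjAct f) (Category.comp_id _) (Category.comp_id _))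
        (cart f (𝟙 b)) (Category.comp_id g) hk =
      hcomp α (vcomp β (cart f (𝟙 b)) (Category.comp_id h) hk) hR := by
  refine (comp_pair_vcomp α β hR (conjAct f) (cart f (𝟙 b)) (Category.comp_id _)
    (Category.comp_id _) (Category.comp_id g) hk (Category.id_comp _) (Category.id_comp _)
    (Category.comp_id _) hk).symm.trans ?_
  rw [conjAct, lift_cart]
  refine (comp_pair_hcomp α β (cellId (looseId b)) (cart f (𝟙 b)) hR
    (Category.comp_id g) (Category.comp_id h) hk).trans ?_
  rw [vcomp_cellId]

/-- Equivariance of every 2-cell out of `B(f, 1)` for the action of the loose-identity. The unit of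
the loose-identity is opcartesian, so it suffices to restrict along it, where both sides become `φ`.
-/
theorem conjAct_gcomp {a b e : X} (f : a ⟶ b) {h : b ⟶ e} {g : a ⟶ e}
    (φ : Cell (X := X) h (.single (ehom f (𝟙 b))) g (looseId e)) :
    conjAct f ⨾ φ = hcomp₂ (looseMap h) φ := by
  refine looseId_ext (.nil b) (.single (ehom f (𝟙 b))) ?_
  have e1 := comp_pair_gcomp (looseUnit b) (cellId (ehom f (𝟙 b))) rfl (conjAct f) φ
  have e0 : tightId (X := X) (𝟙 b) rfl rfl = looseUnit b := ids_comp _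
  have e3 : comp (.pair (looseUnit b) (cellId (ehom f (𝟙 b))) rfl) (conjAct f)
      (Category.comp_id _) (Category.comp_id _) = cellId (ehom f (𝟙 b)) := by
    refine cart_ext (Category.id_comp _) (Category.id_comp _) ?_
    refine (comp_pair_conjAct f (looseUnit b) (cellId _) rfl (Category.id_comp _)).trans ?_
    rw [cellId_vcomp, ← e0]
    exact (tightId_hcomp (cart f (𝟙 b))).trans (cellId_vcomp _).symm
  have e4 := comp_pair_hcomp (looseUnit b) (cellId (ehom f (𝟙 b))) (looseMap h)
    φ rfl (Category.id_comp _) (Category.id_comp _) (Category.id_comp _)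
  rw [unit_looseMap, cellId_vcomp] at e4
  refine (e1.trans ((congrArg (· ⨾ φ) e3).trans (cellId_vcomp _))).trans ?_
  exact (e4.trans (tightId_hcomp _)).symm

/-- A 2-cell out of `B(f, 1)` is determined by the associated nullary 2-cell. -/
theorem eq_hcomp_conjUnit {a b e : X} (f : a ⟶ b) {h : b ⟶ e} {g : a ⟶ e} {k : a ⟶ e}
    (hk : f ≫ h = k) (φ : Cell (X := X) h (.single (ehom f (𝟙 b))) g (looseId e)) :
    φ = hcompR (vcomp (cart f (𝟙 b)) (looseMap h) (Category.id_comp h) hk)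
      (vcomp (conjUnit f) φ hk (Category.id_comp g)) := by
  -- The Yoneda argument: the identity of `B(f, 1)` is the action applied to the cartesian 2-cell
  -- and the unit. Pasting `φ` below and using equivariance expresses `φ` through its value on the
  -- unit.
  have e1 : comp (.pair (cart f (𝟙 b)) (conjUnit f) (LoosePath.append_nil _)) (conjAct f)
      (Category.comp_id _) (Category.comp_id _) = cellId (ehom f (𝟙 b)) := by
    refine cart_ext (Category.id_comp _) (Category.id_comp _) ?_
    refine (comp_pair_conjAct f _ (conjUnit f) _ (Category.id_comp _)).trans ?_
    rw [cellId_vcomp, conjUnit_cart]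
    exact hcomp_tightId _
  have e2 := comp_pair_vcomp (cart f (𝟙 b)) (conjUnit f) (LoosePath.append_nil _) (conjAct f) φ
    (Category.comp_id _) (Category.comp_id _) (Category.id_comp _) (Category.id_comp _)
    (Category.id_comp _) (Category.id_comp _) (Category.id_comp _) (Category.id_comp _)
  rw [e1, cellId_vcomp] at e2
  refine e2.symm.trans ?_
  refine (congrArg (fun ψ => comp (.pair (cart f (𝟙 b)) (conjUnit f) (LoosePath.append_nil _)) ψ
    (Category.id_comp _) (Category.id_comp _)) (conjAct_gcomp f φ)).trans ?_
  exact comp_pair_hcomp _ _ _ _ _ _ _ _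

/-- Reduces equations between 2-cells out of `B(k, 1)` to equations between nullary 2-cells. Both
`sharp_flat` and the compatibility of right-morphisms are proved in this way. -/
theorem conjUnit_ext {a b e : X} {f : a ⟶ b} {h : b ⟶ e} {g : a ⟶ e} {k : a ⟶ e}
    (hk : f ≫ h = k) {φ ψ : Cell (X := X) h (.single (ehom f (𝟙 b))) g (looseId e)}
    (H : vcomp (conjUnit f) φ hk (Category.id_comp g) =
      vcomp (conjUnit f) ψ hk (Category.id_comp g)) : φ = ψ := by
  rw [eq_hcomp_conjUnit f hk φ, H, ← eq_hcomp_conjUnit f hk ψ]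

end Calculus

/-! ### Dense tight-cells -/

section Density

variable {X : Type u} [Category.{v} X] [VirtualEquipment.{w, z} X]

theorem looseMap_id (b : X) : looseMap (𝟙 b) = cellId (looseId b) := by
  refine looseId_ext (.nil b) (.nil b) ?_
  refine (unit_looseMap (𝟙 b)).trans ?_
  exact (ids_comp (looseUnit b)).trans (vcomp_cellId (looseUnit b)).symm

/-- The right lift property in the definition of density, transported along cartesian 2-cells: `E(1,
1)` as a restriction is replaced by the loose-identity itself, and the canonical 2-cell by
horizontal composition with `cart j (𝟙 E)`. -/
theorem IsDense.existsUnique_cell {A E : X} {j : A ⟶ E} (hj : IsDense j)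
    {R : LoosePath Loose E E} (φ : Cell (𝟙 E) (R.append (.single (ehom j (𝟙 E)))) j (looseId E)) :
    ∃! ψ : Cell (𝟙 E) R (𝟙 E) (looseId E), hcomp ψ (cart j (𝟙 E)) rfl = φ := by
  have hcart : postMap j (𝟙 E) (𝟙 E) rfl (Category.id_comp (𝟙 E)) ⨾
      resMapL (tightId j (Category.comp_id j).symm rfl) (𝟙 E) ⨾ cart j (𝟙 E) =
      cart j (𝟙 E) := by
    rw [gcomp_assoc, resMapL_cart, gcomp_hcomp, postMap_cart, looseMap_id]
    -- The tight-cell `j ≫ 𝟙 E` is replaced by a variable, so that its equality with `j` can be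
    -- eliminated.
    have key : ∀ k (h : j = k) (h' : j ≫ 𝟙 E = k),
        hcompR (vcomp (cart j (𝟙 E)) (cellId (looseId E)) (Category.comp_id _) h')
          (tightId j h rfl) = cart j (𝟙 E) := by
      intro k h h'
      subst h
      rw [vcomp_cellId]
      exact hcomp_tightId _
    exact key _ _ _
  have key : ∀ ψ : Cell (𝟙 E) R (𝟙 E) (ehom (𝟙 E) (𝟙 E)),
      comp (.pair ψ (cellId (ehom j (𝟙 E))) rfl)
        (comp (.pair₁ (cellId (ehom (𝟙 E) (𝟙 E))) (postMap j (𝟙 E) (𝟙 E) rfl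
          (Category.id_comp (𝟙 E)) ⨾ resMapL (tightId j (Category.comp_id j).symm rfl) (𝟙 E)))
          (resComp j (𝟙 E) (𝟙 E)) (Category.id_comp _) (Category.id_comp _))
        (Category.id_comp _) (Category.id_comp _) ⨾ cart j (𝟙 E) =
      hcomp (ψ ⨾ cart (𝟙 E) (𝟙 E)) (cart j (𝟙 E)) rfl := by
    intro ψ
    rw [← comp_pair_gcomp, ← comp_pair_gcomp, resComp_cart,
      comp_pair_hcomp _ _ _ _ _ (Category.id_comp _) (Category.id_comp _) (Category.id_comp _),
      cellId_vcomp]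
    refine (congrArg (fun φ => comp (.pair ψ (cellId (ehom j (𝟙 E))) rfl)
      (hcomp₂ (cart (𝟙 E) (𝟙 E)) φ) (Category.id_comp _) (Category.id_comp _)) hcart).trans ?_
    rw [comp_pair_hcomp _ _ _ _ _ (Category.id_comp _) (Category.id_comp _) (Category.id_comp _),
      cellId_vcomp]
  obtain ⟨ψ, hψ, hψ'⟩ := hj R (lift j (𝟙 E) φ (Category.id_comp _) (Category.id_comp _))
  refine ⟨ψ ⨾ cart (𝟙 E) (𝟙 E), ?_, ?_⟩
  · refine (key ψ).symm.trans ?_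
    rw [hψ]
    exact lift_cart ..
  · intro χ hχ
    rw [← hψ' (lift (𝟙 E) (𝟙 E) χ (Category.id_comp _) (Category.id_comp _))]
    · exact (lift_cart ..).symm
    · refine cart_ext (Category.id_comp _) (Category.id_comp _) ?_
      refine (key _).trans ?_
      rw [lift_cart, ← hχ]
      congr 1
      exact lift_cart ..

/-- For a dense tight-cell `j`, 2-cells `g ⇒ f` correspond to 2-cells `E(j, g) ⇒ E(j, f)`. -/
theorem IsDense.existsUnique {A E x : X} {j : A ⟶ E} (hj : IsDense j) {f g : x ⟶ E}
    (φ : Cell f (.single (ehom j g)) j (looseId E)) :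
    ∃! ρ : TightCell g f, hcompL ρ (cart j g) = φ := by
  -- The chain `E(f, 1), E(1, g)` encodes 2-cells `g ⇒ f` with identity frames, as density requires.
  -- Its extension by `E(j, 1)` is composed to `E(f, 1), E(j, g)`, where `φ` applies; the 2-cell `ρ`
  -- is `ψ` restricted along the units of `E(f, 1)` and `E(1, g)`.
  obtain ⟨ψ, hψ, hψ'⟩ := hj.existsUnique_cell (R := .pair (ehom f (𝟙 E)) (ehom (𝟙 E) g))
    (hcomp (cart f (𝟙 E)) (resComp j (𝟙 E) g ⨾ φ) rfl)
  refine ⟨comp (.pair (conjUnit f) (compUnit g) rfl) ψ (Category.comp_id _) (Category.comp_id _),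
    ?_, ?_⟩
  · have e1 := comp_pair (.pair (conjUnit f) (compUnit g) rfl)
      (.single (resFactor j (𝟙 E) g (Category.comp_id g))) rfl ψ (cart j (𝟙 E)) (looseMul E)
      (Category.comp_id _) (Category.comp_id _) (Category.id_comp _)
      (Category.comp_id _) (Category.comp_id _) (Category.comp_id _) (Category.id_comp _)
    have e2 := comp_pair (.single (conjUnit f))
      (.pair (compUnit g) (resFactor j (𝟙 E) g (Category.comp_id g)) rfl) rfl
      (cart f (𝟙 E)) (resComp j (𝟙 E) g ⨾ φ) (looseMul E)
      (Category.comp_id _) (Category.id_comp _) (Category.id_comp _)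
      (Category.comp_id _) (Category.comp_id _) (Category.comp_id _) (Category.id_comp _)
    have e3 : comp (.pair (compUnit g) (resFactor j (𝟙 E) g (Category.comp_id g))
        (LoosePath.nil_append _)) (resComp j (𝟙 E) g) (Category.comp_id _) (Category.comp_id _) =
        cellId (ehom j g) := by
      refine cart_ext (Category.id_comp _) (Category.id_comp _) ?_
      refine (comp_pair_resComp _ _ _ (Category.id_comp _) (Category.comp_id g)
        (Category.id_comp _)).trans ?_
      rw [compUnit_cart, resFactor_cart, cellId_vcomp]
      exact tightId_hcomp _
    have e4 : comp (.pair (compUnit g) (resFactor j (𝟙 E) g (Category.comp_id g))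
        (LoosePath.nil_append _)) (resComp j (𝟙 E) g ⨾ φ) (Category.id_comp _)
        (Category.id_comp _) = φ := by
      refine (comp_pair_vcomp (compUnit g) _ _ (resComp j (𝟙 E) g) φ (Category.comp_id _)
        (Category.comp_id _) (Category.id_comp _) (Category.id_comp _) (Category.id_comp _)
        (Category.id_comp _) (Category.id_comp _) (Category.id_comp _)).trans ?_
      rw [e3, cellId_vcomp]
    refine Eq.trans (congrArg (hcompL _) (resFactor_cart j (𝟙 E) g (Category.comp_id g)).symm) ?_
    refine e1.symm.trans ?_
    refine (congrArg (fun χ => comp (Row.cons (conjUnit f) (.pair (compUnit g)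
      (resFactor j (𝟙 E) g (Category.comp_id g)) rfl) rfl) χ (Category.comp_id _)
      (Category.id_comp _)) hψ).trans ?_
    refine e2.trans ?_
    refine Eq.trans ?_ (tightId_hcomp φ)
    exact congrArg₂ (fun α β => hcomp α β (LoosePath.nil_append _)) (conjUnit_cart f) e4
  · intro ρ hρ
    have hρ' : hcompL ρ (cart j g) = φ := hρ
    -- Any solution `ρ` induces a 2-cell on `E(f, 1), E(1, g)` with the defining property of `ψ`,
    -- and evaluating it on the units returns `ρ`.
    have e5 : hcomp (hcomp (cart f (𝟙 E)) (hcompL ρ (cart (𝟙 E) g)) rfl) (cart j (𝟙 E)) rfl =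
        hcomp (cart f (𝟙 E)) (resComp j (𝟙 E) g ⨾ φ) rfl := by
      rw [← hρ', hcomp_gcomp, resComp_cart]
      refine (hcomp_assoc _ _ _ _ _ rfl rfl).trans ?_
      exact congrArg (fun χ => hcomp (cart f (𝟙 E)) χ rfl) (hcomp_assoc _ _ _ _ _ _ _)
    rw [← hψ' _ e5]
    refine Eq.symm ?_
    refine (comp_pair_hcomp (conjUnit f) (compUnit g) (cart f (𝟙 E)) (hcompL ρ (cart (𝟙 E) g)) rfl
      (Category.comp_id _) (Category.id_comp _) (Category.comp_id _)).trans ?_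
    rw [conjUnit_cart]
    refine (tightId_hcomp _).trans ?_
    refine (hcomp_vcomp ρ (compUnit g) (cart (𝟙 E) g) (Category.id_comp _) (Category.id_comp _)
      (Category.comp_id _)).symm.trans ?_
    rw [compUnit_cart]
    exact hcomp_tightId ρ

end Density

/-! ### Relative monads and opalgebras as 2-cells into loose-identities -/

section OpalgebraCells

variable {X : Type u} [Category.{v} X] [VirtualEquipment.{w, z} X] {A E : X} {j : A ⟶ E}

namespace RelMonad

/-- The 2-cell `⇒ E(j, t)` corresponding to the unit. -/
noncomputable def unitCell (T : RelMonad j) : Cell (𝟙 A) (.nil A) (𝟙 A) (ehom j T.t) :=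
  resUnit j ⨾ resMapR j T.unit

theorem unitCell_cart (T : RelMonad j) : T.unitCell ⨾ cart j T.t = T.unit := by
  rw [unitCell, gcomp_assoc, resMapR_cart, hcomp_gcomp, resUnit_cart]
  exact hcomp_tightId _

/-- The multiplication `E(j, t), E(j, t) ⇒ E(j, t)`. -/
noncomputable def mulCell (T : RelMonad j) :
    Cell (𝟙 A) (.pair (ehom j T.t) (ehom j T.t)) (𝟙 A) (ehom j T.t) :=
  comp (.pair₁ T.ext (cellId (ehom j T.t))) (resComp j T.t T.t) (Category.id_comp _)
    (Category.id_comp _)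

/-- The extension operator, as a 2-cell into a loose-identity. -/
noncomputable def extCell (T : RelMonad j) : Cell T.t (.single (ehom j T.t)) T.t (looseId E) :=
  T.ext ⨾ cart T.t T.t

theorem mulCell_cart (T : RelMonad j) :
    T.mulCell ⨾ cart j T.t = hcomp₂ T.extCell (cart j T.t) := by
  refine (comp_pair_resComp T.ext (cellId (ehom j T.t)) rfl (Category.id_comp _)
    (Category.id_comp _) (Category.id_comp _)).trans ?_
  rw [cellId_vcomp]
  rfl

theorem extCell_unit (T : RelMonad j) : hcompR T.extCell T.unit = cart j T.t := by
  rw [extCell, ← gcomp_hcomp, ← resMapL_cart, ← gcomp_assoc, T.ext_unit, cellId_gcomp]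

end RelMonad

namespace Opalgebra

variable {T : RelMonad j}

/-- The opextension operator, as a 2-cell into a loose-identity. -/
noncomputable def cell (U : Opalgebra T) : Cell U.a (.single (ehom j T.t)) U.a (looseId U.B) :=
  U.opext ⨾ cart U.a U.a

theorem unitCell_cell (U : Opalgebra T) : T.unitCell ⨾ U.cell = tightId U.a rfl rfl := by
  rw [cell, ← gcomp_assoc, ← resUnit_cart, ← U.unit_opext]
  rfl

/-- With `unitCell_cell`, this presents an opalgebra as a 2-cell `E(j, t) ⇒ B(1, 1)` sending the
unit and multiplication of `E(j, t)` to identities and horizontal composition; `ofCell` is the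
converse. -/
theorem mulCell_cell (U : Opalgebra T) : T.mulCell ⨾ U.cell = hcomp₂ U.cell U.cell := by
  have h := congrArg (· ⨾ cart U.a U.a) U.opext_opext
  refine Eq.trans ?_ (h.symm.trans ?_)
  · exact (gcomp_assoc _ _ _).symm
  · exact comp_pair_resComp U.opext U.opext rfl (Category.id_comp _) (Category.id_comp _)
      (Category.id_comp _)

/-- Opalgebras from 2-cells into loose-identities. -/
noncomputable def ofCell {B : X} {a : A ⟶ B} (e : Cell a (.single (ehom j T.t)) a (looseId B))
    (h₁ : T.unitCell ⨾ e = tightId a rfl rfl) (h₂ : T.mulCell ⨾ e = hcomp₂ e e) :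
    Opalgebra T where
  B := B
  a := a
  opext := lift a a e (Category.id_comp _) (Category.id_comp _)
  unit_opext := by
    refine cart_ext (Category.id_comp _) (Category.id_comp _) ?_
    refine (gcomp_assoc _ _ _).trans ?_
    rw [lift_gcomp_cart]
    exact h₁.trans (resUnit_cart a).symm
  opext_opext := by
    refine cart_ext (Category.id_comp _) (Category.id_comp _) ?_
    refine (comp_pair_resComp _ _ rfl (Category.id_comp _) (Category.id_comp _)
      (Category.id_comp _)).trans ?_
    rw [lift_cart]
    refine h₂.symm.trans ?_
    refine Eq.trans ?_ (gcomp_assoc _ _ _).symm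
    rw [lift_gcomp_cart]
    rfl

theorem ofCell_cell {B : X} {a : A ⟶ B} (e : Cell a (.single (ehom j T.t)) a (looseId B))
    (h₁ : T.unitCell ⨾ e = tightId a rfl rfl) (h₂ : T.mulCell ⨾ e = hcomp₂ e e) :
    (ofCell e h₁ h₂).cell = e :=
  lift_cart ..

/-- The image of an opalgebra under a tight-cell. -/
noncomputable def map (U : Opalgebra T) {C : X} (c : U.B ⟶ C) {a' : A ⟶ C} (h : U.a ≫ c = a') :
    Opalgebra T :=
  ofCell (vcomp U.cell (looseMap c) h h)
    (by rw [gcomp_vcomp, unitCell_cell, tightId_looseMap]; subst h; rfl)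
    (by rw [gcomp_vcomp, mulCell_cell]; exact hcomp_looseMap _ _ _ _ _ _ _)

theorem map_cell (U : Opalgebra T) {C : X} (c : U.B ⟶ C) {a' : A ⟶ C} (h : U.a ≫ c = a') :
    (U.map c h).cell = vcomp U.cell (looseMap c) h h :=
  ofCell_cell ..

theorem isMediating_iff (U V : Opalgebra T) (c : U.B ⟶ V.B) :
    IsMediating U V c ↔ ∃ h : U.a ≫ c = V.a, vcomp U.cell (looseMap c) h h = V.cell := by
  refine exists_congr fun h => ?_
  have e : U.opext ⨾ postMap U.a U.a c h h ⨾ cart V.a V.a = vcomp U.cell (looseMap c) h h := by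
    rw [gcomp_assoc, postMap_cart, gcomp_vcomp]
    rfl
  constructor
  · intro h'
    rw [← e, h']
    rfl
  · intro h'
    exact cart_ext (Category.id_comp _) (Category.id_comp _) (e.trans h')

theorem action_cart (U : Opalgebra T) :
    U.action ⨾ cart (𝟙 U.B) U.a = hcomp₂ U.cell (cart (𝟙 U.B) U.a) := by
  refine (comp_pair_resComp U.opext (cellId _) rfl (Category.id_comp _) (Category.id_comp _)
    (Category.id_comp _)).trans ?_
  rw [cellId_vcomp]
  rfl

/-- Both sides of the grading condition land in a restriction, so nothing is lost by pasting with
its cartesian 2-cell. The action of `V` then becomes horizontal composition with `V.cell`. -/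
theorem isGradedOpalgebraMor_iff (U V : Opalgebra T) (P : LoosePath Loose U.B V.B)
    (α : Cell (𝟙 A) (.cons (ehom (𝟙 U.B) U.a) P) (𝟙 V.B) (ehom (𝟙 V.B) V.a)) :
    IsGradedOpalgebraMor U V P α ↔
      comp (.cons U.action (Row.ids P) rfl) (α ⨾ cart (𝟙 V.B) V.a) (Category.id_comp _)
        (Category.id_comp _) = hcomp V.cell (α ⨾ cart (𝟙 V.B) V.a) rfl := by
  have e₁ : comp (.cons U.action (Row.ids P) rfl) α (Category.id_comp _) (Category.id_comp _) ⨾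
      cart (𝟙 V.B) V.a = comp (.cons U.action (Row.ids P) rfl) (α ⨾ cart (𝟙 V.B) V.a)
        (Category.id_comp _) (Category.id_comp _) :=
    (comp_vcomp _ _ _ _ _ _ _ _ _ _ _).symm
  have e₂ : comp (.pair (cellId (ehom j T.t)) α rfl) V.action (Category.id_comp _)
      (Category.id_comp _) ⨾ cart (𝟙 V.B) V.a = hcomp V.cell (α ⨾ cart (𝟙 V.B) V.a) rfl := by
    refine (comp_pair_gcomp _ _ _ _ _).symm.trans ?_
    rw [action_cart, comp_pair_hcomp _ _ _ _ _ (Category.id_comp _) (Category.id_comp _)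
      (Category.id_comp _), cellId_vcomp]
  rw [← e₁, ← e₂]
  exact ⟨fun h => congrArg (· ⨾ cart (𝟙 V.B) V.a) h,
    fun h => cart_ext (Category.id_comp _) (Category.id_comp _) h⟩

end Opalgebra

end OpalgebraCells

/-! ### Two usable forms of the universal property of an opalgebra object -/

section OpalgebraObjects

variable {X : Type u} [Category.{v} X] [VirtualEquipment.{w, z} X] {A E : X} {j : A ⟶ E}

namespace OpalgebraObject

variable {T : RelMonad j} (O : OpalgebraObject T)

/-- The universal property of an opalgebra object for gradings by one loose-cell, in terms of
2-cells into loose-identities with arbitrary right frame. -/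
theorem existsUnique_single (U V : Opalgebra T) (c : O.B ⟶ U.B) (d : O.B ⟶ V.B)
    (hc : O.a ≫ c = U.a) (hd : O.a ≫ d = V.a) (hc' : IsMediating O.toOpalgebra U c)
    (hd' : IsMediating O.toOpalgebra V d) {y : X} (p : Loose U.B y) (g : y ⟶ V.B)
    (α : Cell V.a (.pair (ehom (𝟙 U.B) U.a) p) g (looseId V.B))
    (hα : comp (.pair U.action (cellId p) rfl) α (Category.id_comp _) (Category.id_comp _) =
      hcomp V.cell α rfl) :
    ∃! β : Cell d (.pair (ehom (𝟙 U.B) c) p) g (looseId V.B),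
      comp (.pair₁ (resFactor (𝟙 U.B) c O.a hc) (cellId p)) β hd (Category.id_comp g) = α := by
  -- The universal property concerns 2-cells whose right frame is an identity. Appending the
  -- loose-cell `E(1, g)`, for `E` the codomain of `V`, to the grading absorbs the right frame `g`
  -- of `α`.
  set α' : Cell (𝟙 A) (.cons (ehom (𝟙 U.B) U.a) (.pair p (ehom (𝟙 V.B) g))) (𝟙 V.B)
      (ehom (𝟙 V.B) V.a) :=
    lift (𝟙 V.B) V.a (hcomp α (cart (𝟙 V.B) g) rfl) (Category.id_comp _) (Category.id_comp _)
    with hα'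
  have α'_cart : α' ⨾ cart (𝟙 V.B) V.a = hcomp α (cart (𝟙 V.B) g) rfl := lift_cart ..
  have graded : IsGradedOpalgebraMor U V (.pair p (ehom (𝟙 V.B) g)) α' := by
    rw [Opalgebra.isGradedOpalgebraMor_iff, α'_cart]
    refine (comp_pair (.pair U.action (cellId p) rfl) (.single (cellId (ehom (𝟙 V.B) g))) rfl α
      (cart (𝟙 V.B) g) (looseMul V.B) (Category.id_comp _) (Category.id_comp _)
      (Category.id_comp _) (Category.comp_id _) (Category.comp_id _) (Category.id_comp _)
      (Category.id_comp _)).trans ?_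
    refine Eq.trans ?_ (hcomp_assoc V.cell α (cart (𝟙 V.B) g) rfl rfl rfl rfl)
    exact congrArg₂ (fun φ ψ => hcomp φ ψ rfl) hα (cellId_vcomp (cart (𝟙 V.B) g))
  obtain ⟨β', hβ', hβ''⟩ := O.existsUnique_cell U V c d hc hd hc' hd' _ α' graded
  have hβ₁ : comp (.cons (resFactor (𝟙 U.B) c O.a hc)
      (Row.pair₁ (cellId p) (cellId (ehom (𝟙 V.B) g))) rfl) (β' ⨾ cart (𝟙 V.B) d) hd
      (Category.id_comp _) = hcomp α (cart (𝟙 V.B) g) rfl := by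
    refine (comp_vcomp _ β' (cart (𝟙 V.B) d) (Category.comp_id _) (Category.id_comp _) hd
      (Category.id_comp _) _ _ _ _).trans ?_
    refine (congrArg (fun φ => vcomp φ (cart (𝟙 V.B) d) hd (Category.id_comp _)) hβ').trans ?_
    refine (vcomp_assoc α' _ _ _ _ _ _ hd (Category.id_comp _) (Category.id_comp _)
      (Category.id_comp _)).trans ?_
    rw [resFactor_cart]
    exact α'_cart
  have hp : (LoosePath.single p).append (.nil y) = .single p := rfl
  -- The auxiliary loose-cell is removed again by inserting its unit `compUnit g`.
  refine ⟨comp (.cons (cellId (ehom (𝟙 U.B) c)) (.pair (cellId p) (compUnit g) hp) rfl)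
    (β' ⨾ cart (𝟙 V.B) d) (Category.id_comp d) (Category.comp_id g), ?_, ?_⟩
  -- Interchange: `e₁` and `e₂` decompose one row, consisting of `resFactor`, an identity and
  -- `compUnit g`, in the two possible orders. Thus restriction along `k` commutes with insertion of
  -- the unit.
  · have e₁ := comp_triple (.single (resFactor (𝟙 U.B) c O.a hc)) (.single (cellId p)) (.nil (𝟙 y))
      (cellId (ehom (𝟙 U.B) c)) (cellId p) (compUnit g) (β' ⨾ cart (𝟙 V.B) d)
      (Category.comp_id _) (Category.comp_id _) (Category.comp_id _) (Category.id_comp _)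
      (Category.id_comp _) (Category.comp_id _) hd (Category.id_comp _) hd (Category.comp_id _)
    have e₂ := comp_triple (.single (cellId (ehom (𝟙 U.B) U.a))) (.single (cellId p))
      (.single (compUnit g)) (resFactor (𝟙 U.B) c O.a hc) (cellId p) (cellId (ehom (𝟙 V.B) g))
      (β' ⨾ cart (𝟙 V.B) d)
      (Category.id_comp _) (Category.id_comp _) (Category.comp_id _) (Category.comp_id _)
      hd (Category.id_comp _) (Category.id_comp _) (Category.comp_id _) hd (Category.comp_id _)
    rw [comp_cellId, comp_cellId] at e₁
    rw [comp_cellId, comp_cellId] at e₂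
    have e₃ : comp (.nil (𝟙 y)) (compUnit g) (Category.id_comp _) (Category.id_comp _) =
      compUnit g := ids_comp _
    have e₄ : comp (.single (cellId (ehom (𝟙 U.B) U.a))) (resFactor (𝟙 U.B) c O.a hc)
      (Category.id_comp _) (Category.id_comp _) = resFactor (𝟙 U.B) c O.a hc := ids_comp _
    rw [e₃] at e₁
    rw [e₄] at e₂
    refine e₁.trans (e₂.symm.trans ?_)
    refine (congrArg (fun φ => comp (.cons (cellId (ehom (𝟙 U.B) U.a))
      (.pair (cellId p) (compUnit g) hp) rfl) φ (Category.id_comp _) (Category.comp_id _))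
      hβ₁).trans ?_
    refine (comp_pair (.pair₁ (cellId (ehom (𝟙 U.B) U.a)) (cellId p)) (.single (compUnit g)) rfl α
      (cart (𝟙 V.B) g) (looseMul V.B) (Category.id_comp _) (Category.id_comp _)
      (Category.comp_id _) (Category.comp_id _) (Category.comp_id _) (Category.id_comp _)
      (Category.comp_id _)).trans ?_
    refine Eq.trans ?_ (hcomp_tightId α)
    exact congrArg₂ (fun φ ψ => hcomp φ ψ rfl) (ids_comp α) (compUnit_cart g)
  · intro β hβ
    have e₀ : lift (𝟙 V.B) d (hcomp β (cart (𝟙 V.B) g) rfl) (Category.id_comp _)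
        (Category.id_comp _) ⨾ cart (𝟙 V.B) d = hcomp β (cart (𝟙 V.B) g) rfl := lift_cart ..
    -- A competitor `β`, extended by the auxiliary loose-cell, restricts along `k` to `α'`; hence it
    -- is `β'`, and inserting the unit recovers `β`.
    have e₁ : lift (𝟙 V.B) d (hcomp β (cart (𝟙 V.B) g) rfl) (Category.id_comp _)
        (Category.id_comp _) = β' := by
      refine hβ'' _ ?_
      refine cart_ext hd (Category.id_comp _) ?_
      refine (comp_vcomp _ _ (cart (𝟙 V.B) d) (Category.comp_id _) (Category.id_comp _) hd
        (Category.id_comp _) (Category.id_comp _) (Category.id_comp _) hd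
        (Category.id_comp _)).symm.trans ?_
      refine Eq.trans ?_ (vcomp_assoc α' (resFactor (𝟙 V.B) d O.a hd) (cart (𝟙 V.B) d)
        (Category.id_comp _) (Category.id_comp _) hd (Category.id_comp _) hd (Category.id_comp _)
        (Category.id_comp _) (Category.id_comp _)).symm
      rw [resFactor_cart]
      refine Eq.trans ?_ α'_cart.symm
      refine (congrArg (fun φ => comp (.cons (resFactor (𝟙 U.B) c O.a hc)
        (Row.pair₁ (cellId p) (cellId (ehom (𝟙 V.B) g))) rfl) φ hd (Category.id_comp _))
        e₀).trans ?_
      refine (comp_pair (.pair₁ (resFactor (𝟙 U.B) c O.a hc) (cellId p))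
        (.single (cellId (ehom (𝟙 V.B) g))) rfl β
        (cart (𝟙 V.B) g) (looseMul V.B) hd (Category.id_comp _)
        (Category.id_comp _) (Category.comp_id _) (Category.comp_id _) hd
        (Category.id_comp _)).trans ?_
      exact congrArg₂ (fun φ ψ => hcomp φ ψ rfl) hβ (cellId_vcomp (cart (𝟙 V.B) g))
    rw [← e₁]
    refine Eq.symm ?_
    refine (congrArg (fun φ => comp (.cons (cellId (ehom (𝟙 U.B) c))
      (.pair (cellId p) (compUnit g) hp) rfl) φ (Category.id_comp _) (Category.comp_id _))
      e₀).trans ?_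
    refine (comp_pair (.pair₁ (cellId (ehom (𝟙 U.B) c)) (cellId p)) (.single (compUnit g)) rfl β
      (cart (𝟙 V.B) g) (looseMul V.B) (Category.id_comp _) (Category.id_comp _)
      (Category.comp_id _) (Category.comp_id _) (Category.comp_id _) (Category.id_comp _)
      (Category.comp_id _)).trans ?_
    refine Eq.trans ?_ (hcomp_tightId β)
    exact congrArg₂ (fun φ ψ => hcomp φ ψ rfl) (ids_comp β) (compUnit_cart g)

/-- The universal property of an opalgebra object for 2-cells between tight-cells. -/
theorem existsUnique_tightCell {B : X} {a a' : A ⟶ B} {c d : O.B ⟶ B} {e e' h₁ h₁' h₂ h₂'}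
    (hc : O.a ≫ c = a) (hd : O.a ≫ d = a')
    (hc' : IsMediating O.toOpalgebra (⟨B, a, e, h₁, h₂⟩ : Opalgebra T) c)
    (hd' : IsMediating O.toOpalgebra (⟨B, a', e', h₁', h₂'⟩ : Opalgebra T) d)
    (σ : TightCell a a') (hσ : hcompL σ (Opalgebra.mk B a e h₁ h₂ : Opalgebra T).cell =
      hcompR (Opalgebra.mk B a' e' h₁' h₂' : Opalgebra T).cell σ) :
    ∃! ρ : TightCell c d, precomp O.a ρ hd hc = σ := by
  set U : Opalgebra T := ⟨B, a, e, h₁, h₂⟩ with hU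
  set V : Opalgebra T := ⟨B, a', e', h₁', h₂'⟩ with hV
  -- The 2-cell `σ` is encoded as `B(1, σ)`, a morphism with empty grading; the grading condition
  -- amounts to `hσ`. The answer is decoded by evaluation on the unit of `B(1, c)`.
  set α : Cell (𝟙 A) (.single (ehom (𝟙 B) a)) (𝟙 B) (ehom (𝟙 B) a') :=
    lift (𝟙 B) a' (hcompL σ (cart (𝟙 B) a)) (Category.id_comp _) (Category.id_comp _) with hα
  have α_cart : α ⨾ cart (𝟙 B) a' = hcompL σ (cart (𝟙 B) a) := lift_cart ..
  have graded : IsGradedOpalgebraMor U V (.nil B) α := by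
    refine (Opalgebra.isGradedOpalgebraMor_iff U V (.nil B) α).2 ?_
    refine (congrArg (U.action ⨾ ·) α_cart).trans ?_
    refine Eq.trans ?_ (congrArg (fun φ => hcomp V.cell φ rfl) α_cart).symm
    refine (hcomp_gcomp _ _ _).trans ?_
    refine (congrArg (hcompL σ) U.action_cart).trans ?_
    refine (hcomp_assoc σ U.cell (cart (𝟙 B) a) rfl rfl rfl rfl).symm.trans ?_
    refine (congrArg (fun φ => hcomp φ (cart (𝟙 B) a) rfl) hσ).trans ?_
    exact hcomp_assoc V.cell σ (cart (𝟙 B) a) _ _ _ _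
  obtain ⟨β, hβ, hβ'⟩ := O.existsUnique_cell U V c d hc hd hc' hd' _ α graded
  refine ⟨vcomp (compUnit c) (β ⨾ cart (𝟙 B) d) (Category.id_comp _) (Category.comp_id _), ?_, ?_⟩
  -- Units are stable under restriction: the unit of `B(1, c)` precomposed with `k` is the unit of
  -- `B(1, a)`, up to the canonical 2-cell. This is why the decoded 2-cell restricts to `σ`.
  · have e₁ : precomp O.a (compUnit c) (Category.comp_id _) hc =
        vcomp (compUnit a) (resFactor (𝟙 B) c O.a hc) (Category.id_comp _)
          (Category.comp_id _) := by
      refine cart_ext hc (Category.comp_id _) ?_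
      refine (comp_vcomp (.nil O.a) (compUnit c) (cart (𝟙 B) c) (Category.comp_id _) hc hc
        (Category.comp_id _) (Category.id_comp _) (Category.comp_id _) hc hc).symm.trans ?_
      refine Eq.trans ?_ (vcomp_assoc (compUnit a) (resFactor (𝟙 B) c O.a hc) (cart (𝟙 B) c)
        (Category.id_comp _) (Category.comp_id _) hc (Category.comp_id _) hc (Category.id_comp _)
        (Category.id_comp _) (Category.comp_id _)).symm
      rw [resFactor_cart, compUnit_cart, compUnit_cart]
      subst hc
      exact precomp_tightId _ _ _ _ _ _
    refine (comp_vcomp (.nil O.a) (compUnit c) (β ⨾ cart (𝟙 B) d) (Category.comp_id _) hc hd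
      (Category.comp_id _) _ _ _ _).trans ?_
    refine (congrArg (fun φ => vcomp φ (β ⨾ cart (𝟙 B) d) hd (Category.comp_id _)) e₁).trans ?_
    refine (vcomp_assoc (compUnit a) (resFactor (𝟙 B) c O.a hc) (β ⨾ cart (𝟙 B) d)
        (Category.id_comp _) (Category.comp_id _) hd (Category.comp_id _) hd (Category.id_comp _)
        (Category.id_comp _) (Category.comp_id _)).trans ?_
    have e₂ : vcomp (resFactor (𝟙 B) c O.a hc) (β ⨾ cart (𝟙 B) d) hd (Category.id_comp _) =
        hcompL σ (cart (𝟙 B) a) := by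
      refine (vcomp_assoc (resFactor (𝟙 B) c O.a hc) β (cart (𝟙 B) d) (Category.comp_id _)
        (Category.id_comp _) hd (Category.id_comp _) (Category.id_comp _) (Category.id_comp _) hd
        (Category.id_comp _)).symm.trans ?_
      refine (congrArg (fun φ => vcomp φ (cart (𝟙 B) d) hd (Category.id_comp _)) hβ).trans ?_
      refine (vcomp_assoc α _ _ _ _ _ _ hd (Category.id_comp _) (Category.id_comp _)
        (Category.id_comp _)).trans ?_
      rw [resFactor_cart]
      exact α_cart
    rw [e₂]
    refine (hcomp_vcomp σ (compUnit a) (cart (𝟙 B) a) (Category.id_comp _) (Category.id_comp _)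
      (Category.comp_id _)).symm.trans ?_
    rw [compUnit_cart]
    exact hcomp_tightId σ
  · intro ρ hρ
    have e₀ : lift (𝟙 B) d (hcompL ρ (cart (𝟙 B) c)) (Category.id_comp _)
        (Category.id_comp _) ⨾ cart (𝟙 B) d = hcompL ρ (cart (𝟙 B) c) := lift_cart ..
    have e₁ : lift (𝟙 B) d (hcompL ρ (cart (𝟙 B) c)) (Category.id_comp _)
        (Category.id_comp _) = β := by
      refine hβ' _ ?_
      refine cart_ext hd (Category.id_comp _) ?_
      refine (vcomp_assoc (resFactor (𝟙 B) c O.a hc) _ (cart (𝟙 B) d) (Category.comp_id _)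
        (Category.id_comp _) hd (Category.id_comp _) (Category.id_comp _) (Category.id_comp _) hd
        (Category.id_comp _)).trans ?_
      refine (congrArg (fun φ => vcomp (resFactor (𝟙 B) c O.a hc) φ hd (Category.id_comp _))
        e₀).trans ?_
      refine Eq.trans ?_ (vcomp_assoc α (resFactor (𝟙 B) d O.a hd) (cart (𝟙 B) d)
        (Category.id_comp _) (Category.id_comp _) hd (Category.id_comp _) hd (Category.id_comp _)
        (Category.id_comp _) (Category.id_comp _)).symm
      rw [resFactor_cart]
      refine Eq.trans ?_ α_cart.symm
      refine (precomp_hcomp_vcomp ρ (resFactor (𝟙 B) c O.a hc) (cart (𝟙 B) c) hd hc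
        (Category.id_comp _)).symm.trans ?_
      rw [resFactor_cart]
      exact congrArg (fun φ => hcompL φ (cart (𝟙 B) a)) hρ
    rw [← e₁]
    refine Eq.symm ?_
    refine (congrArg (fun φ => vcomp (compUnit c) φ (Category.id_comp _) (Category.comp_id _))
      e₀).trans ?_
    refine (hcomp_vcomp ρ (compUnit c) (cart (𝟙 B) c) (Category.id_comp _) (Category.id_comp _)
      (Category.comp_id _)).symm.trans ?_
    rw [compUnit_cart]
    exact hcomp_tightId ρ

end OpalgebraObject

end OpalgebraObjects

/-! ### The relative adjunction `k ⊣ v` of an opalgebra object -/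

section InducedAdjunction

variable {X : Type u} [Category.{v} X] [VirtualEquipment.{w, z} X] {A E : X} {j : A ⟶ E}

theorem Opalgebra.isMediating_id {T : RelMonad j} (U : Opalgebra T) : IsMediating U U (𝟙 U.B) := by
  refine (isMediating_iff _ _ _).2 ⟨Category.comp_id _, ?_⟩
  rw [looseMap_id, vcomp_cellId]

namespace OpalgebraObject

variable {T : RelMonad j} (O : OpalgebraObject T)

theorem isMediating_v : IsMediating O.toOpalgebra T.opalgebra O.v :=
  (O.existsUnique_mediating T.opalgebra).choose_spec.1

theorem a_comp_v : O.a ≫ O.v = T.t :=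
  O.isMediating_v.choose

theorem cell_v : vcomp O.toOpalgebra.cell (looseMap O.v) O.a_comp_v O.a_comp_v = T.extCell :=
  ((Opalgebra.isMediating_iff _ _ _).1 O.isMediating_v).choose_spec

/-- This makes `E(1, t), E(j, 1) ⇒ E(j, t) ⇒ B(a, a)` a morphism out of `(t, †)` graded by `E(j,
1)`. Associativity of composition turns the action on `E(1, t)` into the multiplication of `E(j, t)`
(`e₁`), which the opalgebra turns into horizontal composition. -/
theorem resComp_graded (U : Opalgebra T) :
    comp (.pair T.opalgebra.action (cellId (ehom j (𝟙 E))) rfl) (resComp j (𝟙 E) T.t ⨾ U.cell)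
      (Category.id_comp _) (Category.id_comp _) = hcomp U.cell (resComp j (𝟙 E) T.t ⨾ U.cell)
        rfl := by
  have e₁ : comp (.pair T.opalgebra.action (cellId (ehom j (𝟙 E))) rfl) (resComp j (𝟙 E) T.t)
      (Category.id_comp _) (Category.id_comp _) =
      comp (.pair (cellId (ehom j T.t)) (resComp j (𝟙 E) T.t) rfl) T.mulCell
        (Category.id_comp _) (Category.id_comp _) := by
    refine cart_ext (Category.id_comp _) (Category.id_comp _) ?_
    refine (comp_pair_gcomp _ _ _ _ _).symm.trans ?_
    refine Eq.trans ?_ (comp_pair_gcomp _ _ _ _ _)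
    rw [T.mulCell_cart]
    refine (congrArg (fun φ => comp (.pair T.opalgebra.action (cellId (ehom j (𝟙 E))) rfl) φ
      (Category.id_comp _) (Category.id_comp _)) (resComp_cart j (𝟙 E) T.t)).trans ?_
    refine (comp_pair_cellId_right T.opalgebra.action (cart (𝟙 E) T.t) (cart j (𝟙 E)) rfl).trans ?_
    refine Eq.trans ?_ (comp_pair_cellId_left (resComp j (𝟙 E) T.t) T.extCell (cart j T.t) rfl).symm
    refine (congrArg (fun φ => hcomp φ (cart j (𝟙 E)) rfl) T.opalgebra.action_cart).trans ?_
    refine Eq.trans ?_ (congrArg (fun φ => hcomp T.extCell φ rfl) (resComp_cart _ _ _).symm)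
    exact hcomp_assoc T.extCell (cart (𝟙 E) T.t) (cart j (𝟙 E)) rfl rfl rfl rfl
  refine (comp_pair_gcomp _ _ _ _ _).trans ?_
  rw [e₁]
  refine (comp_pair_gcomp _ _ _ _ _).symm.trans ?_
  rw [U.mulCell_cell]
  exact comp_pair_cellId_left (resComp j (𝟙 E) T.t) U.cell U.cell rfl

/-- The source of `♭`: the universal property for the opalgebras `(t, †)` and `(k, ⋉)`, with
mediating tight-cells `v` and the identity. -/
theorem existsUnique_flatCell :
    ∃! β : Cell (𝟙 O.B) (.pair (ehom (𝟙 E) O.v) (ehom j (𝟙 E))) O.a (looseId O.B),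
      comp (.pair₁ (resFactor (𝟙 E) O.v O.a O.a_comp_v) (cellId (ehom j (𝟙 E)))) β
        (Category.comp_id _) (Category.id_comp _) =
      resComp j (𝟙 E) T.t ⨾ O.toOpalgebra.cell :=
  O.existsUnique_single T.opalgebra O.toOpalgebra O.v (𝟙 O.B) O.a_comp_v (Category.comp_id _)
    O.isMediating_v O.toOpalgebra.isMediating_id (ehom j (𝟙 E)) O.a _
    (resComp_graded O.toOpalgebra)

/-- The 2-cell `E(1, v), E(j, 1) ⇒ B(1, 1)` corresponding to `♭`. -/
noncomputable def flatCell :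
    Cell (𝟙 O.B) (.pair (ehom (𝟙 E) O.v) (ehom j (𝟙 E))) O.a (looseId O.B) :=
  O.existsUnique_flatCell.choose

theorem resFactor_flatCell :
    comp (.pair₁ (resFactor (𝟙 E) O.v O.a O.a_comp_v) (cellId (ehom j (𝟙 E)))) O.flatCell
        (Category.comp_id _) (Category.id_comp _) =
      resComp j (𝟙 E) T.t ⨾ O.toOpalgebra.cell :=
  O.existsUnique_flatCell.choose_spec.1

/-- The 2-cell `B(k, 1) ⇒ E(1, 1)` corresponding to `♯`. -/
noncomputable def sharpCell : Cell O.v (.single (ehom O.a (𝟙 O.B))) j (looseId E) :=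
  hcompR (vcomp (cart O.a (𝟙 O.B)) (looseMap O.v) (Category.id_comp _) O.a_comp_v) T.unit

/-- The essential part of `flat_sharp`. By uniqueness of extensions along `k`, it is enough to
compare restrictions along `k`. The left-hand side then involves `⋉` followed by `v`, that is `†`;
composing `†` with `η` gives the canonical 2-cell, so both sides are the composition of `E(1, t)`
with `E(j, 1)`. -/
theorem flatCell_unit :
    hcompR (vcomp O.flatCell (looseMap O.v) (Category.id_comp _) O.a_comp_v) T.unit =
      hcomp₂ (cart (𝟙 E) O.v) (cart j (𝟙 E)) := by
  have e₀ : comp (.pair T.opalgebra.action (cellId (ehom j (𝟙 E))) rfl)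
      (hcomp₂ (cart (𝟙 E) T.t) (cart j (𝟙 E))) (Category.id_comp _) (Category.id_comp _) =
      hcomp T.opalgebra.cell (hcomp₂ (cart (𝟙 E) T.t) (cart j (𝟙 E))) rfl := by
    refine (comp_pair_cellId_right T.opalgebra.action (cart (𝟙 E) T.t) (cart j (𝟙 E)) rfl).trans ?_
    refine (congrArg (fun φ => hcomp φ (cart j (𝟙 E)) rfl) T.opalgebra.action_cart).trans ?_
    exact hcomp_assoc T.opalgebra.cell (cart (𝟙 E) T.t) (cart j (𝟙 E)) rfl rfl rfl rfl
  refine (O.existsUnique_single T.opalgebra T.opalgebra O.v O.v O.a_comp_v O.a_comp_v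
    O.isMediating_v O.isMediating_v (ehom j (𝟙 E)) j (hcomp₂ (cart (𝟙 E) T.t) (cart j (𝟙 E)))
    e₀).unique ?_ ?_
  · refine (comp_pair_hcompR _ _ _ _ _ O.a_comp_v (Category.id_comp _)
      (Category.id_comp _)).trans ?_
    rw [precomp_id]
    have e₁ := comp_pair_vcomp (resFactor (𝟙 E) O.v O.a O.a_comp_v) (cellId (ehom j (𝟙 E))) rfl
      O.flatCell (looseMap O.v) (Category.comp_id _) (Category.id_comp _) O.a_comp_v O.a_comp_v
      (Category.id_comp _) O.a_comp_v O.a_comp_v (Category.id_comp _)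
    refine (congrArg (hcompR · T.unit) e₁).trans ?_
    refine (congrArg (fun φ => hcompR (vcomp φ (looseMap O.v) O.a_comp_v O.a_comp_v) T.unit)
      O.resFactor_flatCell).trans ?_
    refine (congrArg (hcompR · T.unit) (gcomp_vcomp _ _ _ _ _).symm).trans ?_
    rw [O.cell_v, ← gcomp_hcomp, T.extCell_unit, resComp_cart]
    rfl
  · refine (comp_pair_hcomp _ _ _ _ _ O.a_comp_v (Category.id_comp _)
      (Category.id_comp _)).trans ?_
    exact congrArg₂ (fun φ ψ => hcomp φ ψ rfl) (resFactor_cart (𝟙 E) O.v O.a O.a_comp_v)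
      (cellId_vcomp _)

/-- The 2-cell `♯ : B(k, 1) ⇒ E(j, v)`. -/
noncomputable def sharp : Cell (𝟙 O.B) (.single (ehom O.a (𝟙 O.B))) (𝟙 A) (ehom j O.v) :=
  lift j O.v O.sharpCell (Category.id_comp _) (Category.id_comp _)

/-- The 2-cell `♭ : E(j, v) ⇒ B(k, 1)`. -/
noncomputable def flat : Cell (𝟙 O.B) (.single (ehom j O.v)) (𝟙 A) (ehom O.a (𝟙 O.B)) :=
  lift O.a (𝟙 O.B) (comp (.pair (toComp j O.v) (conjUnit j) (LoosePath.append_nil _)) O.flatCell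
    (Category.id_comp _) (Category.id_comp _)) (Category.id_comp _) (Category.id_comp _)

theorem sharp_cart : O.sharp ⨾ cart j O.v = O.sharpCell :=
  lift_cart ..

theorem flat_cart : O.flat ⨾ cart O.a (𝟙 O.B) =
    comp (.pair (toComp j O.v) (conjUnit j) (LoosePath.append_nil _)) O.flatCell
      (Category.id_comp _) (Category.id_comp _) :=
  lift_cart ..

/-- Evaluating `♯` on the identity of `k` gives `η`. This identifies the unit of the induced
adjunction and is the input to the Yoneda arguments below. -/
theorem conjUnit_sharpCell :
    vcomp (conjUnit O.a) O.sharpCell O.a_comp_v (Category.id_comp _) = T.unit := by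
  refine (vcomp_hcomp T.unit (conjUnit O.a) _ O.a_comp_v (Category.id_comp _)
    (Category.id_comp _)).symm.trans ?_
  rw [← vcomp_assoc (conjUnit O.a) (cart O.a (𝟙 O.B)) (looseMap O.v) (Category.comp_id _)
    (Category.id_comp _) O.a_comp_v O.a_comp_v, conjUnit_cart, tightId_looseMap]
  have : ∀ k (h : O.a ≫ O.v = k) (τ : TightCell j k), hcompR (tightId (O.a ≫ O.v) h h) τ = τ := by
    intro k h τ
    subst h
    exact tightId_hcomp τ
  exact this _ _ _

/-- By `conjUnit_ext` it suffices to evaluate on the identity of `k`, which `♯` sends to `η`. Then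
`♭` applies `⋉` to `η`, since `flatCell` restricts along `k` to composition followed by `⋉`, and the
unit law of the opalgebra concludes. -/
theorem sharp_flat : O.sharp ⨾ O.flat = cellId (ehom O.a (𝟙 O.B)) := by
  refine cart_ext (Category.id_comp _) (Category.id_comp _) ?_
  refine (gcomp_assoc _ _ _).trans ?_
  rw [cellId_vcomp, flat_cart]
  refine conjUnit_ext (Category.comp_id _) ?_
  rw [conjUnit_cart]
  set x := lift j O.v (g' := O.a) (f' := 𝟙 A) T.unit O.a_comp_v (Category.id_comp _) with hx
  have e₁ : vcomp (conjUnit O.a) O.sharp (Category.comp_id _) (Category.comp_id _) = x := by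
    refine cart_ext O.a_comp_v (Category.id_comp _) ?_
    refine (vcomp_assoc _ _ _ _ _ _ _ (Category.id_comp _) (Category.id_comp _) O.a_comp_v
      (Category.id_comp _)).trans ?_
    refine (congrArg (fun φ => vcomp (conjUnit O.a) φ O.a_comp_v (Category.id_comp _))
      O.sharp_cart).trans ?_
    rw [conjUnit_sharpCell, lift_cart]
  -- The same `η`, now as a 2-cell into `E(1, t)` rather than `E(j, v)`: in this form it lies above
  -- the restriction of `flatCell` along `k`. The two forms agree in `E(1, v)` by `e₂`.
  set y := lift (𝟙 E) T.t (g' := 𝟙 A) (f' := j) T.unit (Category.id_comp _)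
    (Category.comp_id _) with hy
  have e₂ : vcomp x (toComp j O.v) (Category.comp_id _) (Category.id_comp _) =
      vcomp y (resFactor (𝟙 E) O.v O.a O.a_comp_v) (Category.id_comp _) (Category.comp_id _) := by
    refine cart_ext O.a_comp_v (Category.comp_id _) ?_
    refine (vcomp_assoc _ _ _ _ _ _ _ (Category.id_comp _) (Category.comp_id _) O.a_comp_v
      (Category.id_comp _)).trans ?_
    refine Eq.trans ?_ (vcomp_assoc _ _ _ _ _ _ _ O.a_comp_v (Category.id_comp _)
      (Category.id_comp _) (Category.comp_id _)).symm
    rw [toComp_cart, resFactor_cart, lift_cart, lift_cart]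
  have e₃ : comp (.pair y (conjUnit j) rfl) (resComp j (𝟙 E) T.t) (Category.comp_id _)
      (Category.comp_id _) = T.unitCell := by
    refine cart_ext (Category.id_comp _) (Category.id_comp _) ?_
    refine (comp_pair_resComp _ _ _ (Category.id_comp _) (Category.comp_id _)
      (Category.id_comp _)).trans ?_
    rw [lift_cart, conjUnit_cart]
    exact (hcomp_tightId T.unit).trans T.unitCell_cart.symm
  refine (vcomp_assoc (conjUnit O.a) O.sharp _ (Category.comp_id _) (Category.comp_id _)
    (Category.comp_id _) (Category.id_comp _) _ _ _ _).symm.trans ?_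
  rw [e₁]
  have e₄ := comp_pair (.single x) (.nil (𝟙 A)) (LoosePath.append_nil _) (toComp j O.v)
    (conjUnit j) O.flatCell (Category.comp_id _) (Category.id_comp _) (Category.id_comp _)
    (Category.id_comp _) (Category.id_comp _) (Category.comp_id _) (Category.id_comp _)
  refine e₄.trans ?_
  have e₅ := comp_pair (.single y) (.single (conjUnit j)) rfl
    (resFactor (𝟙 E) O.v O.a O.a_comp_v) (cellId (ehom j (𝟙 E))) O.flatCell (Category.id_comp _)
    (Category.comp_id _) (Category.id_comp _) (Category.comp_id _) (Category.id_comp _)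
    (Category.id_comp _) (Category.id_comp _)
  have e₆ : comp (Row.nil (𝟙 A)) (conjUnit j) (Category.id_comp _) (Category.id_comp _) =
    conjUnit j := ids_comp _
  rw [e₆]
  rw [comp_cellId] at e₅
  refine (congrArg (fun φ => comp (.pair φ (conjUnit j) rfl) O.flatCell (Category.comp_id _)
    (Category.id_comp _)) e₂).trans ?_
  refine e₅.symm.trans ?_
  refine (congrArg (fun φ => comp (.pair y (conjUnit j) rfl) φ (Category.id_comp _)
    (Category.id_comp _)) O.resFactor_flatCell).trans ?_
  refine (comp_pair_vcomp y (conjUnit j) rfl (resComp j (𝟙 E) T.t) O.toOpalgebra.cell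
    (Category.comp_id _) (Category.comp_id _) (Category.id_comp _) (Category.id_comp _) _ _ _
    _).trans ?_
  rw [e₃]
  exact O.toOpalgebra.unitCell_cell

/-- Unfolding leaves `flatCell` followed by `v` and `η`, evaluated on the unit of `E(j, 1)`;
`flatCell_unit` replaces this by plain composition, for which the unit acts as an identity. -/
theorem flat_sharp : O.flat ⨾ O.sharp = cellId (ehom j O.v) := by
  refine cart_ext (Category.id_comp _) (Category.id_comp _) ?_
  refine (gcomp_assoc _ _ _).trans ?_
  rw [cellId_vcomp, sharp_cart, sharpCell, gcomp_hcomp, gcomp_vcomp, flat_cart]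
  have e₁ := comp_pair_vcomp (toComp j O.v) (conjUnit j) (LoosePath.append_nil _)
      O.flatCell (looseMap O.v) (Category.id_comp _) (Category.id_comp _) (Category.id_comp _)
      O.a_comp_v (Category.id_comp _) O.a_comp_v (Category.id_comp _) (Category.id_comp _)
  refine (congrArg (hcompR · T.unit) e₁.symm).trans ?_
  have e₂ := comp_pair_hcompR (toComp j O.v) (conjUnit j) (LoosePath.append_nil _)
    (vcomp O.flatCell (looseMap O.v) (Category.id_comp _) O.a_comp_v) T.unit (Category.id_comp _)
    (Category.id_comp _) (Category.id_comp _)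
  rw [precomp_id] at e₂
  refine e₂.symm.trans ?_
  rw [flatCell_unit]
  refine (comp_pair_hcomp _ _ _ _ _ (Category.id_comp _) (Category.comp_id _)
      (Category.id_comp _)).trans ?_
  rw [toComp_cart, conjUnit_cart]
  exact hcomp_tightId _

/-- The relative adjunction `k ⊣ v` induced by an opalgebra object. -/
noncomputable def adj : RelAdj j :=
  ⟨O.B, O.a, O.v, O.sharp, O.flat, O.sharp_flat, O.flat_sharp⟩

theorem adj_s : O.adj.s = O.sharpCell :=
  O.sharp_cart

end OpalgebraObject

end InducedAdjunction

/-! ### Morphisms of relative monads with identity 2-cell -/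

section EqToHom

variable {X : Type u} [Category.{v} X] [VirtualEquipment.{w, z} X] {A E : X} {j : A ⟶ E}

/-- When the 2-cell is an identity, the unit law says that the units coincide and the extension law
that the extension operators coincide. The other fields are propositions. -/
theorem RelMonadHom.exists_eq_eqToHom {S T : RelMonad j} (f : S ⟶ T) (h : S.t = T.t)
    (hf : RelMonadHom.τ f = tightId S.t h rfl) : ∃ h : S = T, f = eqToHom h := by
  obtain ⟨t, e, η, h₁, h₂, h₃⟩ := S
  obtain ⟨t', e', η', h₁', h₂', h₃'⟩ := T
  obtain ⟨τ, hη, he⟩ := f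
  dsimp only at h hf
  subst h hf
  have hη' : η = η' := (tightId_hcomp η).symm.trans hη
  have he' : e = e' := by
    rw [resMapR_tightId, resMapR_tightId, resMapL_tightId] at he
    exact (vcomp_cellId e).symm.trans (he.trans ((vcomp_cellId _).trans (cellId_vcomp _)))
  subst hη' he'
  exact ⟨rfl, rfl⟩

theorem RelMonadHom.τ_eqToHom {S T : RelMonad j} (h : S = T) :
    RelMonadHom.τ (eqToHom h) = tightId S.t (congrArg RelMonad.t h) rfl := by
  subst h
  rfl

end EqToHom

/-! ### The relative monad induced by `k ⊣ v` is `T` -/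

section InducedMonad

variable {X : Type u} [Category.{v} X] [VirtualEquipment.{w, z} X] {A E : X} {j : A ⟶ E}

/-- A relative adjunction `ℓ ⊣ r` induces `T` if the extension operator of `T` is the image under
`r` of a 2-cell `E(j, t) ⇒ C(ℓ, ℓ)` and the units agree. -/
theorem RelAdj.monad_eq_and_e_eq (L : RelAdj j) (T : RelMonad j) (h : L.ℓ ≫ L.r = T.t)
    (e : Cell L.ℓ (.single (ehom j T.t)) L.ℓ (looseId L.apex))
    (he : vcomp e (looseMap L.r) h h = T.extCell)
    (hu : vcomp L.ι L.s h (Category.id_comp j) = T.unit) :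
    L.monad = T ∧ resMapR j (tightId T.t h.symm rfl) ⨾ L.e = e := by
  obtain ⟨t, e', η, h₁, h₂, h₃⟩ := T
  dsimp only at h
  subst h
  have hη : L.unit = η := hu
  subst hη
  -- Postcomposition with `♯` is injective. It sends `e` to its image under `r` composed with the
  -- unit, that is `†` composed with `η`, hence to the cartesian 2-cell, which is also the image of
  -- `L.lamFlat`. So `e` must be `L.e`.
  have key : lift L.ℓ (𝟙 L.apex) e (Category.comp_id _) (Category.id_comp _) = L.lamFlat := by
    refine L.s_cancel rfl (Category.id_comp j) ?_
    rw [L.lift_s_unit, he, L.lamFlat_s]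
    exact RelMonad.extCell_unit _
  have he₁ : e = L.e := by
    rw [RelAdj.e, ← key, lift_cart]
  subst he₁
  have he' : L.ext = e' :=
    cart_ext (Category.id_comp _) (Category.id_comp _) (L.ext_cart.trans he)
  subst he'
  exact ⟨rfl, by rw [resMapR_tightId, cellId_gcomp]⟩

namespace OpalgebraObject

variable {T : RelMonad j} (O : OpalgebraObject T)

theorem ι_adj_s : vcomp O.adj.ι O.adj.s O.a_comp_v (Category.id_comp _) = T.unit := by
  rw [adj_s]
  exact O.conjUnit_sharpCell

theorem adj_monad : O.adj.monad = T :=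
  (O.adj.monad_eq_and_e_eq T O.a_comp_v O.toOpalgebra.cell O.cell_v O.ι_adj_s).1

/-- The opalgebra structure which the adjunction puts on `k` is `⋉`, up to the identity 2-cell
mediating `k ≫ v = t`. Needed to see that the tight-cell of a right-morphism is mediating. -/
theorem resMapR_adj_e :
    resMapR j (tightId T.t O.a_comp_v.symm rfl) ⨾ O.adj.e = O.toOpalgebra.cell :=
  (O.adj.monad_eq_and_e_eq T O.a_comp_v O.toOpalgebra.cell O.cell_v O.ι_adj_s).2

end OpalgebraObject

end InducedMonad

/-! ### Restriction of opalgebras along morphisms, and opalgebras from adjunctions -/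

section Transposition

variable {X : Type u} [Category.{v} X] [VirtualEquipment.{w, z} X] {A E : X} {j : A ⟶ E}

/-- Read as: `σ` is a morphism of opalgebras for the source, from its own `(t, †)` to the
restriction along `σ` of that of the target. -/
theorem RelMonadHom.extCell_comp {S T : RelMonad j} (σ : RelMonadHom S T) :
    hcompL σ.τ S.extCell = hcompR (resMapR j σ.τ ⨾ T.extCell) σ.τ := by
  have h := congrArg (· ⨾ cart S.t T.t) σ.ext_comp
  rw [gcomp_assoc, resMapR_cart, hcomp_gcomp, gcomp_assoc, resMapL_cart, gcomp_hcomp,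
    gcomp_assoc] at h
  exact h

theorem RelMonadHom.unitCell_resMapR {S T : RelMonad j} (σ : RelMonadHom S T) :
    S.unitCell ⨾ resMapR j σ.τ = T.unitCell := by
  rw [RelMonad.unitCell, gcomp_assoc, ← resMapR_hcomp, σ.unit_comp]
  rfl

/-- With `unitCell_resMapR`, this says that `E(j, σ)` preserves units and multiplications, so
opalgebras restrict along `σ`. It follows from the extension law by moving `σ` across the middle of
the composite. -/
theorem RelMonadHom.mulCell_resMapR {S T : RelMonad j} (σ : RelMonadHom S T) :
    S.mulCell ⨾ resMapR j σ.τ = comp (.pair₁ (resMapR j σ.τ) (resMapR j σ.τ)) T.mulCell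
      (Category.id_comp _) (Category.id_comp _) := by
  refine cart_ext (Category.id_comp _) (Category.id_comp _) ?_
  refine (gcomp_assoc _ _ _).trans ?_
  refine Eq.trans ?_ (comp_pair_gcomp _ _ _ _ _)
  rw [resMapR_cart, hcomp_gcomp, S.mulCell_cart, T.mulCell_cart,
    comp_pair_hcomp _ _ _ _ _ (Category.id_comp _) (Category.id_comp _) (Category.id_comp _)]
  refine (hcomp_assoc σ.τ S.extCell (cart j S.t) rfl rfl rfl rfl).symm.trans ?_
  refine (congrArg (fun φ => hcomp φ (cart j S.t) rfl) σ.extCell_comp).trans ?_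
  refine (hcomp_assoc _ σ.τ (cart j S.t) _ _ rfl rfl).trans ?_
  exact congrArg (fun φ => hcomp (resMapR j σ.τ ⨾ T.extCell) φ rfl) (resMapR_cart j σ.τ).symm

/-- Restriction of an opalgebra along a morphism of relative monads. -/
noncomputable def Opalgebra.pullback {S T : RelMonad j} (σ : RelMonadHom S T) (U : Opalgebra T) :
    Opalgebra S :=
  ofCell (resMapR j σ.τ ⨾ U.cell)
    (by rw [← gcomp_assoc, σ.unitCell_resMapR, U.unitCell_cell])
    (by
      rw [← gcomp_assoc, σ.mulCell_resMapR]
      refine (comp_pair_gcomp _ _ _ _ _).symm.trans ?_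
      rw [U.mulCell_cell]
      exact comp_pair_hcomp _ _ _ _ _ _ _ _)

theorem Opalgebra.pullback_cell {S T : RelMonad j} (σ : RelMonadHom S T) (U : Opalgebra T) :
    (U.pullback σ).cell = resMapR j σ.τ ⨾ U.cell :=
  ofCell_cell ..

namespace RelAdj

variable (L : RelAdj j)

theorem extCell_monad : L.monad.extCell = vcomp L.e (looseMap L.r) rfl rfl :=
  L.ext_cart

theorem unitCell_e : L.monad.unitCell ⨾ L.e = tightId L.ℓ rfl rfl := by
  have h : vcomp L.monad.unitCell L.lamFlat (Category.id_comp _) (Category.id_comp _) = L.ι := by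
    refine L.s_cancel rfl (Category.id_comp _) ?_
    refine (vcomp_assoc _ L.lamFlat L.s (Category.id_comp _) (Category.id_comp _) rfl
      (Category.id_comp _) rfl (Category.id_comp _) (Category.id_comp _)
      (Category.id_comp _)).trans ?_
    rw [lamFlat_s]
    exact L.monad.unitCell_cart
  rw [← L.ι_cart, ← h]
  exact gcomp_vcomp _ _ _ _ _

/-- Since `♯` can be cancelled, compare images under it: both are the extension operator composed
with the cartesian 2-cell, by `lift_s` on the right-hand side. -/
theorem mulCell_e : L.monad.mulCell ⨾ L.e = hcomp₂ L.e L.e := by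
  have h : vcomp L.monad.mulCell L.lamFlat (Category.id_comp _) (Category.id_comp _) =
      lift L.ℓ (𝟙 L.apex) (hcomp₂ L.e L.e) (Category.comp_id _) (Category.id_comp _) := by
    refine L.s_cancel rfl (Category.id_comp _) ?_
    refine Eq.trans ?_ (L.lift_s L.e L.lamFlat _ (Category.id_comp _) rfl rfl
      (Category.id_comp _)).symm
    refine (vcomp_assoc _ L.lamFlat L.s (Category.id_comp _) (Category.id_comp _) rfl
      (Category.id_comp _) rfl (Category.id_comp _) (Category.id_comp _)
      (Category.id_comp _)).trans ?_
    rw [lamFlat_s, ← extCell_monad]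
    exact L.monad.mulCell_cart
  refine (gcomp_vcomp L.monad.mulCell L.lamFlat (cart L.ℓ (𝟙 L.apex)) _ _).trans ?_
  refine (congrArg (fun φ => vcomp φ (cart L.ℓ (𝟙 L.apex)) (Category.comp_id _)
    (Category.id_comp _)) h).trans ?_
  exact lift_cart ..

/-- The left adjoint of a relative adjunction is an opalgebra for the induced relative monad. -/
noncomputable def opalgebra : Opalgebra L.monad :=
  .ofCell L.e L.unitCell_e L.mulCell_e

theorem opalgebra_cell : L.opalgebra.cell = L.e :=
  Opalgebra.ofCell_cell ..

theorem pullback_opalgebra_cell {T : RelMonad j} (σ : RelMonadHom T L.monad) :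
    (L.opalgebra.pullback σ).cell = resMapR j σ.τ ⨾ L.e :=
  (Opalgebra.pullback_cell σ L.opalgebra).trans (congrArg (resMapR j σ.τ ⨾ ·) L.opalgebra_cell)

/-- Applying `r` to the restricted opalgebra on `ℓ` gives the restriction of `(t, †)`, which is the
target of `σ` as a morphism of opalgebras. -/
theorem pullback_opalgebra_map_cell {T : RelMonad j} (σ : RelMonadHom T L.monad) :
    ((L.opalgebra.pullback σ).map (C := E) L.r rfl).cell = resMapR j σ.τ ⨾ L.monad.extCell := by
  refine (Opalgebra.map_cell (L.opalgebra.pullback σ) L.r rfl).trans ?_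
  refine (congrArg (fun φ => vcomp φ (looseMap L.r) rfl rfl)
    (L.pullback_opalgebra_cell σ)).trans ?_
  rw [L.extCell_monad]
  exact (gcomp_vcomp _ _ _ _ _).symm

end RelAdj

theorem IsMediating.map {T : RelMonad j} {U V : Opalgebra T} {c : U.B ⟶ V.B}
    (hc : IsMediating U V c) {C : X} (d : V.B ⟶ C) {a' : A ⟶ C} (h : V.a ≫ d = a') :
    IsMediating U (V.map d h) (c ≫ d) := by
  obtain ⟨h₁, h₂⟩ := (Opalgebra.isMediating_iff _ _ _).1 hc
  have h₃ : U.a ≫ c ≫ d = a' := by rw [← Category.assoc, h₁, h]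
  refine (Opalgebra.isMediating_iff _ _ _).2 ⟨h₃, ?_⟩
  refine Eq.trans ?_ (V.map_cell d h).symm
  rw [← h₂]
  refine (congrArg (fun φ => vcomp U.cell φ h₃ h₃) (looseMap_comp c d).symm).trans ?_
  exact (vcomp_assoc _ _ _ _ _ _ _ _ _ _ _).symm

/-! ### Bijectivity of transposition, strict morphisms and initiality -/

namespace OpalgebraObject

variable {T : RelMonad j} (O : OpalgebraObject T) {R : RelAdj j}

theorem hom_ℓ_comp (f : O.adj ⟶ R) : O.a ≫ RightMor.c f = R.ℓ :=
  RightMor.ℓ_comp f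

theorem hom_ℓ_comp_r (f : O.adj ⟶ R) : O.a ≫ RightMor.c f ≫ R.r = R.ℓ ≫ R.r :=
  (Category.assoc _ _ _).symm.trans (congrArg (· ≫ R.r) (O.hom_ℓ_comp f))

variable (R) in
/-- Transposition of right-morphisms out of the relative adjunction induced by an opalgebra
object. -/
noncomputable def transpose (f : O.adj ⟶ R) : T ⟶ R.monad :=
  eqToHom O.adj_monad.symm ≫ RightMor.transpose f

theorem τ_transpose' (f : O.adj ⟶ R) : RelMonadHom.τ (O.transpose R f) =
    hcompL (RightMor.transposeCell f) (tightId T.t O.a_comp_v.symm rfl) :=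
  congrArg (hcompL _) (RelMonadHom.τ_eqToHom O.adj_monad.symm)

theorem τ_transpose (f : O.adj ⟶ R) : RelMonadHom.τ (O.transpose R f) =
    precomp O.a (RightMor.ρ f) (O.hom_ℓ_comp_r f) O.a_comp_v := by
  have key : ∀ k (h : O.a ≫ O.v = k) (h' : k = O.a ≫ O.v),
      hcompL (precomp O.a (RightMor.ρ f) (O.hom_ℓ_comp_r f) rfl) (tightId k h' rfl) =
        precomp O.a (RightMor.ρ f) (O.hom_ℓ_comp_r f) h := by
    intro k h h'
    subst h
    exact hcomp_tightId _
  exact (O.τ_transpose' f).trans (key _ O.a_comp_v O.a_comp_v.symm)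

/-- The tight-cell of a right-morphism is determined by its transpose: by `e_pushMap` it carries the
opalgebra structure on `k`, which is `⋉`, to the structure on `ℓ'` restricted along the transpose.
-/
theorem isMediating_c (f : O.adj ⟶ R) :
    IsMediating O.toOpalgebra (R.opalgebra.pullback (O.transpose R f)) (RightMor.c f) := by
  refine (Opalgebra.isMediating_iff _ _ _).2 ⟨O.hom_ℓ_comp f, ?_⟩
  refine Eq.trans ?_ (R.pullback_opalgebra_cell (O.transpose R f)).symm
  rw [O.τ_transpose' f]
  have h₁ : resMapR j (hcompL (RightMor.transposeCell f) (tightId T.t O.a_comp_v.symm rfl)) ⨾ R.e =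
      resMapR j (tightId T.t O.a_comp_v.symm rfl) ⨾
        (resMapR j (RightMor.transposeCell f) ⨾ R.e) := by
    rw [resMapR_hcomp]
    exact gcomp_assoc _ _ _
  refine Eq.trans ?_ h₁.symm
  refine Eq.trans ?_ (congrArg (resMapR j (tightId T.t O.a_comp_v.symm rfl) ⨾ ·) (e_pushMap f))
  rw [← resMapR_adj_e]
  exact (gcomp_vcomp _ _ _ _ _).symm

/-- The tight-cells `v` and `c ≫ r'` mediate for `(t, †)` and for the image of the restricted
opalgebra under `r'`, and `σ` is a morphism between these two; the trivially graded universal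
property extends it along `k`. -/
theorem existsUnique_ρ (σ : T ⟶ R.monad) (c : O.B ⟶ R.apex)
    (hc : IsMediating O.toOpalgebra (R.opalgebra.pullback σ) c)
    (h : O.a ≫ c ≫ R.r = R.ℓ ≫ R.r) :
    ∃! ρ : TightCell O.v (c ≫ R.r), precomp O.a ρ h O.a_comp_v = RelMonadHom.τ σ := by
  refine O.existsUnique_tightCell O.a_comp_v h O.isMediating_v (hc.map R.r rfl)
    (RelMonadHom.τ σ) ?_
  refine (RelMonadHom.extCell_comp σ).trans ?_
  exact congrArg (hcompR · (RelMonadHom.τ σ)) (R.pullback_opalgebra_map_cell σ).symm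

variable (R) in
theorem transpose_injective : Function.Injective (O.transpose R) := by
  intro f g hfg
  have hc : RightMor.c f = RightMor.c g :=
    (O.existsUnique_mediating (R.opalgebra.pullback (O.transpose R f))).unique
      (O.isMediating_c f) (hfg ▸ O.isMediating_c g)
  have hf := O.τ_transpose f
  have hg := O.τ_transpose g
  rw [← hfg] at hg
  -- The type of `ρ` depends on `c`, so the comparison is heterogeneous and `c` is generalised
  -- before its equation is eliminated.
  have key : ∀ (c : O.B ⟶ R.apex) (h : O.a ≫ c ≫ R.r = R.ℓ ≫ R.r) (ρ : TightCell O.v (c ≫ R.r)),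
      RelMonadHom.τ (O.transpose R f) = precomp O.a ρ h O.a_comp_v → RightMor.c f = c →
        HEq (RightMor.ρ f) ρ := by
    intro c h ρ hρ hc
    subst hc
    exact heq_of_eq ((O.existsUnique_ρ (O.transpose R f) _ (O.isMediating_c f) h).unique
      hf.symm hρ.symm)
  exact RightMor.ext_heq hc (key _ _ _ hg hc)

/-- Compatibility with `♯` costs nothing: by Yoneda it can be tested on the identity of `k`, where
it reads `σ` composed with `η` equals the unit of the target. -/
theorem compat_of_precomp_eq (σ : T ⟶ R.monad) (c : O.B ⟶ R.apex) (h₁ : O.a ≫ c = R.ℓ)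
    (h₂ : O.a ≫ c ≫ R.r = R.ℓ ≫ R.r) (ρ : TightCell O.v (c ≫ R.r))
    (hρ : precomp O.a ρ h₂ O.a_comp_v = RelMonadHom.τ σ) :
    hcompL ρ O.adj.s = vcomp (pushMap O.adj.ℓ c h₁) R.s rfl (Category.id_comp j) := by
  refine conjUnit_ext (f := O.a) h₂ ?_
  refine (precomp_hcomp_vcomp ρ (conjUnit O.a) O.adj.s h₂ O.a_comp_v
    (Category.id_comp _)).symm.trans ?_
  refine (congrArg (fun φ => hcompL φ (vcomp (conjUnit O.a) O.adj.s O.a_comp_v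
    (Category.id_comp _))) hρ).trans ?_
  refine (congrArg (hcompL (RelMonadHom.τ σ)) O.ι_adj_s).trans ?_
  refine (RelMonadHom.unit_comp σ).trans ?_
  refine Eq.trans ?_ (vcomp_assoc O.adj.ι (pushMap O.adj.ℓ c h₁) R.s h₁ (Category.comp_id _) rfl
    (Category.id_comp j) rfl (Category.id_comp _) h₂ (Category.id_comp _))
  exact congrArg (fun φ => vcomp φ R.s rfl (Category.id_comp j))
    (ι_pushMap (L := O.adj) (R := R) c h₁).symm

/-- The right-morphism with given underlying 2-cells. -/
noncomputable def homMk (σ : T ⟶ R.monad) (c : O.B ⟶ R.apex) (h₁ : O.a ≫ c = R.ℓ)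
    (h₂ : O.a ≫ c ≫ R.r = R.ℓ ≫ R.r) (ρ : TightCell O.v (c ≫ R.r))
    (hρ : precomp O.a ρ h₂ O.a_comp_v = RelMonadHom.τ σ) : O.adj ⟶ R :=
  (⟨c, h₁, ρ, (compat_iff (L := O.adj) c h₁ ρ).2 (O.compat_of_precomp_eq σ c h₁ h₂ ρ hρ)⟩ :
    RightMor O.adj R)

theorem transpose_homMk (σ : T ⟶ R.monad) (c : O.B ⟶ R.apex) (h₁ : O.a ≫ c = R.ℓ)
    (h₂ : O.a ≫ c ≫ R.r = R.ℓ ≫ R.r) (ρ : TightCell O.v (c ≫ R.r))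
    (hρ : precomp O.a ρ h₂ O.a_comp_v = RelMonadHom.τ σ) :
    O.transpose R (O.homMk σ c h₁ h₂ ρ hρ) = σ :=
  RelMonadHom.ext ((O.τ_transpose _).trans hρ)

variable (R) in
theorem transpose_surjective : Function.Surjective (O.transpose R) := by
  intro σ
  obtain ⟨c, hc, -⟩ := O.existsUnique_mediating (R.opalgebra.pullback σ)
  have h₁ : O.a ≫ c = R.ℓ := hc.choose
  have h₂ : O.a ≫ c ≫ R.r = R.ℓ ≫ R.r :=
    (Category.assoc _ _ _).symm.trans (congrArg (· ≫ R.r) h₁)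
  obtain ⟨ρ, hρ, -⟩ := O.existsUnique_ρ σ c hc h₂
  exact ⟨_, O.transpose_homMk σ c h₁ h₂ ρ hρ⟩

variable (R) in
theorem transpose_bijective : Function.Bijective (O.transpose R) :=
  ⟨O.transpose_injective R, O.transpose_surjective R⟩

variable (R) in
/-- The bijection between right-morphisms and morphisms of relative monads. -/
noncomputable def transposeEquiv : (O.adj ⟶ R) ≃ (T ⟶ R.monad) :=
  Equiv.ofBijective _ (O.transpose_bijective R)

theorem transpose_symm (σ : T ⟶ R.monad) : O.transpose R ((O.transposeEquiv R).symm σ) = σ :=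
  (O.transposeEquiv R).apply_symm_apply σ

theorem transpose_comp {R' : RelAdj j} (f : O.adj ⟶ R) (g : R ⟶ R') :
    O.transpose R' (f ≫ g) = O.transpose R f ≫ (oslash j).map g := by
  refine Eq.trans ?_ (Category.assoc _ _ _).symm
  exact congrArg (eqToHom O.adj_monad.symm ≫ ·) ((oslash j).map_comp f g)

theorem transpose_id : O.transpose O.adj (𝟙 O.adj) = eqToHom O.adj_monad.symm :=
  (congrArg (eqToHom O.adj_monad.symm ≫ ·) ((oslash j).map_id O.adj)).trans (Category.comp_id _)

theorem tightId_eq_tightId {x e : X} {f g h : x ⟶ e} (h₁ : f = g) (h₂ : f = h) (h₃ : h = g) :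
    tightId (X := X) f h₁ h₂ = tightId h h₃ rfl := by
  subst h₂
  rfl

/-- An identity `ρ` restricts to an identity along `k`, which forces the relative monads to be
equal. Conversely, an identity transpose makes `c ≫ r'` mediate for `(t, †)`, hence equal to `v`;
then `ρ` and the identity have the same restriction along `k`. -/
theorem isStrict_iff (f : O.adj ⟶ R) :
    RightMor.IsStrict f ↔ ∃ h : T = R.monad, O.transpose R f = eqToHom h := by
  constructor
  · rintro ⟨h, hρ⟩
    have ht : T.t = R.ℓ ≫ R.r := by
      rw [← O.hom_ℓ_comp_r f, ← O.a_comp_v]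
      exact congrArg (O.a ≫ ·) h
    refine RelMonadHom.exists_eq_eqToHom (O.transpose R f) ht ?_
    rw [τ_transpose, hρ]
    refine (precomp_tightId O.a O.v h rfl _ O.a_comp_v).trans ?_
    exact tightId_eq_tightId _ _ _
  · rintro ⟨h, hf⟩
    subst h
    have hτ : RelMonadHom.τ (O.transpose R f) = tightId (R.ℓ ≫ R.r) rfl rfl :=
      congrArg RelMonadHom.τ hf
    have hc : O.v = RightMor.c f ≫ R.r := by
      refine (O.existsUnique_mediating R.monad.opalgebra).unique O.isMediating_v ?_
      obtain ⟨h₁, h₂⟩ := (Opalgebra.isMediating_iff _ _ _).1 ((O.isMediating_c f).map R.r rfl)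
      refine (Opalgebra.isMediating_iff _ _ _).2 ⟨h₁, h₂.trans ?_⟩
      refine (R.pullback_opalgebra_map_cell (O.transpose R f)).trans ?_
      refine (congrArg (fun φ => resMapR j φ ⨾ R.monad.extCell) hτ).trans ?_
      refine (congrArg (· ⨾ R.monad.extCell) (resMapR_tightId j (R.ℓ ≫ R.r))).trans ?_
      exact cellId_gcomp _
    refine ⟨hc, (O.existsUnique_ρ (O.transpose R f) _ (O.isMediating_c f)
      (O.hom_ℓ_comp_r f)).unique (O.τ_transpose f).symm ?_⟩
    refine Eq.trans ?_ hτ.symm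
    refine (precomp_tightId O.a O.v hc rfl _ O.a_comp_v).trans ?_
    exact tightId_eq_tightId _ _ _

/-- The resolution `k ⊣ v` given by an opalgebra object. -/
noncomputable def resolution : Resolution T :=
  ⟨O.adj, O.adj_monad.symm⟩

/-- A morphism of resolutions includes no condition on `♯`; out of `k ⊣ v` it nevertheless underlies
a strict right-morphism, since compatibility follows from the transpose being an identity. -/
theorem exists_strict (R : Resolution T) (m : O.resolution ⟶ R) :
    ∃ f : O.adj ⟶ R.adj, RightMor.c f = ResolutionHom.c m ∧ O.transpose R.adj f =
      eqToHom R.eq_monad := by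
  have h₁ : O.a ≫ ResolutionHom.c m = R.adj.ℓ := ResolutionHom.ℓ_comp m
  have h₂ : O.a ≫ ResolutionHom.c m ≫ R.adj.r = R.adj.ℓ ≫ R.adj.r :=
    (Category.assoc _ _ _).symm.trans (congrArg (· ≫ R.adj.r) h₁)
  have h₃ : O.v = ResolutionHom.c m ≫ R.adj.r := (ResolutionHom.comp_r m).symm
  have hρ : precomp O.a (tightId O.v h₃ rfl) h₂ O.a_comp_v =
      RelMonadHom.τ (eqToHom R.eq_monad) := by
    refine Eq.trans ?_ (RelMonadHom.τ_eqToHom R.eq_monad).symm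
    refine (precomp_tightId O.a O.v h₃ rfl _ O.a_comp_v).trans ?_
    exact tightId_eq_tightId _ _ _
  exact ⟨O.homMk (eqToHom R.eq_monad) _ h₁ h₂ _ hρ, rfl, O.transpose_homMk _ _ _ _ _ _⟩

/-- Morphisms of resolutions out of `k ⊣ v` correspond to right-morphisms with identity transpose,
of which there is exactly one. -/
theorem nonempty_isInitial_resolution : Nonempty (Limits.IsInitial O.resolution) := by
  have h : ∀ R : Resolution T, Nonempty (Unique (O.resolution ⟶ R)) := by
    intro R
    obtain ⟨f, hf⟩ := O.transpose_surjective R.adj (eqToHom R.eq_monad)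
    obtain ⟨h, -⟩ := (O.isStrict_iff f).2 ⟨R.eq_monad, hf⟩
    let m : O.resolution ⟶ R := (⟨RightMor.c f, RightMor.ℓ_comp f, h.symm⟩ : ResolutionHom _ _)
    refine ⟨⟨⟨m⟩, fun m' => ?_⟩⟩
    obtain ⟨f', hc, hf'⟩ := O.exists_strict R m'
    obtain rfl : f = f' := O.transpose_injective R.adj (hf.trans hf'.symm)
    exact ResolutionHom.ext hc.symm
  exact ⟨Limits.IsInitial.ofUnique (h := fun R => (h R).some) _⟩

end OpalgebraObject

/-- For a dense tight-cell, right-morphisms are determined by their tight-cells. -/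
theorem IsDense.existsUnique_rightMor (hj : IsDense j) {L R : RelAdj j} (c : L.apex ⟶ R.apex)
    (h : L.ℓ ≫ c = R.ℓ) : ∃! f : L ⟶ R, RightMor.c f = c := by
  -- As `♯` is invertible, compatibility prescribes `ρ` composed with `cart j L.r`, that is `E(j,
  -- ρ)`; density then provides exactly one such `ρ`.
  have key : ∀ ρ : TightCell L.r (c ≫ R.r),
      hcompL ρ (cart j L.r) = L.flat ⨾ vcomp (pushMap L.ℓ c h) R.s rfl (Category.id_comp j) ↔
        hcompL ρ L.s = vcomp (pushMap L.ℓ c h) R.s rfl (Category.id_comp j) := by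
    intro ρ
    constructor
    · intro hρ
      rw [RelAdj.s, ← hcomp_gcomp, hρ, ← gcomp_assoc, L.sharp_flat, cellId_gcomp]
    · intro hρ
      rw [← hρ, hcomp_gcomp, RelAdj.s, ← gcomp_assoc, L.flat_sharp, cellId_gcomp]
  obtain ⟨ρ, hρ, hρ'⟩ := hj.existsUnique
    (L.flat ⨾ vcomp (pushMap L.ℓ c h) R.s rfl (Category.id_comp j))
  refine ⟨(⟨c, h, ρ, (compat_iff c h ρ).2 ((key ρ).1 hρ)⟩ : RightMor L R), rfl, ?_⟩
  rintro ⟨c', h', ρ', hρ''⟩ hc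
  have hc' : c' = c := hc
  subst hc'
  obtain rfl : ρ' = ρ := hρ' ρ' ((key ρ').2 ((compat_iff _ h ρ').1 hρ''))
  rfl

end Transposition

/-! ### The section `S` -/

section Main

variable {X : Type u} [Category.{v} X] [VirtualEquipment.{w, z} X] {A E : X} {j : A ⟶ E}

/-- The functor sending a relative monad to the relative adjunction induced by its opalgebra
object. -/
noncomputable def opalgebraSection
    (K : ∀ T : (AdmitsOpalgebraObject j).FullSubcategory, OpalgebraObject T.obj) :
    (AdmitsOpalgebraObject j).FullSubcategory ⥤ RelAdj j where
  obj T := (K T).adj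
  -- The inverse transpose of `τ`. Functoriality is therefore checked after transposing, where it
  -- holds because `⊘_j` is a functor.
  map {T T'} τ := ((K T).transposeEquiv (K T').adj).symm
    (τ.hom ≫ eqToHom (K T').adj_monad.symm)
  map_id T := by
    refine (K T).transpose_injective _ ?_
    rw [(K T).transpose_symm, (K T).transpose_id]
    exact Category.id_comp _
  map_comp {T T' T''} σ τ := by
    refine (K T).transpose_injective _ ?_
    rw [(K T).transpose_symm, (K T).transpose_comp, (K T).transpose_symm]
    refine (Category.assoc _ _ _).trans (Eq.trans ?_ (Category.assoc _ _ _).symm)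
    exact congrArg (σ.hom ≫ ·) ((K T').transpose_symm _).symm

theorem transpose_opalgebraSection
    (K : ∀ T : (AdmitsOpalgebraObject j).FullSubcategory, OpalgebraObject T.obj)
    {T T' : (AdmitsOpalgebraObject j).FullSubcategory} (τ : T ⟶ T') :
    (K T).transpose _ ((opalgebraSection K).map τ) =
      τ.hom ≫ eqToHom (K T').adj_monad.symm :=
  (K T).transpose_symm _

/-- Objects agree on the nose by `adj_monad`, and on morphisms the definition through inverse
transposes gives `τ` conjugated by these equalities. -/
theorem opalgebraSection_comp_oslash
    (K : ∀ T : (AdmitsOpalgebraObject j).FullSubcategory, OpalgebraObject T.obj) :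
    opalgebraSection K ⋙ oslash j = (AdmitsOpalgebraObject j).ι := by
  refine CategoryTheory.Functor.ext (fun T => (K T).adj_monad) fun T T' τ => ?_
  have h : eqToHom (K T).adj_monad.symm ≫ (oslash j).map ((opalgebraSection K).map τ) =
    τ.hom ≫ eqToHom (K T').adj_monad.symm := transpose_opalgebraSection K τ
  have h' := congrArg (eqToHom (K T).adj_monad ≫ ·) h
  have key : ∀ {S₁ S₂ S₃ : RelMonad j} (e : S₁ = S₂) (g : S₁ ⟶ S₃),
      g = eqToHom e ≫ eqToHom e.symm ≫ g := by
    intro S₁ S₂ S₃ e g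
    subst e
    simp
  exact (key _ _).trans h'

end Main

end FormalCat

theorem mainTheorem8 {X : Type u} [Category.{v} X] [VirtualEquipment.{w, z} X] {A E : X}
    (j : A ⟶ E)
    (K : ∀ T : (AdmitsOpalgebraObject j).FullSubcategory, OpalgebraObject T.obj) :
    ∃ (S : (AdmitsOpalgebraObject j).FullSubcategory ⥤ RelAdj j)
      (hS : S ⋙ oslash j = (AdmitsOpalgebraObject j).ι),
      (∀ T, ∃ sharp flat h₁ h₂,
        S.obj T = ⟨(K T).B, (K T).a, (K T).v, sharp, flat, h₁, h₂⟩) ∧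
      (∀ T (R : RelAdj j), Function.Bijective (fun f : S.obj T ⟶ R =>
        (eqToHom (Functor.congr_obj hS T).symm ≫ (oslash j).map f :
          T.obj ⟶ (oslash j).obj R))) ∧
      (∀ T (R : RelAdj j) (f : S.obj T ⟶ R), RightMor.IsStrict f ↔
        ∃ h : T.obj = (oslash j).obj R,
          eqToHom (Functor.congr_obj hS T).symm ≫ (oslash j).map f = eqToHom h) ∧
      (∀ T, Nonempty (Limits.IsInitial
        (⟨S.obj T, (Functor.congr_obj hS T).symm⟩ : Resolution T.obj))) ∧
      (IsDense j → (S ⋙ leftAdjoint j).Full ∧ (S ⋙ leftAdjoint j).Faithful) := by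
  -- Proofs of equality of objects are irrelevant, so the composites with `eqToHom` in the statement
  -- are the transposition maps already studied.
  refine ⟨opalgebraSection K, opalgebraSection_comp_oslash K,
    fun T => ⟨_, _, _, _, rfl⟩, fun T R => (K T).transpose_bijective R,
    fun T R f => (K T).isStrict_iff f, fun T => (K T).nonempty_isInitial_resolution,
    fun hj => ⟨⟨fun {T T'} g => ?_⟩, ⟨fun {T T'} σ τ h => ?_⟩⟩⟩
  -- Fullness: density lifts the coslice morphism to a right-morphism `f`, and the transpose of `f`
  -- is the required preimage.
  · obtain ⟨f, hf, -⟩ := hj.existsUnique_rightMor (L := (K T).adj) (R := (K T').adj) g.right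
      (Under.w g)
    refine ⟨⟨(K T).transpose _ f ≫ eqToHom (K T').adj_monad⟩, ?_⟩
    have h : (opalgebraSection K).map
        (⟨(K T).transpose _ f ≫ eqToHom (K T').adj_monad⟩ : T ⟶ T') = f := by
      refine (K T).transpose_injective _ ?_
      rw [transpose_opalgebraSection]
      refine (Category.assoc _ _ _).trans ?_
      rw [eqToHom_trans]
      exact Category.comp_id _
    refine Under.UnderMorphism.ext ?_
    exact (congrArg RightMor.c h).trans hf
  -- Faithfulness: equal tight-cells give equal right-morphisms by density, hence equal transposes,
  -- and the isomorphism `eqToHom` cancels.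
  · have hc : RightMor.c ((opalgebraSection K).map σ) = RightMor.c ((opalgebraSection K).map τ) :=
      congrArg CommaMorphism.right h
    have hf : (opalgebraSection K).map σ = (opalgebraSection K).map τ :=
      (hj.existsUnique_rightMor (L := (K T).adj) (R := (K T').adj) _
        (RightMor.ℓ_comp ((opalgebraSection K).map τ))).unique hc rfl
    have h₁ := congrArg ((K T).transpose _) hf
    rw [transpose_opalgebraSection, transpose_opalgebraSection] at h₁
    exact ObjectProperty.hom_ext _ ((cancel_mono _).1 h₁)
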